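/- Let $d\ge 1$ and let $\mu$ be a probability measure on $\mathbb{R}$ all of whose moments are finite and which satisfies, for some constants $C,a\ge 1$, $$\int |x|^k\,d\mu(x)\le C\,a^k k^k\qquad\text{for all } k\in\mathbb{N}.$$ Let $\omega=(\omega_n)_{n\in\mathbb{Z}^d}$ be i.i.d. real random variables with law $\mu$, realised as the coordinates of $\mathbb{R}^{\mathbb{Z}^d}$ under $\mathbb{P}=\bigotimes_{n\in\mathbb{Z}^d}\mu$, with expectation $\mathbb{E}$. Let $H^\omega=\Delta+V^\omega$ on $\ell^2(\mathbb{Z}^d)$, where $(\Delta\psi)(n)=\sum_{|k-n|=1}\psi(k)$ with $|n|=\sum_i|n_i|$, and $(V^\omega\psi)(n)=\omega_n\psi(n)$; the domain of $H^\omega$ is $\{\psi\in\ell^2(\mathbb{Z}^d): V^\omega\psi\in\ell^2(\mathbb{Z}^d)\}$. For $L\in\mathbb{N}$ let $\Lambda_L=\{n\in\mathbb{Z}^d:|n_i|\le L \text{ for all } i\}$ and let $H^\omega_L=\chi_L H^\omega\chi_L$ be the compression of $H^\omega$ to $\ell^2(\Lambda_L)$. Denote by $\delta_n$ the standard basis vectors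 and by $E_T$ the projection-valued spectral measure of a self-adjoint operator $T$. Define the finite Borel measure $$\bar\nu(B)=\int_0^1\mathbb{E}\Big(\omega_0^2\,\big\langle\delta_0,E_{H^{\omega^{(u)}}}(B)\,\delta_0\big\rangle\Big)\,du ,$$ where $\omega^{(u)}$ is obtained from $\omega$ by replacing the single coordinate $\omega_0$ by $u\omega_0$ (the factor $\omega_0^2$ is not rescaled). Let $f:\mathbb{R}\to\mathbb{R}$ belong to $C^1_P(\mathbb{R})$, i.e. $f$ is differentiable, $f'$ is continuous, and $|f'(x)|\le P(x)$ for all $x\in\mathbb{R}$, for some polynomial $P$. Then for all $L\in\mathbb{N}$ and $n\in\Lambda_L$ the random variable $\langle\delta_n,f(H^\omega_L)\delta_n\rangle$ is integrable, the random variable $$X_{f,L}(\omega)=\frac{1}{|\Lambda_L|^{1/2}}\sum_{n\in\Lambda_L}\Big(\langle\delta_n,f(H^\omega_L)\delta_n\rangle-\mathbb{E}\big(\langle\delta_n,f(H^\omega_L)\delta_n\rangle\big)\Big)$$ is square-integrable, and $$0\le\sigma_f^2\le 8\,\|f'\|^2_{L^2(\bar\nu)}<\infty,\qquad\text{where}\quad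 \sigma_f^2=\limsup_{L\to\infty}\mathbb{E}\big(|X_{f,L}|^2\big).$$ -/

import Mathlib

open MeasureTheory Filter
open scoped ENNReal InnerProductSpace

noncomputable section

namespace Anderson

/-! ### Spectral measures of (unbounded) self-adjoint operators -/

/-- A projection-valued measure (resolution of the identity) on the Borel sets of `ℝ`: every
`proj B` is an orthogonal projection, `proj ∅ = 0`, `proj ℝ = 1`,
`proj (A ∩ B) = proj A * proj B`, and `proj` is countably additive in the strong operator
topology. The values of `proj` on sets that are not Borel are irrelevant. -/
structure ProjectionValuedMeasure (E : Type*) [NormedAddCommGroup E] [InnerProductSpace ℂ E]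
    [CompleteSpace E] where
  proj : Set ℝ → E →L[ℂ] E
  isStarProjection : ∀ B, MeasurableSet B → IsStarProjection (proj B)
  empty : proj ∅ = 0
  univ : proj Set.univ = 1
  inter : ∀ A B, MeasurableSet A → MeasurableSet B → proj (A ∩ B) = proj A * proj B
  iUnion : ∀ B : ℕ → Set ℝ, (∀ i, MeasurableSet (B i)) → Pairwise (Function.onFun Disjoint B) →
    ∀ ψ : E, HasSum (fun i => proj (B i) ψ) (proj (⋃ i, B i) ψ)

section PVM

variable {E : Type*} [NormedAddCommGroup E] [InnerProductSpace ℂ E] [CompleteSpace E]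

theorem ProjectionValuedMeasure.re_inner_nonneg (P : ProjectionValuedMeasure E) {B : Set ℝ}
    (hB : MeasurableSet B) (ψ : E) : 0 ≤ (⟪ψ, P.proj B ψ⟫_ℂ).re := by
  have h := P.isStarProjection B hB
  have h1 : P.proj B ψ = P.proj B (P.proj B ψ) := by
    conv_lhs => rw [← h.isIdempotentElem.eq]
    rfl
  have h2 : ContinuousLinearMap.adjoint (P.proj B) = P.proj B := h.isSelfAdjoint.star_eq
  rw [h1, ← ContinuousLinearMap.adjoint_inner_left, h2]
  exact inner_self_nonneg (𝕜 := ℂ)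

/-- The finite Borel measure `B ↦ ⟨ψ, P(B) ψ⟩`. -/
def ProjectionValuedMeasure.measureAt (P : ProjectionValuedMeasure E) (ψ : E) : Measure ℝ :=
  Measure.ofMeasurable (fun B _ => ENNReal.ofReal (⟪ψ, P.proj B ψ⟫_ℂ).re)
    (by simp [P.empty])
    (by
      intro B hB hd
      have h := ((P.iUnion B hB hd ψ).mapL (innerSL ℂ ψ)).mapL Complex.reCLM
      simp only [innerSL_apply_apply, Complex.reCLM_apply] at h
      rw [← h.tsum_eq]
      exact ENNReal.ofReal_tsum_of_nonneg (fun i => P.re_inner_nonneg (hB i) ψ) h.summable)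

theorem ProjectionValuedMeasure.measureAt_apply (P : ProjectionValuedMeasure E) (ψ : E)
    {B : Set ℝ} (hB : MeasurableSet B) :
    P.measureAt ψ B = ENNReal.ofReal (⟪ψ, P.proj B ψ⟫_ℂ).re :=
  Measure.ofMeasurable_apply B hB

/-- `P` is the projection-valued measure `E_T` of the operator `T`, that is `T = ∫ x dP(x)`:
the domain of `T` is `{ψ | ∫ x² d⟨ψ, P(x) ψ⟩ < ∞}`, and `⟨ψ, T ψ⟩ = ∫ x d⟨ψ, P(x) ψ⟩` on it
(by polarization the quadratic form determines `T`). -/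
def IsSpectralResolution (T : E →ₗ.[ℂ] E) (P : ProjectionValuedMeasure E) : Prop :=
  (∀ ψ : E, ψ ∈ T.domain ↔ ∫⁻ x, ENNReal.ofReal (x ^ 2) ∂(P.measureAt ψ) < ∞) ∧
  ∀ ψ : T.domain, ⟪(ψ : E), T ψ⟫_ℂ = ((∫ x, x ∂(P.measureAt (ψ : E)) : ℝ) : ℂ)

open Classical in
/-- The spectral measure `⟨ψ, E_T(·) ψ⟩` of the operator `T` at the vector `ψ`. The spectral
theorem provides a unique resolution for every self-adjoint `T`; the value for an operator
without a resolution is irrelevant. -/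
def spectralMeasure (T : E →ₗ.[ℂ] E) (ψ : E) : Measure ℝ :=
  if h : ∃ P : ProjectionValuedMeasure E, IsSpectralResolution T P then h.choose.measureAt ψ
  else 0

end PVM

/-! ### The Anderson model on `ℓ²(ℤᵈ)` -/

/-- The Hilbert space `ℓ²(ℤᵈ)`. -/
abbrev Ell2 (d : ℕ) : Type := lp (fun _ : Fin d → ℤ => ℂ) 2

/-- The basis vector `δ_n`. -/
def delta {d : ℕ} (n : Fin d → ℤ) : Ell2 d := lp.single 2 n (1 : ℂ)

/-- The vectors `e ∈ ℤᵈ` with `|e| = ∑ |e_i| = 1`; the neighbours of `n` are the `n + e`. -/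
def unitVectors (d : ℕ) : Finset (Fin d → ℤ) :=
  (Finset.Icc (fun _ => -1) (fun _ => 1)).filter (fun e => ∑ i, |e i| = 1)

theorem mem_unitVectors {d : ℕ} (e : Fin d → ℤ) : e ∈ unitVectors d ↔ ∑ i, |e i| = 1 := by
  simp only [unitVectors, Finset.mem_filter, Finset.mem_Icc, and_iff_right_iff_imp]
  intro h
  have hi : ∀ i, |e i| ≤ 1 := fun i => h ▸
    Finset.single_le_sum (f := fun i => |e i|) (fun j _ => abs_nonneg (e j)) (Finset.mem_univ i)
  exact ⟨fun i => (abs_le.1 (hi i)).1, fun i => (abs_le.1 (hi i)).2⟩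

theorem memlp_shift {d : ℕ} (e : Fin d → ℤ) (ψ : Ell2 d) :
    Memℓp (fun n : Fin d → ℤ => ψ (n + e)) 2 := by
  have h := lp.memℓp ψ
  rw [memℓp_gen_iff (by norm_num)] at h ⊢
  exact h.comp_injective (add_left_injective e)

theorem memlp_laplacian {d : ℕ} (ψ : Ell2 d) :
    Memℓp (fun n : Fin d → ℤ => ∑ e ∈ unitVectors d, ψ (n + e)) 2 := by
  have h := Memℓp.finsetSum (unitVectors d) (f := fun e (n : Fin d → ℤ) => ψ (n + e))
    (p := 2) (fun e _ => memlp_shift e ψ)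
  exact h

/-- The discrete Laplacian `(Δψ)(n) = ∑_{|k - n| = 1} ψ(k)`. -/
def laplacian (d : ℕ) : Ell2 d →ₗ[ℂ] Ell2 d where
  toFun ψ := ⟨fun n => ∑ e ∈ unitVectors d, ψ (n + e), memlp_laplacian ψ⟩
  map_add' ψ φ := by
    ext n
    simp only [lp.coeFn_add, Pi.add_apply, Finset.sum_add_distrib]
  map_smul' c ψ := by
    ext n
    simp [Finset.mul_sum]

/-- The potential `(Vψ)(n) = ω_n ψ(n)` on its maximal domain `{ψ ∈ ℓ² | Vψ ∈ ℓ²}`. -/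
def potential {d : ℕ} (ω : (Fin d → ℤ) → ℝ) : Ell2 d →ₗ.[ℂ] Ell2 d where
  domain :=
    { carrier := {ψ | Memℓp (fun n => (ω n : ℂ) * ψ n) 2}
      add_mem' := by
        intro ψ φ hψ hφ
        have h := hψ.add hφ
        simp only [Set.mem_ofPred_eq]
        convert h using 1
        ext n
        simp [mul_add]
      zero_mem' := by
        have h : Memℓp (0 : (Fin d → ℤ) → ℂ) 2 := zero_memℓp
        simp only [Set.mem_ofPred_eq]
        convert h using 1
        ext n
        simp
      smul_mem' := by
        intro c ψ hψ
        have h := hψ.const_smul c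
        simp only [Set.mem_ofPred_eq]
        convert h using 1
        ext n
        simp [mul_left_comm] }
  toFun :=
    { toFun := fun ψ => ⟨fun n => (ω n : ℂ) * (ψ : Ell2 d) n, ψ.2⟩
      map_add' := by
        intro ψ φ
        ext n
        simp only [Submodule.coe_add, lp.coeFn_add, Pi.add_apply, mul_add]
      map_smul' := by
        intro c ψ
        ext n
        simp [mul_left_comm] }

/-- The Anderson Hamiltonian `H^ω = Δ + V^ω`, with the domain of `V^ω`. -/
def hamiltonian {d : ℕ} (ω : (Fin d → ℤ) → ℝ) : Ell2 d →ₗ.[ℂ] Ell2 d where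
  domain := (potential ω).domain
  toFun := (laplacian d).comp (potential ω).domain.subtype + (potential ω).toFun

theorem delta_mem_domain {d : ℕ} (ω : (Fin d → ℤ) → ℝ) (n : Fin d → ℤ) :
    delta n ∈ (hamiltonian ω).domain := by
  change Memℓp (fun k => (ω k : ℂ) * (delta n : Ell2 d) k) 2
  have h := (lp.memℓp (delta n : Ell2 d)).const_smul (ω n : ℂ)
  convert h using 1
  ext k
  by_cases hk : k = n
  · subst hk
    simp
  · simp [delta, lp.single_apply, hk]

/-- The cube `Λ_L = {n ∈ ℤᵈ : |n_i| ≤ L}`. -/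
def box (d L : ℕ) : Finset (Fin d → ℤ) :=
  Finset.Icc (fun _ => -(L : ℤ)) (fun _ => (L : ℤ))

/-- The matrix `H^ω_L = χ_L H^ω χ_L` on `ℓ²(Λ_L)`, with entries `⟨δ_m, H^ω δ_n⟩`. -/
def boxHamiltonian {d : ℕ} (L : ℕ) (ω : (Fin d → ℤ) → ℝ) : Matrix (box d L) (box d L) ℂ :=
  Matrix.of fun m n =>
    ⟪(delta (m : Fin d → ℤ) : Ell2 d), hamiltonian ω ⟨delta n, delta_mem_domain ω n⟩⟫_ℂ

/-- The (real) random variable `⟨δ_n, f(H^ω_L) δ_n⟩`, `n ∈ Λ_L`, where `f(H^ω_L)` is given by the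
functional calculus of Hermitian matrices. -/
def diagEntry {d : ℕ} (f : ℝ → ℝ) (L : ℕ) (n : box d L) (ω : (Fin d → ℤ) → ℝ) : ℝ :=
  (cfc f (boxHamiltonian L ω) n n).re

/-- The law `ℙ = ⨂_{n ∈ ℤᵈ} μ` of the potential. -/
def law (d : ℕ) (μ : Measure ℝ) [IsProbabilityMeasure μ] : Measure ((Fin d → ℤ) → ℝ) :=
  Measure.infinitePi fun _ => μ

/-- `X_{f,L} = |Λ_L|^{-1/2} ∑_{n ∈ Λ_L} (⟨δ_n, f(H^ω_L) δ_n⟩ - 𝔼⟨δ_n, f(H^ω_L) δ_n⟩)`. -/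
def fluctuation (d : ℕ) (μ : Measure ℝ) [IsProbabilityMeasure μ] (f : ℝ → ℝ) (L : ℕ)
    (ω : (Fin d → ℤ) → ℝ) : ℝ :=
  (1 / Real.sqrt ((box d L).card : ℝ)) *
    ∑ n : box d L, (diagEntry f L n ω - ∫ ω', diagEntry f L n ω' ∂(law d μ))

/-- `σ_f² = limsup_{L → ∞} 𝔼(|X_{f,L}|²)`, as an extended nonnegative real. -/
def limsupVariance (d : ℕ) (μ : Measure ℝ) [IsProbabilityMeasure μ] (f : ℝ → ℝ) : ℝ≥0∞ :=
  limsup (fun L : ℕ => ∫⁻ ω, ‖fluctuation d μ f L ω‖ₑ ^ 2 ∂(law d μ)) atTop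

/-- The configuration obtained from `ω` by the replacement `ω_0 → u ω_0`. -/
def rescaleZero {d : ℕ} (u : ℝ) (ω : (Fin d → ℤ) → ℝ) : (Fin d → ℤ) → ℝ :=
  Function.update ω 0 (u * ω 0)

/-- The modified density of states measure
`ν̄(B) = ∫_0^1 𝔼(ω_0² ⟨δ_0, E_{H^ω}(B) δ_0⟩|_{ω_0 → u ω_0}) du`. The factor `ω_0²`, which is not
rescaled, is the density of the measure over which the spectral measures are averaged. -/
def modifiedDOS (d : ℕ) (μ : Measure ℝ) [IsProbabilityMeasure μ] : Measure ℝ :=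
  (volume.restrict (Set.Icc (0 : ℝ) 1)).bind fun u =>
    ((law d μ).withDensity fun ω => ENNReal.ofReal (ω 0 ^ 2)).bind fun ω =>
      spectralMeasure (hamiltonian (rescaleZero u ω)) (delta 0)

/-- The moment hypothesis: all moments of `μ` are finite, and there are `C, a ≥ 1` with
`∫ |x|^k dμ ≤ C a^k k^k` for every `k`. -/
def MomentHypothesis (μ : Measure ℝ) : Prop :=
  (∀ k : ℕ, Integrable (fun x => |x| ^ k) μ) ∧
  ∃ C a : ℝ, 1 ≤ C ∧ 1 ≤ a ∧ ∀ k : ℕ, ∫ x, |x| ^ k ∂μ ≤ C * a ^ k * (k : ℝ) ^ k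

/-- The class `C¹_P(ℝ)`: differentiable functions with a continuous derivative that is bounded
by a polynomial. -/
def IsC1P (f : ℝ → ℝ) : Prop :=
  Differentiable ℝ f ∧ Continuous (deriv f) ∧
    ∃ P : Polynomial ℝ, ∀ x, |deriv f x| ≤ P.eval x

end Anderson

end

/-!
# Variance bound for the trace fluctuations of the Anderson model

`X_{f,L}` is `|Λ_L|^{-1/2}` times the centred trace `Tr f(H_L)`, a function of the independent
variables `ω_n`, `n ∈ Λ_L`. By the Efron–Stein inequality (`lintegral_sub_mean_sq_le_sum`) its
variance is at most the sum over `n` of the mean square change caused by setting `ω_n` to `0`. The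
path from `ω_n = 0` to the actual value, `u ↦ u ω_n`, is a rank-one perturbation, along which the
derivative of `Tr f` is `ω_n ⟨δ_n, f'(H) δ_n⟩` (`trace_cfc_sub`, `traceStatistic_sub_update`). Two
applications of the Cauchy–Schwarz inequality bound the squared change by the average over `u` in
`[0, 1]` of `ω_n² ⟨δ_n, f'(H)² δ_n⟩`. As the law of the potential is translation invariant, the
expectation is the integral of `f'²` against the analogue of `ν̄` for the volume `Λ_L - n`
(`averagedMoment`, `lintegral_traceStatistic_le`). For all `n` but those near the boundary of `Λ_L`
this volume contains a large ball around `0`. Averaging over `n` thus gives in the limit at most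
`∫ f'² dν̄` (`limsup_average_le`), which is the claim with constant `1` instead of `8`.

It remains to see that the finite-volume averages converge to `∫ f'² dν̄`
(`tendsto_averagedMoment`). For a fixed potential, the compressions converge to `H^ω` on its domain,
hence in the strong resolvent sense (`IsResolvent.tendsto_embed`). The Stone–Weierstrass theorem
extends this to continuous functions of the resolvent, and the spectral measures at `δ_0` converge
when tested against these. Since `H` has hopping range one, the moments `⟨δ_0, H_Λ^j δ_0⟩` are
bounded uniformly in `Λ` by a polynomial in finitely many of the `|ω_n|`
(`integral_one_add_sq_pow_le`). This gives the convergence for functions of polynomial growth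
(`tendsto_integral_finiteMeasure`), and an integrable majorant for the average over the disorder.

The spectral measure of the unbounded operator `H^ω` enters through an arbitrarily chosen spectral
resolution. It is identified by the spectral theorem in the following form. A Neumann series shows
that `H^ω + iη` is invertible for large `η` (`exists_isResolvent_hamiltonian`). Its inverse `R` is a
bounded normal operator, and the continuous functional calculus with the Riesz–Markov theorem yields
spectral projections of `R` (`exists_isSpectralProjection`). Their image under `z ↦ re z⁻¹` is a
spectral resolution of `H^ω` (`IsResolvent.isSpectralResolution`). Any other spectral resolution
commutes with `R`, hence with these projections, and two commuting resolutions have the same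
spectral measures (`IsSpectralResolution.measureAt_eq`). It follows that the spectral measures
integrate functions of the resolvent in the expected way (`IsResolvent.integral_spectralMeasure`).
-/

noncomputable section

namespace Anderson

/-! ### Functional calculus of Hermitian matrices -/

section Matrix

variable {ι : Type*} [Fintype ι] [DecidableEq ι] {A : Matrix ι ι ℂ}

/-- The spectral measure `⟨δ_n, E_A(·) δ_n⟩` of a Hermitian matrix `A` at a basis vector: the
eigenvalues carry the squared moduli of the `n`-th components of the eigenvectors. -/
def matrixMeasure (hA : A.IsHermitian) (n : ι) : Measure ℝ :=
  ∑ i, ENNReal.ofReal (‖hA.eigenvectorUnitary.1 n i‖ ^ 2) • Measure.dirac (hA.eigenvalues i)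

theorem sum_norm_sq_eigenvectorUnitary (hA : A.IsHermitian) (n : ι) :
    ∑ i, ‖hA.eigenvectorUnitary.1 n i‖ ^ 2 = 1 := by
  have h := congrFun (congrFun (Matrix.mem_unitaryGroup_iff.1 hA.eigenvectorUnitary.2) n) n
  rw [Matrix.mul_apply] at h
  simp only [Matrix.star_apply, Matrix.one_apply_eq, RCLike.star_def, RCLike.mul_conj] at h
  apply Complex.ofReal_injective
  rw [Complex.ofReal_sum]
  simpa using h

instance isProbabilityMeasure_matrixMeasure (hA : A.IsHermitian) (n : ι) :
    IsProbabilityMeasure (matrixMeasure hA n) := by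
  constructor
  simp only [matrixMeasure, Measure.coe_finsetSum, Finset.sum_apply, Measure.smul_apply,
    measure_univ, smul_eq_mul, mul_one]
  rw [← ENNReal.ofReal_sum_of_nonneg (fun i _ => by positivity),
    sum_norm_sq_eigenvectorUnitary]
  simp

theorem integrable_matrixMeasure {E : Type*} [NormedAddCommGroup E] (hA : A.IsHermitian)
    (n : ι) (g : ℝ → E) : Integrable g (matrixMeasure hA n) := by
  unfold matrixMeasure
  rw [integrable_finsetSum_measure]
  intro i _
  exact (integrable_dirac (by simp)).smul_measure ENNReal.ofReal_ne_top

theorem integral_matrixMeasure {E : Type*} [NormedAddCommGroup E] [NormedSpace ℝ E]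
    [CompleteSpace E] (hA : A.IsHermitian) (n : ι) (g : ℝ → E) :
    ∫ x, g x ∂(matrixMeasure hA n) =
      ∑ i, ‖hA.eigenvectorUnitary.1 n i‖ ^ 2 • g (hA.eigenvalues i) := by
  unfold matrixMeasure
  rw [integral_finsetSum_measure]
  · simp [integral_smul_measure]
  · intro i _
    exact (integrable_dirac (by simp)).smul_measure ENNReal.ofReal_ne_top

/-- The function `g(A) = U diag(g(λ)) U*` of a Hermitian matrix, for a complex-valued `g`. -/
def hermitianFun (hA : A.IsHermitian) (g : ℝ → ℂ) : Matrix ι ι ℂ :=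
  hA.eigenvectorUnitary.1 * Matrix.diagonal (fun i => g (hA.eigenvalues i)) *
    star hA.eigenvectorUnitary.1

theorem hermitianFun_mul (hA : A.IsHermitian) (g h : ℝ → ℂ) :
    hermitianFun hA g * hermitianFun hA h = hermitianFun hA (fun x => g x * h x) := by
  unfold hermitianFun
  rw [← Matrix.diagonal_mul_diagonal]
  have h1 := Matrix.mem_unitaryGroup_iff'.1 hA.eigenvectorUnitary.2
  calc _ = hA.eigenvectorUnitary.1 * Matrix.diagonal (fun i => g (hA.eigenvalues i)) *
        (star hA.eigenvectorUnitary.1 * hA.eigenvectorUnitary.1) *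
        Matrix.diagonal (fun i => h (hA.eigenvalues i)) * star hA.eigenvectorUnitary.1 := by
        simp only [mul_assoc]
    _ = _ := by rw [h1]; simp only [mul_assoc, one_mul]

theorem hermitianFun_add (hA : A.IsHermitian) (g h : ℝ → ℂ) :
    hermitianFun hA g + hermitianFun hA h = hermitianFun hA (fun x => g x + h x) := by
  unfold hermitianFun
  rw [← Matrix.diagonal_add, mul_add, add_mul]

theorem hermitianFun_const (hA : A.IsHermitian) (c : ℂ) :
    hermitianFun hA (fun _ => c) = c • 1 := by
  unfold hermitianFun
  have h : (Matrix.diagonal fun _ : ι => c) = c • (1 : Matrix ι ι ℂ) := by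
    rw [Matrix.smul_one_eq_diagonal]
  rw [h, mul_smul_comm, mul_one, smul_mul_assoc,
    Matrix.mem_unitaryGroup_iff.1 hA.eigenvectorUnitary.2]

theorem hermitianFun_id (hA : A.IsHermitian) : hermitianFun hA (fun x => (x : ℂ)) = A := by
  conv_rhs => rw [hA.spectral_theorem]
  rfl

/-- The diagonal entries of `g(A)` are the integrals of `g` against the spectral measures. -/
theorem hermitianFun_apply_self (hA : A.IsHermitian) (g : ℝ → ℂ) (n : ι) :
    hermitianFun hA g n n = ∫ x, g x ∂(matrixMeasure hA n) := by
  rw [integral_matrixMeasure]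
  unfold hermitianFun
  rw [Matrix.mul_apply]
  refine Finset.sum_congr rfl fun i _ => ?_
  rw [Matrix.mul_diagonal, Matrix.star_apply, RCLike.star_def, mul_right_comm, RCLike.mul_conj,
    Complex.real_smul]
  push_cast
  rfl

theorem cfc_eq_hermitianFun (hA : A.IsHermitian) (g : ℝ → ℝ) :
    cfc g A = hermitianFun hA (fun x => (g x : ℂ)) := by
  rw [hA.cfc_eq]
  rfl

theorem cfc_apply_self (hA : A.IsHermitian) (g : ℝ → ℝ) (n : ι) :
    (cfc g A n n) = ((∫ x, g x ∂(matrixMeasure hA n) : ℝ) : ℂ) := by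
  rw [cfc_eq_hermitianFun hA, hermitianFun_apply_self]
  exact integral_ofReal

theorem re_cfc_apply_self (hA : A.IsHermitian) (g : ℝ → ℝ) (n : ι) :
    (cfc g A n n).re = ∫ x, g x ∂(matrixMeasure hA n) := by
  rw [cfc_apply_self hA, Complex.ofReal_re]

theorem pow_apply_self (hA : A.IsHermitian) (k : ℕ) (n : ι) :
    ((A ^ k) n n).re = ∫ x, x ^ k ∂(matrixMeasure hA n) := by
  rw [← re_cfc_apply_self hA]
  exact congrArg (fun M : Matrix ι ι ℂ => (M n n).re)
    (cfc_pow_id (R := ℝ) (p := IsSelfAdjoint) A k hA).symm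

theorem continuous_cfc_matrix {X : Type*} [TopologicalSpace X] {a : X → Matrix ι ι ℂ}
    (ha : Continuous a) (hh : ∀ x, (a x).IsHermitian) {g : ℝ → ℝ} (hg : Continuous g) :
    Continuous fun x => cfc g (a x) := by
  open scoped Matrix.Norms.L2Operator in
  exact Continuous.cfc_of_mem_nhdsSet (s := Set.univ) g Filter.univ_mem ha
    (fun x => hh x) hg.continuousOn

/-- The functional calculus is compatible with a relabelling of the basis. -/
theorem map_cfc_reindex {κ : Type*} [Fintype κ] [DecidableEq κ] (e : κ ≃ ι)
    (hA : A.IsHermitian) (g : ℝ → ℝ) :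
    cfc g (A.submatrix e e) = (cfc g A).submatrix e e := by
  let φ : Matrix ι ι ℂ →⋆ₐ[ℂ] Matrix κ κ ℂ :=
    { (Matrix.reindexAlgEquiv ℂ ℂ e.symm : Matrix ι ι ℂ →ₐ[ℂ] Matrix κ κ ℂ) with
      map_star' := fun M => rfl }
  have hφ : Continuous φ := by
    change Continuous fun M : Matrix ι ι ℂ => M.submatrix e e
    exact continuous_id.matrix_submatrix e e
  exact (StarAlgHom.map_cfc φ g A
    (by exact (Matrix.finite_real_spectrum (A := A)).continuousOn g) hφ hA
    (by exact hA.submatrix e)).symm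

/-- `A` and `B` need not commute: cyclicity of the trace makes the `k` terms of the product rule
equal. -/
theorem hasDerivAt_trace_pow (A B : Matrix ι ι ℂ) (k : ℕ) (t : ℝ) :
    HasDerivAt (fun s : ℝ => ((A + s • B) ^ k).trace)
      (k * ((A + t • B) ^ (k - 1) * B).trace) t := by
  open scoped Matrix.Norms.L2Operator in
  have h0 : HasDerivAt (fun s : ℝ => A + s • B) B t := by
    simpa using ((hasDerivAt_id t).smul_const B).const_add A
  have h1 := h0.fun_pow' k
  let T : Matrix ι ι ℂ →L[ℝ] ℂ :=
    LinearMap.toContinuousLinearMap (Matrix.traceLinearMap ι ℝ ℂ)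
  have h2 := T.hasFDerivAt.comp_hasDerivAt t h1
  refine h2.congr_deriv ?_
  change (∑ i ∈ Finset.range k, (A + t • B) ^ (k - 1 - i) * B * (A + t • B) ^ i).trace = _
  rw [Matrix.trace_sum, Finset.sum_congr rfl (g := fun _ => ((A + t • B) ^ (k - 1) * B).trace)]
  · simp
  · intro i hi
    rw [Finset.mem_range] at hi
    rw [Matrix.trace_mul_comm, ← mul_assoc, ← pow_add]
    congr 3
    omega

theorem hasDerivAt_trace_aeval (A B : Matrix ι ι ℂ) (q : Polynomial ℝ) (t : ℝ) :
    HasDerivAt (fun s : ℝ => (Polynomial.aeval (A + s • B) q).trace)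
      ((Polynomial.aeval (A + t • B) (Polynomial.derivative q) * B).trace) t := by
  induction q using Polynomial.induction_on' with
  | add p q hp hq =>
    simp only [map_add, Matrix.trace_add, add_mul]
    exact hp.add hq
  | monomial k a =>
    have h := (hasDerivAt_trace_pow A B k t).fun_const_smul a
    simp only [← Matrix.trace_smul] at h
    simp only [Polynomial.derivative_monomial, Polynomial.aeval_monomial, ← Algebra.smul_def]
    refine h.congr_deriv ?_
    rw [Matrix.smul_mul, Matrix.trace_smul, mul_smul]
    congr 1

/-- The eigenvalues of a continuous family of Hermitian matrices over a compact space stay in a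
bounded interval. -/
theorem exists_bound_spectrum {X : Type*} [TopologicalSpace X] [CompactSpace X]
    {a : X → Matrix ι ι ℂ} (ha : Continuous a) :
    ∃ M : ℝ, ∀ x, spectrum ℝ (a x) ⊆ Set.Icc (-M) M := by
  open scoped Matrix.Norms.L2Operator in
  obtain ⟨M, hM⟩ := (isCompact_range ha).isBounded.exists_norm_le
  refine ⟨M * ‖(1 : Matrix ι ι ℂ)‖, fun x y hy => ?_⟩
  have h1 := spectrum.norm_le_norm_mul_of_mem hy
  have h2 := hM (a x) ⟨x, rfl⟩
  rw [Set.mem_Icc, ← abs_le, ← Real.norm_eq_abs]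
  exact h1.trans (mul_le_mul_of_nonneg_right h2 (norm_nonneg _))

theorem norm_integral_matrixMeasure_le {E : Type*} [NormedAddCommGroup E] [NormedSpace ℝ E]
    [CompleteSpace E] (hA : A.IsHermitian) (n : ι) {g : ℝ → E} {c : ℝ}
    (hg : ∀ x ∈ spectrum ℝ A, ‖g x‖ ≤ c) : ‖∫ x, g x ∂(matrixMeasure hA n)‖ ≤ c := by
  rw [integral_matrixMeasure]
  calc _ ≤ ∑ i, ‖‖hA.eigenvectorUnitary.1 n i‖ ^ 2 • g (hA.eigenvalues i)‖ := norm_sum_le _ _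
    _ ≤ ∑ i, ‖hA.eigenvectorUnitary.1 n i‖ ^ 2 * c := by
        refine Finset.sum_le_sum fun i _ => ?_
        rw [norm_smul, Real.norm_of_nonneg (by positivity)]
        exact mul_le_mul_of_nonneg_left (hg _ (hA.eigenvalues_mem_spectrum_real i))
          (by positivity)
    _ = c := by rw [← Finset.sum_mul, sum_norm_sq_eigenvectorUnitary, one_mul]

theorem exists_polynomial_derivative_eq (p : Polynomial ℝ) (c : ℝ) :
    ∃ q : Polynomial ℝ, Polynomial.derivative q = p ∧ q.eval 0 = c := by
  have h : ∃ q : Polynomial ℝ, Polynomial.derivative q = p := by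
    induction p using Polynomial.induction_on' with
    | add p q hp hq =>
      obtain ⟨p', rfl⟩ := hp
      obtain ⟨q', rfl⟩ := hq
      exact ⟨p' + q', by simp⟩
    | monomial k a =>
      refine ⟨Polynomial.monomial (k + 1) (a / (k + 1)), ?_⟩
      rw [Polynomial.derivative_monomial]
      congr 1
      push_cast
      field_simp
  obtain ⟨q, hq⟩ := h
  exact ⟨q + Polynomial.C (c - q.eval 0), by simp [hq], by simp⟩

/-- The derivative of `t ↦ Tr f(A + t v E_nn)` is `v f'(A + t v E_nn)_nn`, in integrated form. This
is the product rule when `f` is a polynomial. In general `f'` is uniformly approximated by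
polynomials on an interval that contains the spectra of all the matrices `A + t v E_nn` with
`0 ≤ t ≤ 1`. -/
theorem trace_cfc_sub (hA : A.IsHermitian) (n : ι) (v : ℝ) {f : ℝ → ℝ}
    (hf : Differentiable ℝ f) (hf' : Continuous (deriv f)) :
    (cfc f (A + Matrix.single n n (v : ℂ))).trace.re - (cfc f A).trace.re =
      ∫ t in (0 : ℝ)..1, v * (cfc (deriv f) (A + t • Matrix.single n n (v : ℂ)) n n).re := by
  set B : Matrix ι ι ℂ := Matrix.single n n (v : ℂ) with hB
  have hBh : B.IsHermitian := by
    rw [hB, Matrix.IsHermitian, Matrix.conjTranspose_single]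
    simp
  have hh : ∀ t : ℝ, (A + t • B).IsHermitian := fun t =>
    hA.add (by rw [Matrix.IsHermitian, Matrix.conjTranspose_smul, hBh.eq, star_trivial])
  have hc : Continuous fun t : ℝ => A + t • B := by fun_prop
  obtain ⟨M, hM⟩ := exists_bound_spectrum (X := Set.Icc (0 : ℝ) 1)
    (a := fun t => A + (t : ℝ) • B) (hc.comp continuous_subtype_val)
  have htr : ∀ (g : ℝ → ℝ) (t : ℝ), (cfc g (A + t • B)).trace.re =
      ∑ m, ∫ x, g x ∂(matrixMeasure (hh t) m) := by
    intro g t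
    rw [Matrix.trace, Complex.re_sum]
    exact Finset.sum_congr rfl fun m _ => re_cfc_apply_self (hh t) g m
  have hcont : ∀ g : ℝ → ℝ, Continuous g →
      Continuous fun t : ℝ => v * (cfc g (A + t • B) n n).re := by
    intro g hg
    exact continuous_const.mul (Complex.continuous_re.comp
      ((continuous_cfc_matrix hc hh hg).matrix_elem n n))
  have hpoly : ∀ q : Polynomial ℝ,
      (cfc q.eval (A + (1 : ℝ) • B)).trace.re - (cfc q.eval (A + (0 : ℝ) • B)).trace.re =
      ∫ t in (0 : ℝ)..1, v * (cfc (Polynomial.derivative q).eval (A + t • B) n n).re := by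
    intro q
    refine (intervalIntegral.integral_eq_sub_of_hasDerivAt
      (f := fun t : ℝ => (cfc q.eval (A + t • B)).trace.re) (fun t _ => ?_)
      ((hcont _ (Polynomial.derivative q).continuous).intervalIntegrable 0 1)).symm
    have h := Complex.reCLM.hasFDerivAt.comp_hasDerivAt t (hasDerivAt_trace_aeval A B q t)
    have e : (fun t : ℝ => (cfc q.eval (A + t • B)).trace.re) =
        (Complex.reCLM : ℂ → ℝ) ∘ fun s : ℝ => (Polynomial.aeval (A + s • B) q).trace := by
      ext s
      rw [cfc_polynomial (p := IsSelfAdjoint) q _ (hh s)]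
      rfl
    rw [e]
    refine h.congr_deriv ?_
    rw [cfc_polynomial (p := IsSelfAdjoint) _ _ (hh t), hB, Matrix.trace_mul_single,
      Complex.reCLM_apply]
    simp [mul_comm]
  have hM0 : ∀ t ∈ Set.Icc (0 : ℝ) 1, ∀ x ∈ spectrum ℝ (A + t • B), |x| ≤ M := fun t ht x hx =>
    abs_le.2 (hM ⟨t, ht⟩ hx)
  -- `M` bounds the spectra; the maximum makes `[-M', M']` contain `0`, where `f` and its polynomial
  -- approximation agree.
  set M' := max M 0 with hM'
  set N : ℝ := (Fintype.card ι : ℝ)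
  have key : ∀ ε : ℝ, 0 < ε →
      |((cfc f (A + (1 : ℝ) • B)).trace.re - (cfc f (A + (0 : ℝ) • B)).trace.re) -
        ∫ t in (0 : ℝ)..1, v * (cfc (deriv f) (A + t • B) n n).re| ≤
      ε * (2 * N * M' + |v|) := by
    intro ε hε
    obtain ⟨p, hp⟩ := exists_polynomial_near_of_continuousOn (-M') M' (deriv f)
      hf'.continuousOn ε hε
    obtain ⟨q, hq, hq0⟩ := exists_polynomial_derivative_eq p (f 0)
    have hfq : ∀ x ∈ Set.Icc (-M') M', |f x - q.eval x| ≤ ε * M' := by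
      intro x hx
      have h := Convex.norm_image_sub_le_of_norm_deriv_le (f := fun x => f x - q.eval x)
        (s := Set.Icc (-M') M') (C := ε) (x := 0) (y := x)
        (fun y _ => (hf y).sub (q.differentiable y)) (fun y hy => ?_) (convex_Icc _ _)
        ⟨by simp [hM'], by simp [hM']⟩ hx
      · simp only [hq0, sub_self, sub_zero, Real.norm_eq_abs] at h
        exact h.trans (mul_le_mul_of_nonneg_left (abs_le.2 hx) hε.le)
      · rw [deriv_fun_sub (hf y) (q.differentiable y), Polynomial.deriv, hq, Real.norm_eq_abs,
          abs_sub_comm]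
        exact (hp y hy).le
    have hspec : ∀ t ∈ Set.Icc (0 : ℝ) 1, ∀ x ∈ spectrum ℝ (A + t • B),
        x ∈ Set.Icc (-M') M' := fun t ht x hx =>
      abs_le.1 ((hM0 t ht x hx).trans (le_max_left _ _))
    have h1 : ∀ t ∈ Set.Icc (0 : ℝ) 1,
        |(cfc f (A + t • B)).trace.re - (cfc q.eval (A + t • B)).trace.re| ≤ ε * M' * N := by
      intro t ht
      rw [htr, htr, ← Finset.sum_sub_distrib]
      calc _ ≤ ∑ m : ι, ε * M' := by
            refine (Finset.abs_sum_le_sum_abs _ _).trans (Finset.sum_le_sum fun m _ => ?_)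
            rw [← integral_sub (integrable_matrixMeasure _ _ _) (integrable_matrixMeasure _ _ _)]
            exact norm_integral_matrixMeasure_le (g := fun x => f x - q.eval x) (hh t) m
              fun x hx => hfq x (hspec t ht x hx)
        _ = _ := by simp [N, mul_comm]
    have h2 : |(∫ t in (0 : ℝ)..1, v * (cfc (Polynomial.derivative q).eval (A + t • B) n n).re) -
        ∫ t in (0 : ℝ)..1, v * (cfc (deriv f) (A + t • B) n n).re| ≤ ε * |v| := by
      rw [← intervalIntegral.integral_sub
        ((hcont _ (Polynomial.derivative q).continuous).intervalIntegrable 0 1)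
        ((hcont _ hf').intervalIntegrable 0 1)]
      have h := intervalIntegral.norm_integral_le_of_norm_le_const (a := (0 : ℝ)) (b := 1)
        (C := ε * |v|) (f := fun t : ℝ =>
          v * (cfc (Polynomial.derivative q).eval (A + t • B) n n).re -
            v * (cfc (deriv f) (A + t • B) n n).re) (fun t ht => ?_)
      · simpa using h
      · rw [Set.uIoc_of_le zero_le_one] at ht
        rw [← mul_sub, norm_mul, mul_comm, Real.norm_eq_abs v]
        refine mul_le_mul_of_nonneg_right ?_ (abs_nonneg v)
        rw [re_cfc_apply_self (hh t), re_cfc_apply_self (hh t),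
          ← integral_sub (integrable_matrixMeasure _ _ _) (integrable_matrixMeasure _ _ _)]
        refine norm_integral_matrixMeasure_le (hh t) n fun x hx => ?_
        rw [hq]
        exact (hp x (hspec t ⟨ht.1.le, ht.2⟩ x hx)).le
    have h3 := h1 0 (by simp)
    have h4 := h1 1 (by simp)
    rw [← hpoly q] at h2
    rw [abs_le] at *
    constructor <;> linarith [h2.1, h2.2, h3.1, h3.2, h4.1, h4.2]
  have hz : ((cfc f (A + (1 : ℝ) • B)).trace.re - (cfc f (A + (0 : ℝ) • B)).trace.re) -
        ∫ t in (0 : ℝ)..1, v * (cfc (deriv f) (A + t • B) n n).re = 0 := by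
    have hK : 0 ≤ 2 * N * M' + |v| := by positivity
    refine abs_nonpos_iff.1 (le_of_forall_pos_le_add fun δ hδ => ?_)
    refine (key (δ / (2 * N * M' + |v| + 1)) (by positivity)).trans ?_
    rw [zero_add, div_mul_eq_mul_div, div_le_iff₀ (by positivity)]
    nlinarith
  rw [one_smul, zero_smul, add_zero] at hz
  linarith

end Matrix

/-! ### The Efron–Stein inequality -/

section EfronStein

variable {ι : Type*} [DecidableEq ι] (μ : Measure ℝ)

/-- The average of `F` over the coordinate `ω_n`, the other coordinates being fixed. -/
def resample (n : ι) (F : (ι → ℝ) → ℝ) (ω : ι → ℝ) : ℝ :=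
  ∫ x, F (Function.update ω n x) ∂μ

variable {μ} {F G : (ι → ℝ) → ℝ}

theorem resample_update (n : ι) (ω : ι → ℝ) (x : ℝ) :
    resample μ n F (Function.update ω n x) = resample μ n F ω := by
  simp [resample]

/-- Each averaging removes one coordinate from those that the function depends on. -/
theorem dependsOn_foldr_resample {s : Set ι} (hF : DependsOn F s) (l : List ι) :
    DependsOn (l.foldr (resample μ) F) (s \ {i | i ∈ l}) := by
  induction l with
  | nil => simpa using hF
  | cons n l ih =>
    intro ω ω' h
    simp only [List.foldr_cons, resample]
    congr 1
    ext x
    refine ih fun i hi => ?_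
    by_cases hin : i = n
    · subst hin
      simp
    · rw [Function.update_of_ne hin, Function.update_of_ne hin]
      exact h i ⟨hi.1, by simpa [hin] using hi.2⟩

variable (μ) [IsProbabilityMeasure μ]

/-- Replacing one coordinate by an independent copy preserves the product law. -/
theorem measurePreserving_update (n : ι) :
    MeasurePreserving (fun p : (ι → ℝ) × ℝ => Function.update p.1 n p.2)
      ((Measure.infinitePi fun _ : ι => μ).prod μ) (Measure.infinitePi fun _ : ι => μ) := by
  have hm : Measurable (fun p : (ι → ℝ) × ℝ => Function.update p.1 n p.2) := by
    rw [measurable_pi_iff]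
    intro i
    by_cases h : i = n
    · subst h
      simpa using measurable_snd
    · simp only [Function.update_of_ne h]
      exact (measurable_pi_apply i).comp measurable_fst
  refine ⟨hm, Measure.eq_infinitePi _ fun s t ht => ?_⟩
  rw [Measure.map_apply hm (MeasurableSet.pi s.countable_toSet fun i _ => ht i)]
  by_cases hn : n ∈ s
  · have : (fun p : (ι → ℝ) × ℝ => Function.update p.1 n p.2) ⁻¹' (Set.pi s t) =
        (Set.pi (s.erase n) t) ×ˢ (t n) := by
      ext p
      simp only [Set.mem_preimage, Set.mem_pi, Set.mem_prod, Finset.coe_erase, Set.mem_sdiff,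
        Set.mem_singleton_iff, Finset.mem_coe]
      constructor
      · intro h
        refine ⟨fun i hi => ?_, ?_⟩
        · simpa [Function.update_of_ne hi.2] using h i hi.1
        · simpa using h n hn
      · rintro ⟨h1, h2⟩ i hi
        by_cases h : i = n
        · subst h
          simpa using h2
        · simpa [Function.update_of_ne h] using h1 i ⟨hi, h⟩
    rw [this, Measure.prod_prod, Measure.infinitePi_pi _ (fun i _ => ht i), mul_comm,
      Finset.mul_prod_erase s (fun i => μ (t i)) hn]
  · have : (fun p : (ι → ℝ) × ℝ => Function.update p.1 n p.2) ⁻¹' (Set.pi s t) =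
        (Set.pi s t) ×ˢ Set.univ := by
      ext p
      simp only [Set.mem_preimage, Set.mem_pi, Set.mem_prod, Set.mem_univ, and_true,
        Finset.mem_coe]
      refine forall₂_congr fun i hi => ?_
      rw [Function.update_of_ne (ne_of_mem_of_not_mem hi hn)]
    rw [this, Measure.prod_prod, Measure.infinitePi_pi _ (fun i _ => ht i), measure_univ, mul_one]

variable {μ}

theorem stronglyMeasurable_resample (hF : StronglyMeasurable F) (n : ι) :
    StronglyMeasurable (resample μ n F) :=
  StronglyMeasurable.integral_prod_right
    (f := fun (ω : ι → ℝ) (x : ℝ) => F (Function.update ω n x))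
    (hF.comp_measurable (measurePreserving_update μ n).measurable)

theorem ae_memLp_section (hF2 : MemLp F 2 (Measure.infinitePi fun _ : ι => μ)) (n : ι) :
    ∀ᵐ ω ∂(Measure.infinitePi fun _ : ι => μ), MemLp (fun x => F (Function.update ω n x)) 2 μ := by
  have h := hF2.comp_measurePreserving (measurePreserving_update μ n)
  filter_upwards [h.integrable_sq.prod_right_ae, h.1.prodMk_left] with ω h1 h2
  exact (memLp_two_iff_integrable_sq h2).2 h1

/-- Among all constants, the mean is the best approximation in `L²`. -/
theorem integral_sub_mean_sq_le {g : ℝ → ℝ} (hg : MemLp g 2 μ) (c : ℝ) :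
    ∫ x, (g x - ∫ y, g y ∂μ) ^ 2 ∂μ ≤ ∫ x, (g x - c) ^ 2 ∂μ := by
  have h1 : Integrable g μ := hg.integrable (by norm_num)
  have h2 : Integrable (fun x => g x ^ 2) μ := hg.integrable_sq
  have key : ∀ a : ℝ, ∫ x, (g x - a) ^ 2 ∂μ = (∫ x, g x ^ 2 ∂μ) - 2 * a * (∫ x, g x ∂μ) + a ^ 2 := by
    intro a
    have e : ∀ x, (g x - a) ^ 2 = g x ^ 2 - 2 * a * g x + a ^ 2 := fun x => by ring
    simp_rw [e]
    have h3 : Integrable (fun x => 2 * a * g x) μ := h1.const_mul _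
    have h4 : Integrable (fun x => g x ^ 2 - 2 * a * g x) μ := h2.sub h3
    rw [integral_add h4 (integrable_const _), integral_sub h2 h3, integral_const_mul]
    simp
  rw [key, key]
  nlinarith [sq_nonneg ((∫ y, g y ∂μ) - c)]

theorem sq_integral_le_integral_sq {α : Type*} {m : MeasurableSpace α} {ν : Measure α}
    [IsProbabilityMeasure ν] {g : α → ℝ} (hg : MemLp g 2 ν) :
    (∫ y, g y ∂ν) ^ 2 ≤ ∫ x, g x ^ 2 ∂ν := by
  have h := ProbabilityTheory.variance_nonneg g ν
  rw [ProbabilityTheory.variance_eq_sub hg] at h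
  simpa using h

theorem ofReal_integral_sq {α : Type*} {m : MeasurableSpace α} {ν : Measure α} {g : α → ℝ}
    (hg : MemLp g 2 ν) : ENNReal.ofReal (∫ x, g x ^ 2 ∂ν) = ∫⁻ x, ENNReal.ofReal (g x ^ 2) ∂ν :=
  ofReal_integral_eq_lintegral_ofReal hg.integrable_sq (Eventually.of_forall fun _ => sq_nonneg _)

theorem integral_prod_update (hF : Integrable F (Measure.infinitePi fun _ : ι => μ)) (n : ι) :
    ∫ ω, F ω ∂(Measure.infinitePi fun _ : ι => μ) =
      ∫ ω, resample μ n F ω ∂(Measure.infinitePi fun _ : ι => μ) := by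
  have hp := measurePreserving_update μ n
  have h : Integrable (fun p : (ι → ℝ) × ℝ => F (Function.update p.1 n p.2))
      ((Measure.infinitePi fun _ : ι => μ).prod μ) := hp.integrable_comp_of_integrable hF
  have e := integral_map (f := F) hp.measurable.aemeasurable (by rw [hp.map_eq]; exact hF.1)
  rw [hp.map_eq] at e
  rw [e, integral_prod _ h]
  rfl

/-- Averaging over one coordinate is a contraction of `L²`. -/
theorem sq_resample_le (hF : StronglyMeasurable F)
    (hF2 : MemLp F 2 (Measure.infinitePi fun _ : ι => μ)) (n : ι) :
    MemLp (resample μ n F) 2 (Measure.infinitePi fun _ : ι => μ) ∧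
    ∫ ω, resample μ n F ω ^ 2 ∂(Measure.infinitePi fun _ : ι => μ) ≤
      ∫ ω, F ω ^ 2 ∂(Measure.infinitePi fun _ : ι => μ) := by
  have hp := measurePreserving_update μ n
  have h := hp.integrable_comp_of_integrable hF2.integrable_sq
  have h1 : ∀ᵐ ω ∂(Measure.infinitePi fun _ : ι => μ),
      resample μ n F ω ^ 2 ≤ resample μ n (fun ω => F ω ^ 2) ω := by
    filter_upwards [ae_memLp_section hF2 n] with ω hω
    exact sq_integral_le_integral_sq hω
  have h2 : Integrable (resample μ n fun ω => F ω ^ 2) (Measure.infinitePi fun _ : ι => μ) :=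
    h.integral_prod_left
  have hm := stronglyMeasurable_resample (μ := μ) hF n
  have h3 : Integrable (fun ω => resample μ n F ω ^ 2) (Measure.infinitePi fun _ : ι => μ) := by
    refine h2.mono' (hm.pow 2).aestronglyMeasurable ?_
    filter_upwards [h1] with ω hω
    rwa [Real.norm_of_nonneg (sq_nonneg _)]
  refine ⟨(memLp_two_iff_integrable_sq hm.aestronglyMeasurable).2 h3, ?_⟩
  rw [integral_prod_update hF2.integrable_sq n]
  exact integral_mono_ae h3 h2 h1

/-- `F - resample n F` is orthogonal to every function that does not depend on `ω_n`. -/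
theorem integral_sub_resample_mul (hF : StronglyMeasurable F)
    (hF2 : MemLp F 2 (Measure.infinitePi fun _ : ι => μ))
    (hG2 : MemLp G 2 (Measure.infinitePi fun _ : ι => μ)) (n : ι)
    (hG : ∀ ω x, G (Function.update ω n x) = G ω) :
    ∫ ω, (F ω - resample μ n F ω) * G ω ∂(Measure.infinitePi fun _ : ι => μ) = 0 := by
  have h1 : Integrable (fun ω => F ω * G ω) (Measure.infinitePi fun _ : ι => μ) :=
    hF2.integrable_mul hG2
  have h2 : Integrable (fun ω => resample μ n F ω * G ω) (Measure.infinitePi fun _ : ι => μ) :=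
    (sq_resample_le hF hF2 n).1.integrable_mul hG2
  simp_rw [sub_mul]
  rw [integral_sub h1 h2, integral_prod_update h1 n, sub_eq_zero]
  congr 1
  ext ω
  simp only [resample, hG]
  rw [integral_mul_const]

/-- The error of averaging successively over several coordinates. Write `R` for the average over the
first coordinate and `G` for the average of `F` over the others; then `F - R G` splits into the
orthogonal parts `F - R F` and `R (F - G)`, and `R` is a contraction. -/
theorem integral_sub_resample_list (hF : StronglyMeasurable F)
    (hF2 : MemLp F 2 (Measure.infinitePi fun _ : ι => μ)) (l : List ι) :
    StronglyMeasurable (l.foldr (resample μ) F) ∧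
    MemLp (l.foldr (resample μ) F) 2 (Measure.infinitePi fun _ : ι => μ) ∧
    ∫ ω, (F ω - l.foldr (resample μ) F ω) ^ 2 ∂(Measure.infinitePi fun _ : ι => μ) ≤
      (l.map fun n => ∫ ω, (F ω - resample μ n F ω) ^ 2
        ∂(Measure.infinitePi fun _ : ι => μ)).sum := by
  induction l with
  | nil => simp [hF, hF2]
  | cons n l ih =>
    obtain ⟨h1, h2, h3⟩ := ih
    simp only [List.foldr_cons, List.map_cons, List.sum_cons]
    set G := l.foldr (resample μ) F
    have hG := sq_resample_le h1 h2 n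
    have hRF := sq_resample_le hF hF2 n
    refine ⟨stronglyMeasurable_resample h1 n, hG.1, ?_⟩
    have hK2 : MemLp (fun ω => resample μ n F ω - resample μ n G ω) 2
      (Measure.infinitePi fun _ : ι => μ) := hRF.1.sub hG.1
    have hD2 : MemLp (fun ω => F ω - resample μ n F ω) 2
      (Measure.infinitePi fun _ : ι => μ) := hF2.sub hRF.1
    have hort := integral_sub_resample_mul hF hF2 hK2 n fun ω x => by
      simp only [resample_update]
    have hK : ∫ ω, (resample μ n F ω - resample μ n G ω) ^ 2
        ∂(Measure.infinitePi fun _ : ι => μ) ≤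
        ∫ ω, (F ω - G ω) ^ 2 ∂(Measure.infinitePi fun _ : ι => μ) := by
      refine le_trans (le_of_eq ?_) (sq_resample_le (hF.sub h1) (hF2.sub h2) n).2
      refine integral_congr_ae ?_
      filter_upwards [ae_memLp_section hF2 n, ae_memLp_section h2 n] with ω hω1 hω2
      congr 1
      exact (integral_sub (hω1.integrable (by norm_num)) (hω2.integrable (by norm_num))).symm
    have e : ∀ ω, (F ω - resample μ n G ω) ^ 2 = (F ω - resample μ n F ω) ^ 2 +
        2 * ((F ω - resample μ n F ω) * (resample μ n F ω - resample μ n G ω)) +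
        (resample μ n F ω - resample μ n G ω) ^ 2 := fun ω => by ring
    simp_rw [e]
    have i1 : Integrable (fun ω => 2 * ((F ω - resample μ n F ω) *
        (resample μ n F ω - resample μ n G ω))) (Measure.infinitePi fun _ : ι => μ) :=
      (hD2.integrable_mul hK2).const_mul 2
    have i2 : Integrable (fun ω => (F ω - resample μ n F ω) ^ 2 +
        2 * ((F ω - resample μ n F ω) * (resample μ n F ω - resample μ n G ω)))
        (Measure.infinitePi fun _ : ι => μ) := hD2.integrable_sq.add i1
    rw [integral_add i2 hK2.integrable_sq, integral_add hD2.integrable_sq i1,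
      integral_const_mul, hort]
    linarith

theorem integral_foldr_resample (hF : StronglyMeasurable F)
    (hF2 : MemLp F 2 (Measure.infinitePi fun _ : ι => μ)) (l : List ι) :
    ∫ ω, l.foldr (resample μ) F ω ∂(Measure.infinitePi fun _ : ι => μ) =
      ∫ ω, F ω ∂(Measure.infinitePi fun _ : ι => μ) := by
  induction l with
  | nil => rfl
  | cons n l ih =>
    obtain ⟨h1, h2, -⟩ := integral_sub_resample_list hF hF2 l
    rw [← ih, integral_prod_update (h2.integrable (by norm_num)) n]
    rfl

theorem enorm_sq_eq_ofReal (x : ℝ) : ‖x‖ₑ ^ 2 = ENNReal.ofReal (x ^ 2) := by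
  rw [Real.enorm_eq_ofReal_abs, ← ENNReal.ofReal_pow (abs_nonneg x), sq_abs]

theorem lintegral_update {g : (ι → ℝ) → ℝ≥0∞} (hg : Measurable g) (n : ι) :
    ∫⁻ ω, g ω ∂(Measure.infinitePi fun _ : ι => μ) =
      ∫⁻ ω, ∫⁻ x, g (Function.update ω n x) ∂μ ∂(Measure.infinitePi fun _ : ι => μ) := by
  have hp := measurePreserving_update μ n
  rw [← hp.lintegral_comp hg]
  exact lintegral_prod (fun p : (ι → ℝ) × ℝ => g (Function.update p.1 n p.2))
    (hg.comp hp.measurable).aemeasurable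

/-- The mean square deviation from the conditional mean is at most that from the value at any fixed
`ω_n = c`, because the latter does not depend on `ω_n` either. -/
theorem lintegral_sub_resample_le (hF : StronglyMeasurable F)
    (hF2 : MemLp F 2 (Measure.infinitePi fun _ : ι => μ)) (n : ι) (c : ℝ) :
    ENNReal.ofReal (∫ ω, (F ω - resample μ n F ω) ^ 2 ∂(Measure.infinitePi fun _ : ι => μ)) ≤
      ∫⁻ ω, ‖F ω - F (Function.update ω n c)‖ₑ ^ 2 ∂(Measure.infinitePi fun _ : ι => μ) := by
  have hp := measurePreserving_update μ n
  have hRF := sq_resample_le hF hF2 n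
  have hm : Measurable fun ω : ι → ℝ => Function.update ω n c :=
    hp.measurable.comp (measurable_id.prodMk measurable_const)
  rw [ofReal_integral_sq (g := fun ω => F ω - resample μ n F ω) (hF2.sub hRF.1)]
  have hM1 : Measurable fun ω => ENNReal.ofReal ((F ω - resample μ n F ω) ^ 2) :=
    ((hF.sub (stronglyMeasurable_resample hF n)).measurable.pow_const 2).ennreal_ofReal
  have hM2 : Measurable fun ω => ‖F ω - F (Function.update ω n c)‖ₑ ^ 2 :=
    ((hF.measurable.sub (hF.measurable.comp hm)).enorm.pow_const 2)
  rw [lintegral_update hM1 n, lintegral_update hM2 n]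
  refine lintegral_mono_ae ?_
  filter_upwards [ae_memLp_section hF2 n] with ω hω
  simp only [resample_update, Function.update_idem, enorm_sq_eq_ofReal]
  have hsub : ∀ a : ℝ, MemLp (fun x => F (Function.update ω n x) - a) 2 μ := fun a =>
    hω.sub (memLp_const a)
  rw [← ofReal_integral_sq (hsub _), ← ofReal_integral_sq (hsub _)]
  exact ENNReal.ofReal_le_ofReal (integral_sub_mean_sq_le hω _)

/-- A form of the **Efron–Stein inequality**: the variance of a function of finitely many
independent variables is at most the sum of the mean square changes caused by setting one of the
variables to a constant. -/
theorem lintegral_sub_mean_sq_le_sum (s : Finset ι) (hF : StronglyMeasurable F)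
    (hF2 : MemLp F 2 (Measure.infinitePi fun _ : ι => μ)) (hs : DependsOn F (s : Set ι)) (c : ℝ) :
    ∫⁻ ω, ‖F ω - ∫ ω', F ω' ∂(Measure.infinitePi fun _ : ι => μ)‖ₑ ^ 2
        ∂(Measure.infinitePi fun _ : ι => μ) ≤
      ∑ n ∈ s, ∫⁻ ω, ‖F ω - F (Function.update ω n c)‖ₑ ^ 2
        ∂(Measure.infinitePi fun _ : ι => μ) := by
  obtain ⟨h1, h2, h3⟩ := integral_sub_resample_list hF hF2 s.toList
  have hdep := dependsOn_foldr_resample (μ := μ) hs s.toList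
  have hconst : ∀ ω, s.toList.foldr (resample μ) F ω =
      ∫ ω', F ω' ∂(Measure.infinitePi fun _ : ι => μ) := by
    intro ω
    rw [← integral_foldr_resample hF hF2 s.toList,
      integral_congr_ae (g := fun _ => s.toList.foldr (resample μ) F ω)
        (Eventually.of_forall fun ω' => hdep (x := ω') (y := ω) fun i hi => by simp at hi)]
    simp
  simp_rw [hconst] at h3
  simp_rw [enorm_sq_eq_ofReal (_ - ∫ ω', F ω' ∂(Measure.infinitePi fun _ : ι => μ))]
  rw [← ofReal_integral_sq (g := fun ω => F ω - ∫ ω', F ω' ∂(Measure.infinitePi fun _ : ι => μ))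
    (hF2.sub (memLp_const _))]
  refine (ENNReal.ofReal_le_ofReal h3).trans ?_
  rw [Finset.sum_map_toList, ENNReal.ofReal_sum_of_nonneg
    (fun n _ => integral_nonneg fun _ => sq_nonneg _)]
  exact Finset.sum_le_sum fun n _ => lintegral_sub_resample_le hF hF2 n c

end EfronStein

/-! ### Orthogonal projections and bounded normal operators -/

section Projections

/-- A Cauchy criterion for vectors `x n` that correspond isometrically to functions `g n` with an `L²`
limit `g` to which no vector is known to correspond: there `e n = 2 ∫ |g n - g|²`. -/
theorem cauchySeq_of_norm_sub_sq_le {E : Type*} [NormedAddCommGroup E] {x : ℕ → E} {e : ℕ → ℝ}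
    (he : Tendsto e atTop (nhds 0)) (h : ∀ n m, ‖x n - x m‖ ^ 2 ≤ e n + e m) : CauchySeq x := by
  rw [Metric.cauchySeq_iff]
  intro ε hε
  obtain ⟨N, hN⟩ := eventually_atTop.1 
    (he.eventually (gt_mem_nhds (show 0 < ε ^ 2 / 2 by positivity)))
  refine ⟨N, fun m hm n hn => ?_⟩
  rw [dist_eq_norm]
  refine lt_of_pow_lt_pow_left₀ 2 hε.le ((h m n).trans_lt ?_)
  linarith [hN m hm, hN n hn]

variable {E : Type*} [NormedAddCommGroup E] [InnerProductSpace ℂ E] [CompleteSpace E]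
  {P Q : E →L[ℂ] E}

theorem inner_apply_eq_of_isSelfAdjoint (hP : IsSelfAdjoint P) (x y : E) :
    ⟪P x, y⟫_ℂ = ⟪x, P y⟫_ℂ := by
  rw [← ContinuousLinearMap.adjoint_inner_right, ← ContinuousLinearMap.star_eq_adjoint, hP.star_eq]

theorem inner_self_apply_eq_re (hP : IsSelfAdjoint P) (x : E) :
    ⟪x, P x⟫_ℂ = ((⟪x, P x⟫_ℂ).re : ℂ) := by
  refine (Complex.conj_eq_iff_re.1 ?_).symm
  rw [inner_conj_symm, inner_apply_eq_of_isSelfAdjoint hP]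

theorem inner_apply_eq_norm_sq (hP : IsStarProjection P) (x : E) :
    ⟪x, P x⟫_ℂ = ((‖P x‖ ^ 2 : ℝ) : ℂ) := by
  have h : P x = P (P x) := by
    conv_lhs => rw [← hP.isIdempotentElem.eq]
    rfl
  rw [h, ← inner_apply_eq_of_isSelfAdjoint hP.isSelfAdjoint, inner_self_eq_norm_sq_to_K, ← h]
  norm_cast

theorem eq_of_forall_re_inner_eq (hP : IsSelfAdjoint P) (hQ : IsSelfAdjoint Q)
    (h : ∀ x, (⟪x, P x⟫_ℂ).re = (⟪x, Q x⟫_ℂ).re) : P = Q := by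
  have h1 : (P : E →ₗ[ℂ] E) = Q := by
    rw [← ext_inner_map]
    intro x
    change ⟪P x, x⟫_ℂ = ⟪Q x, x⟫_ℂ
    rw [inner_apply_eq_of_isSelfAdjoint hP, inner_apply_eq_of_isSelfAdjoint hQ,
      inner_self_apply_eq_re hP, inner_self_apply_eq_re hQ, h]
  exact ContinuousLinearMap.coe_injective h1

/-- For `x` in the range of `Q` the hypothesis leaves no room for `P x`. -/
theorem mul_eq_zero_of_norm_sq_add_le (hQ : IsStarProjection Q)
    (h : ∀ x, ‖P x‖ ^ 2 + ‖Q x‖ ^ 2 ≤ ‖x‖ ^ 2) : P * Q = 0 := by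
  ext x
  have h1 := h (Q x)
  have h2 : Q (Q x) = Q x := by
    conv_rhs => rw [← hQ.isIdempotentElem.eq]
    rfl
  rw [h2] at h1
  have h3 : ‖P (Q x)‖ ^ 2 = 0 := le_antisymm (by linarith) (sq_nonneg _)
  simpa using h3

/-- A strongly Cauchy sequence of self-adjoint operators that are asymptotically idempotent
converges strongly to an orthogonal projection. -/
theorem exists_isStarProjection_of_cauchySeq {T : ℕ → E →L[ℂ] E} (hT : ∀ n, IsSelfAdjoint (T n))
    (hc : ∀ x, CauchySeq fun n => T n x)
    (hi : ∀ x, Tendsto (fun n => ‖T n x‖ ^ 2 - (⟪x, T n x⟫_ℂ).re) atTop (nhds 0)) :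
    ∃ P : E →L[ℂ] E, IsStarProjection P ∧ ∀ x, Tendsto (fun n => T n x) atTop (nhds (P x)) := by
  choose f hf using fun x => cauchySeq_tendsto_of_complete (hc x)
  let P : E →L[ℂ] E := continuousLinearMapOfTendsto T (tendsto_pi_nhds.2 hf)
  have hP : ∀ x, Tendsto (fun n => T n x) atTop (nhds (P x)) := hf
  have hsa : IsSelfAdjoint P := by
    rw [ContinuousLinearMap.isSelfAdjoint_iff_isSymmetric]
    intro x y
    refine tendsto_nhds_unique ((hP x).inner (𝕜 := ℂ) (tendsto_const_nhds (x := y))) ?_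
    simp_rw [inner_apply_eq_of_isSelfAdjoint (hT _)]
    exact (tendsto_const_nhds (x := x)).inner (hP y)
  refine ⟨P, ⟨?_, hsa⟩, hP⟩
  refine eq_of_forall_re_inner_eq (by rw [← pow_two]; exact hsa.pow 2) hsa fun x => ?_
  have h1 : Tendsto (fun n => ‖T n x‖ ^ 2 - (⟪x, T n x⟫_ℂ).re) atTop
      (nhds (‖P x‖ ^ 2 - (⟪x, P x⟫_ℂ).re)) :=
    ((hP x).norm.pow 2).sub
      (Complex.continuous_re.continuousAt.tendsto.comp ((tendsto_const_nhds (x := x)).inner (hP x)))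
  have h2 := tendsto_nhds_unique h1 (hi x)
  have h3 : ⟪x, (P * P) x⟫_ℂ = ((‖P x‖ ^ 2 : ℝ) : ℂ) := by
    change ⟪x, P (P x)⟫_ℂ = _
    rw [← inner_apply_eq_of_isSelfAdjoint hsa, inner_self_eq_norm_sq_to_K]
    norm_cast
  rw [h3, Complex.ofReal_re]
  linarith

theorem norm_sub_apply_sq (hP : IsStarProjection P) (x : E) :
    ‖x - P x‖ ^ 2 = ‖x‖ ^ 2 - ‖P x‖ ^ 2 := by
  have h1 := inner_apply_eq_norm_sq hP.one_sub x
  change ⟪x, x - P x⟫_ℂ = ((‖x - P x‖ ^ 2 : ℝ) : ℂ) at h1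
  rw [inner_sub_right, inner_apply_eq_norm_sq hP, inner_self_eq_norm_sq_to_K] at h1
  apply Complex.ofReal_injective
  rw [← h1]
  push_cast
  rfl

theorem isStarProjection_sum {ι : Type*} {T : ι → E →L[ℂ] E} (hT : ∀ i, IsStarProjection (T i))
    (ho : ∀ i j, i ≠ j → T i * T j = 0) (s : Finset ι) : IsStarProjection (∑ i ∈ s, T i) := by
  classical
  induction s using Finset.induction_on with
  | empty => simp
  | insert i s hi ih =>
    rw [Finset.sum_insert hi]
    refine (hT i).add ih ?_
    rw [Finset.mul_sum]
    exact Finset.sum_eq_zero fun j hj => ho i j fun h => hi (h ▸ hj)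

theorem norm_sum_apply_sq {ι : Type*} {T : ι → E →L[ℂ] E} (hT : ∀ i, IsStarProjection (T i))
    (ho : ∀ i j, i ≠ j → T i * T j = 0) (s : Finset ι) (x : E) :
    ‖(∑ i ∈ s, T i) x‖ ^ 2 = ∑ i ∈ s, ‖T i x‖ ^ 2 := by
  apply Complex.ofReal_injective
  rw [← inner_apply_eq_norm_sq (isStarProjection_sum hT ho s), sum_apply,
    inner_sum, Complex.ofReal_sum]
  exact Finset.sum_congr rfl fun i _ => inner_apply_eq_norm_sq (hT i) x

/-- Pairwise orthogonal projections have a strongly convergent sum. -/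
theorem exists_isStarProjection_tsum {T : ℕ → E →L[ℂ] E} (hT : ∀ i, IsStarProjection (T i))
    (ho : ∀ i j, i ≠ j → T i * T j = 0) (hs : ∀ x, Summable fun i => ‖T i x‖ ^ 2) :
    ∃ P : E →L[ℂ] E, IsStarProjection P ∧
      ∀ x, Tendsto (fun n => (∑ i ∈ Finset.range n, T i) x) atTop (nhds (P x)) := by
  refine exists_isStarProjection_of_cauchySeq
    (fun n => (isStarProjection_sum hT ho _).isSelfAdjoint) (fun x => ?_) fun x => ?_
  · have hlim := (hs x).hasSum.tendsto_sum_nat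
    set a := ∑' i, ‖T i x‖ ^ 2
    have h0 : Tendsto (fun n => |∑ i ∈ Finset.range n, ‖T i x‖ ^ 2 - a|) atTop (nhds 0) := by
      simpa using (hlim.sub_const a).abs
    refine cauchySeq_of_norm_sub_sq_le h0 ?_
    have key : ∀ n m, n ≤ m → ‖(∑ i ∈ Finset.range m, T i) x - (∑ i ∈ Finset.range n, T i) x‖ ^ 2 ≤
        |∑ i ∈ Finset.range m, ‖T i x‖ ^ 2 - a| + |∑ i ∈ Finset.range n, ‖T i x‖ ^ 2 - a| := by
      intro n m hnm
      rw [← sub_apply, ← Finset.sum_range_add_sum_Ico _ hnm,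
        add_sub_cancel_left, norm_sum_apply_sq hT ho, Finset.sum_Ico_eq_sub _ hnm]
      set p := ∑ i ∈ Finset.range m, ‖T i x‖ ^ 2
      set q := ∑ i ∈ Finset.range n, ‖T i x‖ ^ 2
      linarith [le_abs_self (p - a), neg_abs_le (q - a)]
    intro n m
    rcases le_total n m with h | h
    · rw [norm_sub_rev, add_comm]
      exact key n m h
    · exact key m n h
  · simp_rw [inner_apply_eq_norm_sq (isStarProjection_sum hT ho _) x, Complex.ofReal_re, sub_self]
    exact tendsto_const_nhds

theorem commute_of_tendsto {E : Type*} [NormedAddCommGroup E] [InnerProductSpace ℂ E]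
    {T : ℕ → E →L[ℂ] E} {P S : E →L[ℂ] E}
    (h : ∀ x, Tendsto (fun n => T n x) atTop (nhds (P x))) (hS : ∀ n, Commute S (T n)) :
    Commute S P := by
  refine ContinuousLinearMap.ext fun x => ?_
  change S (P x) = P (S x)
  refine tendsto_nhds_unique ((S.continuous.tendsto _).comp (h x)) ((h (S x)).congr fun n => ?_)
  exact (congrArg (fun A : E →L[ℂ] E => A x) (hS n).eq).symm

end Projections

section NormalOperator

variable {E : Type*} [NormedAddCommGroup E] [InnerProductSpace ℂ E] [CompleteSpace E]
variable (R : E →L[ℂ] E) [hR : IsStarNormal R]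

open scoped CompactlySupported

/-- The positive functional `g ↦ ⟨ψ, g(R) ψ⟩` on the real continuous functions on the spectrum of
a normal operator. -/
def spectralFunctional (ψ : E) : C_c(spectrum ℂ R, ℝ) →ₚ[ℝ] ℝ :=
  PositiveLinearMap.mk₀
    { toFun := fun g => (⟪ψ, cfcHom hR (⟨fun x => ((g x : ℝ) : ℂ), by fun_prop⟩ :
        C(spectrum ℂ R, ℂ)) ψ⟫_ℂ).re
      map_add' := fun g h => by
        rw [← Complex.add_re, ← inner_add_right, ← add_apply, ← map_add]
        congr
        ext x
        simp
      map_smul' := fun c g => by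
        rw [RingHom.id_apply, smul_eq_mul, ← Complex.re_ofReal_mul, ← inner_smul_right, ← smul_apply,
          ← map_smul]
        congr
        ext x
        simp }
    (by
      intro g hg
      let s : C(spectrum ℂ R, ℂ) := ⟨fun x => ((Real.sqrt (g x) : ℝ) : ℂ), by fun_prop⟩
      have hs : (⟨fun x => ((g x : ℝ) : ℂ), by fun_prop⟩ : C(spectrum ℂ R, ℂ)) = star s * s := by
        ext x
        simp only [s, ContinuousMap.coe_mk, ContinuousMap.mul_apply, ContinuousMap.star_apply,
          RCLike.star_def, Complex.conj_ofReal]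
        rw [← Complex.ofReal_mul, Real.mul_self_sqrt (hg x)]
      change 0 ≤ (⟪ψ, cfcHom hR _ ψ⟫_ℂ).re
      rw [hs, map_mul, map_star]
      change 0 ≤ (⟪ψ, star (cfcHom hR s) (cfcHom hR s ψ)⟫_ℂ).re
      rw [ContinuousLinearMap.star_eq_adjoint, ContinuousLinearMap.adjoint_inner_right]
      exact inner_self_nonneg (𝕜 := ℂ))

/-- The spectral measure `⟨ψ, E_R(·) ψ⟩` on `ℂ` of a bounded normal operator `R`. -/
def normalMeasure (ψ : E) : Measure ℂ :=
  (RealRMK.rieszMeasure (spectralFunctional R ψ)).map Subtype.val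

instance (ψ : E) : IsFiniteMeasure (normalMeasure R ψ) := by
  unfold normalMeasure
  have : IsFiniteMeasure (RealRMK.rieszMeasure (spectralFunctional R ψ)) := by
    refine isFiniteMeasure_iff_isFiniteMeasureOnCompacts_of_compactSpace.2 inferInstance
  infer_instance

theorem integrable_normalMeasure (ψ : E) {F : Type*} [NormedAddCommGroup F]
    [SecondCountableTopology F]
    {h : ℂ → F} (hh : Continuous h) : Integrable h (normalMeasure R ψ) := by
  unfold normalMeasure
  rw [(MeasurableEmbedding.subtype_coe
    (spectrum.isCompact R).isClosed.measurableSet).integrable_map_iff]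
  have : IsFiniteMeasure (RealRMK.rieszMeasure (spectralFunctional R ψ)) := by
    refine isFiniteMeasure_iff_isFiniteMeasureOnCompacts_of_compactSpace.2 inferInstance
  exact (hh.comp continuous_subtype_val).integrable_of_hasCompactSupport
    (HasCompactSupport.of_compactSpace _)

/-- The Riesz–Markov theorem gives this for real functions on the spectrum; complex ones follow by
linearity. -/
theorem integral_normalMeasure (ψ : E) {h : ℂ → ℂ} (hh : Continuous h) :
    ∫ z, h z ∂(normalMeasure R ψ) = ⟪ψ, cfc h R ψ⟫_ℂ := by
  have hemb : MeasurableEmbedding (Subtype.val : spectrum ℂ R → ℂ) :=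
    MeasurableEmbedding.subtype_coe (spectrum.isCompact R).isClosed.measurableSet
  have hreal : ∀ g : ℂ → ℝ, Continuous g →
      ∫ z, ((g z : ℝ) : ℂ) ∂(normalMeasure R ψ) = ⟪ψ, cfc (fun z => ((g z : ℝ) : ℂ)) R ψ⟫_ℂ := by
    intro g hg
    have hgc : Continuous fun z => ((g z : ℝ) : ℂ) := by fun_prop
    have hsa : IsSelfAdjoint (cfc (fun z => ((g z : ℝ) : ℂ)) R) := by
      rw [isSelfAdjoint_iff, ← cfc_star]
      simp
    rw [inner_self_apply_eq_re hsa, integral_complex_ofReal, normalMeasure, hemb.integral_map]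
    let G : C_c(spectrum ℂ R, ℝ) :=
      CompactlySupportedContinuousMap.continuousMapEquiv ⟨fun x => g x, by fun_prop⟩
    have h1 := RealRMK.integral_rieszMeasure (spectralFunctional R ψ) G
    have h2 : spectralFunctional R ψ G = (⟪ψ, cfc (fun z => ((g z : ℝ) : ℂ)) R ψ⟫_ℂ).re := by
      rw [cfc_apply _ R hR hgc.continuousOn]
      rfl
    rw [h2] at h1
    exact_mod_cast h1
  have e1 : Continuous fun z => (((h z).re : ℝ) : ℂ) := by fun_prop
  have e2 : Continuous fun z => (((h z).im : ℝ) : ℂ) := by fun_prop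
  have hsplit : h = fun z => (((h z).re : ℝ) : ℂ) + Complex.I * (((h z).im : ℝ) : ℂ) := by
    ext z
    rw [mul_comm, Complex.re_add_im]
  rw [hsplit, integral_add (integrable_normalMeasure R ψ e1)
    (integrable_normalMeasure R ψ (by fun_prop)), integral_const_mul,
    hreal _ (by fun_prop), hreal _ (by fun_prop),
    cfc_add (R := ℂ) (p := IsStarNormal) R _ _ e1.continuousOn (by fun_prop),
    cfc_const_mul (R := ℂ) (p := IsStarNormal) Complex.I _ R e2.continuousOn]
  simp

theorem norm_cfc_apply_sq (ψ : E) {h : ℂ → ℂ} (hh : Continuous h) :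
    ‖cfc h R ψ‖ ^ 2 = ∫ z, ‖h z‖ ^ 2 ∂(normalMeasure R ψ) := by
  have h1 := integral_normalMeasure R ψ (h := fun z => star (h z) * h z) (by fun_prop)
  rw [cfc_mul (R := ℂ) (p := IsStarNormal) _ _ R (by fun_prop) (by fun_prop),
    cfc_star] at h1
  change _ = ⟪ψ, star (cfc h R) (cfc h R ψ)⟫_ℂ at h1
  rw [ContinuousLinearMap.star_eq_adjoint, ContinuousLinearMap.adjoint_inner_right,
    inner_self_eq_norm_sq_to_K] at h1
  have e : ∀ z, star (h z) * h z = ((‖h z‖ ^ 2 : ℝ) : ℂ) := by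
    intro z
    rw [RCLike.star_def, Complex.conj_mul']
    norm_cast
  simp_rw [e] at h1
  rw [integral_complex_ofReal] at h1
  apply Complex.ofReal_injective
  rw [h1]
  push_cast
  rfl

theorem normalMeasure_real_univ (ψ : E) : (normalMeasure R ψ).real Set.univ = ‖ψ‖ ^ 2 := by
  have h := norm_cfc_apply_sq R ψ (h := fun _ => 1) continuous_const
  rw [cfc_const_one ℂ R] at h
  simpa using h.symm

/-- For a Borel set `B ⊆ ℂ`, an orthogonal projection with `⟨ψ, P ψ⟩` equal to the spectral measure
of `B` for every `ψ`, lying in the bicommutant of the normal operator `R`. -/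
def IsSpectralProjection (B : Set ℂ) (P : E →L[ℂ] E) : Prop :=
  IsStarProjection P ∧ (∀ ψ, ‖P ψ‖ ^ 2 = (normalMeasure R ψ).real B) ∧
    ∀ S : E →L[ℂ] E, Commute S R → Commute S (star R) → Commute S P

variable {R}

/-- The indicator of a closed set is the pointwise limit of continuous functions `g n` with values
in `[0, 1]`, and the operators `g n (R)` converge strongly by dominated convergence for the spectral
measures. -/
theorem exists_isSpectralProjection_of_isClosed {K : Set ℂ} (hK : IsClosed K) :
    ∃ P, IsSpectralProjection R K P := by
  let g : ℕ → ℂ → ℝ := fun n z => (hK.apprSeq n z : ℝ)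
  have hg : ∀ n, Continuous (g n) := fun n => by fun_prop
  have hgc : ∀ n, Continuous fun z => (g n z : ℂ) := fun n => by fun_prop
  have hg0 : ∀ n z, 0 ≤ g n z := fun n z => NNReal.coe_nonneg _
  have hg1 : ∀ n z, g n z ≤ 1 := fun n z => by
    exact_mod_cast HasOuterApproxClosed.apprSeq_apply_le_one hK n z
  have hlim : ∀ z, Tendsto (fun n => g n z) atTop (nhds (K.indicator (fun _ => (1 : ℝ)) z)) := by
    intro z
    have h := tendsto_pi_nhds.1 (HasOuterApproxClosed.tendsto_apprSeq hK) z
    have e : K.indicator (fun _ => (1 : ℝ)) z =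
        ((K.indicator (fun _ => (1 : NNReal)) z : NNReal) : ℝ) := by
      by_cases hz : z ∈ K <;> simp [hz]
    rw [e]
    exact (NNReal.continuous_coe.tendsto _).comp h
  let T : ℕ → E →L[ℂ] E := fun n => cfc (fun z => (g n z : ℂ)) R
  have hTsa : ∀ n, IsSelfAdjoint (T n) := fun n => by
    simp only [T]
    rw [isSelfAdjoint_iff, ← cfc_star]
    simp
  have hI : MeasurableSet K := hK.measurableSet
  -- Dominated convergence in the form needed below: the integral of `F (g n) 1_K`
  -- tends to that of `F 1_K 1_K`, with `F a b = (a - b)²` for the Cauchy property, `a²` and `a` for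
  -- idempotence, and `a²` for the norms.
  have hDCT : ∀ (ψ : E) (F : ℝ → ℝ → ℝ), Continuous (fun p : ℝ × ℝ => F p.1 p.2) →
      (∀ a b, 0 ≤ a → a ≤ 1 → 0 ≤ b → b ≤ 1 → |F a b| ≤ 1) →
      Tendsto (fun n => ∫ z, F (g n z) (K.indicator (fun _ => (1 : ℝ)) z) ∂(normalMeasure R ψ))
        atTop (nhds (∫ z, F (K.indicator (fun _ => (1 : ℝ)) z) (K.indicator (fun _ => (1 : ℝ)) z)
          ∂(normalMeasure R ψ))) := by
    intro ψ F hF hb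
    have h01 : ∀ z, 0 ≤ K.indicator (fun _ => (1 : ℝ)) z ∧ K.indicator (fun _ => (1 : ℝ)) z ≤ 1 := by
      intro z
      by_cases hz : z ∈ K <;> simp [hz]
    refine tendsto_integral_of_dominated_convergence (fun _ => 1) (fun n => ?_)
      (integrable_const _) (fun n => ?_) ?_
    · exact (hF.measurable.comp ((hg n).measurable.prodMk
        (measurable_const.indicator hI))).aestronglyMeasurable
    · exact Eventually.of_forall fun z => hb _ _ (hg0 n z) (hg1 n z) (h01 z).1 (h01 z).2
    · refine Eventually.of_forall fun z => ?_
      exact (hF.tendsto (_, _)).comp ((hlim z).prodMk_nhds tendsto_const_nhds)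
  have hnorm : ∀ n ψ, ‖T n ψ‖ ^ 2 = ∫ z, g n z ^ 2 ∂(normalMeasure R ψ) := by
    intro n ψ
    rw [norm_cfc_apply_sq R ψ (hgc n)]
    simp
  have hinner : ∀ n ψ, (⟪ψ, T n ψ⟫_ℂ).re = ∫ z, g n z ∂(normalMeasure R ψ) := by
    intro n ψ
    simp only [T]
    rw [← integral_normalMeasure R ψ (hgc n), integral_complex_ofReal, Complex.ofReal_re]
  have hind : ∀ ψ, ∫ z, K.indicator (fun _ => (1 : ℝ)) z ^ 2 ∂(normalMeasure R ψ) =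
      (normalMeasure R ψ).real K := by
    intro ψ
    rw [← integral_indicator_one hI]
    congr 1
    ext z
    by_cases hz : z ∈ K <;> simp [hz]
  obtain ⟨P, hP, hPlim⟩ := exists_isStarProjection_of_cauchySeq hTsa (fun ψ => by
    have h := (hDCT ψ (fun a b => (a - b) ^ 2) (by fun_prop) (by
      intro a b h1 h2 h3 h4
      rw [abs_of_nonneg (sq_nonneg _), sq_le_one_iff_abs_le_one, abs_le]
      constructor <;> linarith)).const_mul 2
    simp only [sub_self, ne_eq, OfNat.ofNat_ne_zero, not_false_eq_true, zero_pow, integral_zero,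
      mul_zero] at h
    refine cauchySeq_of_norm_sub_sq_le h fun n m => ?_
    have e : T n ψ - T m ψ = cfc (fun z => (g n z : ℂ) - (g m z : ℂ)) R ψ := by
      rw [cfc_sub (R := ℂ) (p := IsStarNormal) _ _ R (hgc n).continuousOn (hgc m).continuousOn]
      rfl
    rw [e, norm_cfc_apply_sq R ψ (by fun_prop), ← mul_add, ← integral_add, ← integral_const_mul]
    · refine integral_mono (integrable_normalMeasure R ψ (by fun_prop)) ?_ fun z => ?_
      · refine Integrable.const_mul (Integrable.add ?_ ?_) 2
        all_goals
          refine Integrable.of_bound (C := 1) (Measurable.aestronglyMeasurable ?_)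
            (Eventually.of_forall fun z => ?_)
          · exact ((hg _).measurable.sub (measurable_const.indicator hI)).pow_const 2
          · rw [Real.norm_eq_abs, abs_of_nonneg (sq_nonneg _), sq_le_one_iff_abs_le_one, abs_le]
            by_cases hz : z ∈ K <;> simp only [hz, Set.indicator_of_mem, Set.indicator_of_notMem,
              not_false_eq_true] <;> constructor <;> linarith [hg0 n z, hg1 n z, hg0 m z, hg1 m z]
      · simp only
        rw [← Complex.ofReal_sub, Complex.norm_real, Real.norm_eq_abs, sq_abs]
        nlinarith [sq_nonneg ((g n z - K.indicator (fun _ => (1 : ℝ)) z) +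
          (g m z - K.indicator (fun _ => (1 : ℝ)) z))]
    all_goals
      refine Integrable.of_bound (C := 1) (Measurable.aestronglyMeasurable ?_)
        (Eventually.of_forall fun z => ?_)
      · exact ((hg _).measurable.sub (measurable_const.indicator hI)).pow_const 2
      · rw [Real.norm_eq_abs, abs_of_nonneg (sq_nonneg _), sq_le_one_iff_abs_le_one, abs_le]
        by_cases hz : z ∈ K <;> simp only [hz, Set.indicator_of_mem, Set.indicator_of_notMem,
          not_false_eq_true] <;> constructor <;> linarith [hg0 n z, hg1 n z, hg0 m z, hg1 m z])
    (fun ψ => by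
      have h1 := hDCT ψ (fun a _ => a ^ 2) (by fun_prop) (by
        intro a b h1 h2 h3 h4
        rw [abs_of_nonneg (sq_nonneg _), sq_le_one_iff_abs_le_one, abs_le]
        constructor <;> linarith)
      have h2 := hDCT ψ (fun a _ => a) (by fun_prop) (by
        intro a b h1 h2 h3 h4
        rw [abs_le]
        constructor <;> linarith)
      have h3 := h1.sub h2
      simp only [← hnorm, ← hinner] at h3
      convert h3 using 2
      rw [hind, ← integral_indicator_one hI, sub_eq_zero.2]
      rfl)
  refine ⟨P, hP, fun ψ => ?_, fun S hS hS' => commute_of_tendsto hPlim fun n => ?_⟩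
  · have h1 := hDCT ψ (fun a _ => a ^ 2) (by fun_prop) (by
      intro a b h1 h2 h3 h4
      rw [abs_of_nonneg (sq_nonneg _), sq_le_one_iff_abs_le_one, abs_le]
      constructor <;> linarith)
    simp only [← hnorm, hind] at h1
    exact tendsto_nhds_unique ((hPlim ψ).norm.pow 2) h1
  · exact (Commute.cfc hS.symm hS'.symm _).symm

/-- Disjoint sets have orthogonal spectral projections. -/
theorem IsSpectralProjection.mul_eq_zero {A B : Set ℂ} {P Q : E →L[ℂ] E}
    (hP : IsSpectralProjection R A P) (hQ : IsSpectralProjection R B Q) (hB : MeasurableSet B)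
    (hd : Disjoint A B) : P * Q = 0 := by
  refine mul_eq_zero_of_norm_sq_add_le hQ.1 fun x => ?_
  rw [hP.2.1, hQ.2.1, ← measureReal_union hd hB, ← normalMeasure_real_univ R]
  exact measureReal_mono (Set.subset_univ _)

/-- Every Borel subset of `ℂ` has a spectral projection: this holds for closed sets by
approximation with continuous functions, and is stable under complements and countable disjoint
unions. -/
theorem exists_isSpectralProjection {B : Set ℂ} (hB : MeasurableSet B) :
    ∃ P, IsSpectralProjection R B P := by
  refine MeasurableSpace.induction_on_inter (C := fun B _ => ∃ P, IsSpectralProjection R B P)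
    (s := {K : Set ℂ | IsClosed K})
    (by rw [← borel_eq_generateFrom_isClosed]; exact BorelSpace.measurable_eq)
    isPiSystem_isClosed ?_ ?_ ?_ ?_ B hB
  · exact exists_isSpectralProjection_of_isClosed isClosed_empty
  · exact fun K hK => exists_isSpectralProjection_of_isClosed hK
  · rintro A hA ⟨P, hP1, hP2, hP3⟩
    refine ⟨1 - P, hP1.one_sub, fun ψ => ?_, fun S hS hS' => ?_⟩
    · change ‖ψ - P ψ‖ ^ 2 = _
      rw [norm_sub_apply_sq hP1, hP2, ← normalMeasure_real_univ R, measureReal_compl hA]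
    · exact (Commute.one_right S).sub_right (hP3 S hS hS')
  · intro B hd hm h
    choose T hT using h
    have ho : ∀ i j, i ≠ j → T i * T j = 0 := fun i j hij =>
      (hT i).mul_eq_zero (hT j) (hm j) (hd hij)
    have hs : ∀ ψ, HasSum (fun i => ‖T i ψ‖ ^ 2) ((normalMeasure R ψ).real (⋃ i, B i)) := by
      intro ψ
      simp_rw [(hT _).2.1]
      have h := measure_iUnion (μ := normalMeasure R ψ) hd hm
      simp only [Measure.real, h]
      rw [ENNReal.tsum_toReal_eq fun i => measure_ne_top _ _]
      exact ENNReal.hasSum_toReal (h ▸ measure_ne_top _ _)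
    obtain ⟨P, hP, hlim⟩ := exists_isStarProjection_tsum (fun i => (hT i).1) ho
      fun ψ => (hs ψ).summable
    refine ⟨P, hP, fun ψ => ?_, fun S hS hS' => commute_of_tendsto hlim fun n => ?_⟩
    · have h1 := (hlim ψ).norm.pow 2
      simp_rw [norm_sum_apply_sq (fun i => (hT i).1) ho] at h1
      exact tendsto_nhds_unique h1 (hs ψ).tendsto_sum_nat
    · exact Commute.sum_right _ _ _ fun i _ => (hT i).2.2 S hS hS'

end NormalOperator

/-! ### Projection-valued measures and resolvents -/

section PVMLemmas

variable {E : Type*} [NormedAddCommGroup E] [InnerProductSpace ℂ E] [CompleteSpace E]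

namespace ProjectionValuedMeasure

variable (P : ProjectionValuedMeasure E)

theorem measureAt_eq_norm_sq (ψ : E) {B : Set ℝ} (hB : MeasurableSet B) :
    P.measureAt ψ B = ENNReal.ofReal (‖P.proj B ψ‖ ^ 2) := by
  rw [P.measureAt_apply ψ hB, inner_apply_eq_norm_sq (P.isStarProjection B hB), Complex.ofReal_re]

theorem measureAt_real (ψ : E) {B : Set ℝ} (hB : MeasurableSet B) :
    (P.measureAt ψ).real B = ‖P.proj B ψ‖ ^ 2 := by
  rw [Measure.real, P.measureAt_eq_norm_sq ψ hB, ENNReal.toReal_ofReal (sq_nonneg _)]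

instance (ψ : E) : IsFiniteMeasure (P.measureAt ψ) :=
  ⟨by rw [P.measureAt_eq_norm_sq ψ MeasurableSet.univ]; exact ENNReal.ofReal_lt_top⟩

theorem measureAt_real_univ (ψ : E) : (P.measureAt ψ).real Set.univ = ‖ψ‖ ^ 2 := by
  rw [P.measureAt_real ψ MeasurableSet.univ, P.univ]
  rfl

theorem proj_proj {A B : Set ℝ} (hA : MeasurableSet A) (hB : MeasurableSet B) (ψ : E) :
    P.proj A (P.proj B ψ) = P.proj (A ∩ B) ψ := by
  rw [P.inter A B hA hB]
  rfl

theorem measureAt_proj {A : Set ℝ} (hA : MeasurableSet A) (ψ : E) :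
    P.measureAt (P.proj A ψ) = (P.measureAt ψ).restrict A := by
  ext B hB
  rw [Measure.restrict_apply hB, P.measureAt_eq_norm_sq _ hB, P.proj_proj hB hA,
    P.measureAt_eq_norm_sq _ (hB.inter hA)]

theorem proj_compl {B : Set ℝ} (hB : MeasurableSet B) (ψ : E) :
    P.proj Bᶜ ψ = ψ - P.proj B ψ := by
  have h : P.proj Bᶜ = 1 - P.proj B := by
    refine eq_of_forall_re_inner_eq (P.isStarProjection _ hB.compl).isSelfAdjoint
      (P.isStarProjection _ hB).one_sub.isSelfAdjoint fun x => ?_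
    rw [inner_apply_eq_norm_sq (P.isStarProjection _ hB.compl),
      inner_apply_eq_norm_sq (P.isStarProjection _ hB).one_sub, Complex.ofReal_re,
      Complex.ofReal_re]
    change _ = ‖x - P.proj B x‖ ^ 2
    rw [norm_sub_apply_sq (P.isStarProjection _ hB), ← P.measureAt_real x hB.compl,
      ← P.measureAt_real x hB, measureReal_compl hB, P.measureAt_real_univ]
  rw [h]
  rfl

theorem inner_proj_proj_compl {B C : Set ℝ} (hB : MeasurableSet B) (hC : MeasurableSet C)
    (χ φ : E) : ⟪P.proj C (P.proj B χ), P.proj C (P.proj Bᶜ φ)⟫_ℂ = 0 := by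
  rw [P.proj_proj hC hB, P.proj_proj hC hB.compl,
    inner_apply_eq_of_isSelfAdjoint (P.isStarProjection _ (hC.inter hB)).isSelfAdjoint,
    P.proj_proj (hC.inter hB) (hC.inter hB.compl)]
  have : C ∩ B ∩ (C ∩ Bᶜ) = ∅ := by
    ext x
    simp
    tauto
  rw [this, P.empty]
  simp

/-- Vectors in the ranges of `P(B)` and of its complement contribute independently to the spectral
measure, whatever their relative phase. -/
theorem measureAt_smul_add {B : Set ℝ} (hB : MeasurableSet B) (χ φ : E) {a : ℂ} (ha : ‖a‖ = 1) :
    P.measureAt (a • P.proj B χ + P.proj Bᶜ φ) =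
      P.measureAt (P.proj B χ) + P.measureAt (P.proj Bᶜ φ) := by
  ext C hC
  rw [Measure.add_apply, P.measureAt_eq_norm_sq _ hC, P.measureAt_eq_norm_sq _ hC,
    P.measureAt_eq_norm_sq _ hC, ← ENNReal.ofReal_add (sq_nonneg _) (sq_nonneg _), map_add,
    map_smul]
  congr 1
  have h := norm_add_sq_eq_norm_sq_add_norm_sq_of_inner_eq_zero (𝕜 := ℂ)
    (a • P.proj C (P.proj B χ)) (P.proj C (P.proj Bᶜ φ))
    (by rw [inner_smul_left, P.inner_proj_proj_compl hB hC, mul_zero])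
  rw [norm_smul, ha, one_mul] at h
  simpa [pow_two] using h

end ProjectionValuedMeasure

/-- `R` is the resolvent `(T + iη)⁻¹` of a self-adjoint operator `T`. The identities that express
`R - R* = -2iη R* R = -2iη R R*` encode that `T` is symmetric and that `(T - iη)⁻¹ = R*`. -/
structure IsResolvent (T : E →ₗ.[ℂ] E) (η : ℝ) (R : E →L[ℂ] E) : Prop where
  mem : ∀ ψ, R ψ ∈ T.domain
  apply_eq : ∀ ψ, T ⟨R ψ, mem ψ⟩ = ψ - (Complex.I * η) • R ψ
  left_inv : ∀ φ : T.domain, R (T φ + (Complex.I * η) • (φ : E)) = φ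
  normal : IsStarNormal R
  sub_star : R - star R = -(2 * Complex.I * η) • (star R * R)

variable {T : E →ₗ.[ℂ] E} {η : ℝ} {R : E →L[ℂ] E}

theorem IsResolvent.injective (h : IsResolvent T η R) {ψ : E} (hψ : R ψ = 0) : ψ = 0 := by
  have h1 := h.apply_eq ψ
  have h2 : (⟨R ψ, h.mem ψ⟩ : T.domain) = 0 := Subtype.ext hψ
  rw [h2, T.map_zero, hψ, smul_zero, sub_zero] at h1
  exact h1.symm

/-- A vector orthogonal to the range of `R` is in the kernel of `R*`, hence in that of the normal
operator `R`. -/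
theorem IsResolvent.dense_domain (h : IsResolvent T η R) {ψ : E}
    (hψ : ∀ χ ∈ T.domain, ⟪χ, ψ⟫_ℂ = 0) : ψ = 0 := by
  have h1 : star R ψ = 0 := by
    refine ext_inner_left ℂ fun χ => ?_
    rw [ContinuousLinearMap.star_eq_adjoint, ContinuousLinearMap.adjoint_inner_right, inner_zero_right]
    exact hψ _ (h.mem χ)
  refine h.injective ?_
  have h2 := h.normal.star_comm_self
  have h3 : ‖R ψ‖ = ‖star R ψ‖ := by
    refine (pow_left_inj₀ (norm_nonneg _) (norm_nonneg _) two_ne_zero).1 ?_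
    have e1 : ((‖R ψ‖ ^ 2 : ℝ) : ℂ) = ⟪ψ, (star R * R) ψ⟫_ℂ := by
      change _ = ⟪ψ, star R (R ψ)⟫_ℂ
      rw [ContinuousLinearMap.star_eq_adjoint, ContinuousLinearMap.adjoint_inner_right,
        inner_self_eq_norm_sq_to_K]
      norm_cast
    have e2 : ((‖star R ψ‖ ^ 2 : ℝ) : ℂ) = ⟪ψ, (R * star R) ψ⟫_ℂ := by
      change _ = ⟪ψ, R (star R ψ)⟫_ℂ
      rw [← ContinuousLinearMap.adjoint_inner_left, ← ContinuousLinearMap.star_eq_adjoint,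
        inner_self_eq_norm_sq_to_K]
      norm_cast
    apply Complex.ofReal_injective
    rw [e1, e2, h2.eq]
  rw [h1, norm_zero, norm_eq_zero] at h3
  exact h3

theorem IsSpectralResolution.proj_mem {P : ProjectionValuedMeasure E}
    (hP : IsSpectralResolution T P) {B : Set ℝ} (hB : MeasurableSet B) {φ : E}
    (hφ : φ ∈ T.domain) : P.proj B φ ∈ T.domain := by
  rw [hP.1, P.measureAt_proj hB]
  exact (lintegral_mono' Measure.restrict_le_self le_rfl).trans_lt ((hP.1 φ).1 hφ)

theorem IsSpectralResolution.integrable_id {P : ProjectionValuedMeasure E}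
    (hP : IsSpectralResolution T P) {φ : E} (hφ : φ ∈ T.domain) :
    Integrable (fun x : ℝ => x) (P.measureAt φ) := by
  have h := (hP.1 φ).1 hφ
  have h2 : MemLp (fun x : ℝ => x) 2 (P.measureAt φ) := by
    refine (memLp_two_iff_integrable_sq measurable_id.aestronglyMeasurable).2
      ⟨(measurable_id.pow_const 2).aestronglyMeasurable, ?_⟩
    rw [HasFiniteIntegral]
    refine lt_of_le_of_lt (le_of_eq (lintegral_congr fun x => ?_)) h
    exact Real.enorm_eq_ofReal (sq_nonneg x)
  exact h2.integrable (by norm_num)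

/-- The ranges of `P(B)` and of its complement are orthogonal for the form of `T`. -/
theorem IsSpectralResolution.inner_proj_apply_proj_compl {P : ProjectionValuedMeasure E}
    (hP : IsSpectralResolution T P) {B : Set ℝ} (hB : MeasurableSet B) (χ φ : T.domain) :
    ⟪P.proj B (χ : E), T ⟨P.proj Bᶜ (φ : E), hP.proj_mem hB.compl φ.2⟩⟫_ℂ = 0 := by
  set u : T.domain := ⟨P.proj B (χ : E), hP.proj_mem hB χ.2⟩ with hu
  set v : T.domain := ⟨P.proj Bᶜ (φ : E), hP.proj_mem hB.compl φ.2⟩ with hv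
  have key : ∀ a : ℂ, ‖a‖ = 1 → ⟪((a • u + v : T.domain) : E), T (a • u + v)⟫_ℂ =
      ⟪(u : E), T u⟫_ℂ + ⟪(v : E), T v⟫_ℂ := by
    intro a ha
    rw [hP.2, hP.2, hP.2, ← Complex.ofReal_add]
    congr 1
    have hm : P.measureAt ((a • u + v : T.domain) : E) =
        P.measureAt (u : E) + P.measureAt (v : E) := P.measureAt_smul_add hB χ φ ha
    rw [hm, integral_add_measure (hP.integrable_id u.2) (hP.integrable_id v.2)]
  have hexp : ∀ a : ℂ, ⟪((a • u + v : T.domain) : E), T (a • u + v)⟫_ℂ =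
      star a * a * ⟪(u : E), T u⟫_ℂ + star a * ⟪(u : E), T v⟫_ℂ + a * ⟪(v : E), T u⟫_ℂ +
        ⟪(v : E), T v⟫_ℂ := by
    intro a
    rw [T.map_add, T.map_smul, Submodule.coe_add, Submodule.coe_smul, inner_add_left,
      inner_add_right, inner_add_right, inner_smul_left, inner_smul_left, inner_smul_right,
      inner_smul_right]
    simp only [RCLike.star_def]
    ring
  -- The relative phases `1` and `i` determine the sesquilinear form from the quadratic form.
  have h1 := key 1 (by simp)
  have h2 := key Complex.I (by simp)
  rw [hexp] at h1 h2
  simp only [star_one, one_mul, RCLike.star_def, Complex.conj_I] at h1 h2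
  have hI := Complex.I_mul_I
  change ⟪(u : E), T v⟫_ℂ = 0
  linear_combination (1 / 2 : ℂ) * h1 + (Complex.I / 2) * h2 +
    (-(1/2) * ⟪(v : E), T u⟫_ℂ + 1 / 2 * ⟪(u : E), T v⟫_ℂ + Complex.I / 2 * ⟪(u : E), T u⟫_ℂ) * hI

/-- Every spectral resolution of `T` commutes with the resolvent: the projections preserve the
domain of `T` and commute with `T`, since the form of `T` has no off-diagonal part. -/
theorem IsSpectralResolution.commute_resolvent {P : ProjectionValuedMeasure E}
    (hP : IsSpectralResolution T P) (h : IsResolvent T η R) {B : Set ℝ} (hB : MeasurableSet B) :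
    Commute (P.proj B) R := by
  have hsum : ∀ ψ : E, ψ = P.proj B ψ + P.proj Bᶜ ψ := fun ψ => by rw [P.proj_compl hB]; abel
  have hT : ∀ φ : T.domain, T ⟨P.proj B (φ : E), hP.proj_mem hB φ.2⟩ = P.proj B (T φ) := by
    intro φ
    rw [← sub_eq_zero]
    refine h.dense_domain fun χ hχ => ?_
    have hφ : φ = (⟨P.proj B (φ : E), hP.proj_mem hB φ.2⟩ : T.domain) +
        ⟨P.proj Bᶜ (φ : E), hP.proj_mem hB.compl φ.2⟩ := Subtype.ext (hsum φ)
    have h1 : ⟪χ, P.proj B (T φ)⟫_ℂ =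
        ⟪P.proj B χ, T ⟨P.proj B (φ : E), hP.proj_mem hB φ.2⟩⟫_ℂ := by
      rw [← inner_apply_eq_of_isSelfAdjoint (P.isStarProjection B hB).isSelfAdjoint]
      conv_lhs => rw [hφ]
      rw [T.map_add, inner_add_right, hP.inner_proj_apply_proj_compl hB ⟨χ, hχ⟩ φ, add_zero]
    have h2 := hP.inner_proj_apply_proj_compl hB.compl ⟨χ, hχ⟩ φ
    simp only [compl_compl] at h2
    rw [inner_sub_right, h1]
    conv_lhs => rw [hsum χ]
    rw [inner_add_left, h2, ← hsum]
    simp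
  refine ContinuousLinearMap.ext fun ψ => ?_
  change P.proj B (R ψ) = R (P.proj B ψ)
  have h1 := h.left_inv ⟨P.proj B (R ψ), hP.proj_mem hB (h.mem ψ)⟩
  rw [hT ⟨R ψ, h.mem ψ⟩, h.apply_eq, map_sub, map_smul, sub_add_cancel] at h1
  exact h1.symm

end PVMLemmas

/-! ### Uniqueness and existence of spectral resolutions -/

section Uniqueness

variable {E : Type*} [NormedAddCommGroup E] [InnerProductSpace ℂ E] [CompleteSpace E]
variable {T : E →ₗ.[ℂ] E} {P Q : ProjectionValuedMeasure E}

theorem IsSpectralResolution.mem_domain_of_bounded (hP : IsSpectralResolution T P) {A : Set ℝ}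
    (hA : MeasurableSet A) {c : ℝ} (hc : ∀ x ∈ A, |x| ≤ c) (ψ : E) : P.proj A ψ ∈ T.domain := by
  rw [hP.1, P.measureAt_proj hA]
  calc ∫⁻ x in A, ENNReal.ofReal (x ^ 2) ∂(P.measureAt ψ)
      ≤ ∫⁻ x in A, ENNReal.ofReal (c ^ 2) ∂(P.measureAt ψ) := by
        refine setLIntegral_mono' hA fun x hx => ENNReal.ofReal_le_ofReal ?_
        exact sq_le_sq' (abs_le.1 (hc x hx)).1 (abs_le.1 (hc x hx)).2
    _ < ∞ := by
        rw [setLIntegral_const]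
        exact ENNReal.mul_lt_top ENNReal.ofReal_lt_top (measure_lt_top _ _)

theorem IsSpectralResolution.re_inner_le (hP : IsSpectralResolution T P) {A : Set ℝ}
    (hA : MeasurableSet A) {a : ℝ} (ha : ∀ x ∈ A, x ≤ a) {φ : T.domain}
    (hφ : P.proj A (φ : E) = φ) : (⟪(φ : E), T φ⟫_ℂ).re ≤ a * ‖(φ : E)‖ ^ 2 := by
  rw [hP.2, Complex.ofReal_re, ← P.measureAt_real_univ, ← hφ, P.measureAt_proj hA]
  have hi : Integrable (fun x : ℝ => x) ((P.measureAt (φ : E)).restrict A) :=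
    (hP.integrable_id φ.2).restrict
  calc ∫ x in A, x ∂(P.measureAt (φ : E)) ≤ ∫ x in A, a ∂(P.measureAt (φ : E)) :=
        setIntegral_mono_on hi (integrable_const _).integrableOn hA ha
    _ = _ := by simp [mul_comm]

theorem IsSpectralResolution.le_re_inner (hP : IsSpectralResolution T P) {A : Set ℝ}
    (hA : MeasurableSet A) {a : ℝ} (ha : ∀ x ∈ A, a ≤ x) {φ : T.domain}
    (hφ : P.proj A (φ : E) = φ) : a * ‖(φ : E)‖ ^ 2 ≤ (⟪(φ : E), T φ⟫_ℂ).re := by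
  rw [hP.2, Complex.ofReal_re, ← P.measureAt_real_univ, ← hφ, P.measureAt_proj hA]
  have hi : Integrable (fun x : ℝ => x) ((P.measureAt (φ : E)).restrict A) :=
    (hP.integrable_id φ.2).restrict
  calc _ = ∫ x in A, a ∂(P.measureAt (φ : E)) := by simp [mul_comm]
    _ ≤ ∫ x in A, x ∂(P.measureAt (φ : E)) :=
        setIntegral_mono_on (integrable_const _).integrableOn hi hA ha

/-- On the range of `P(A) Q(B)`, with `A` below `a` and `B` above `b > a`, the form of `T` is at
the same time at most `a` and at least `b`. -/
theorem IsSpectralResolution.proj_mul_proj_eq_zero (hP : IsSpectralResolution T P)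
    (hQ : IsSpectralResolution T Q)
    (hc : ∀ A B, MeasurableSet A → MeasurableSet B → Commute (P.proj A) (Q.proj B))
    {a b : ℝ} (hab : a < b) (n m : ℕ) (ψ : E) :
    P.proj (Set.Icc (-n : ℝ) a) (Q.proj (Set.Icc b m) ψ) = 0 := by
  have hA : MeasurableSet (Set.Icc (-n : ℝ) a) := measurableSet_Icc
  have hB : MeasurableSet (Set.Icc b (m : ℝ)) := measurableSet_Icc
  set φ := P.proj (Set.Icc (-n : ℝ) a) (Q.proj (Set.Icc b m) ψ) with hφ
  have h1 : P.proj (Set.Icc (-n : ℝ) a) φ = φ := by rw [hφ, P.proj_proj hA hA, Set.inter_self]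
  have hφ' : φ = Q.proj (Set.Icc b m) (P.proj (Set.Icc (-n : ℝ) a) ψ) :=
    congrArg (fun S : E →L[ℂ] E => S ψ) (hc _ _ hA hB).eq
  have h2 : Q.proj (Set.Icc b m) φ = φ := by
    rw [hφ', Q.proj_proj hB hB, Set.inter_self]
  have hmem : φ ∈ T.domain := hP.mem_domain_of_bounded hA (c := max n |a|) (fun x hx => by
    rw [abs_le]
    constructor
    · linarith [le_max_left (n : ℝ) |a|, hx.1]
    · linarith [le_max_right (n : ℝ) |a|, hx.2, le_abs_self a]) _
  have h3 := hP.re_inner_le hA (a := a) (fun x hx => hx.2) (φ := ⟨φ, hmem⟩) h1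
  have h4 := hQ.le_re_inner hB (a := b) (fun x hx => hx.1) (φ := ⟨φ, hmem⟩) h2
  have h5 : ‖φ‖ ^ 2 = 0 := by
    have := sq_nonneg ‖φ‖
    simp only at h3 h4
    nlinarith
  simpa using h5

/-- For `a < b` the ranges of `P(-∞, a]` and `Q[b, ∞)` are orthogonal, so that
`⟨ψ, P(-∞, a] ψ⟩ ≤ ⟨ψ, Q(-∞, b] ψ⟩`; then `b` decreases to `a`. -/
theorem IsSpectralResolution.measureAt_Iic_le (hP : IsSpectralResolution T P)
    (hQ : IsSpectralResolution T Q)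
    (hc : ∀ A B, MeasurableSet A → MeasurableSet B → Commute (P.proj A) (Q.proj B))
    (ψ : E) (a : ℝ) : P.measureAt ψ (Set.Iic a) ≤ Q.measureAt ψ (Set.Iic a) := by
  -- Bounded intervals exhaust the half-lines: only vectors with bounded spectral support are
  -- known to be in the domain of `T`.
  have hIicN : ∀ a : ℝ, Set.Iic a = ⋃ n : ℕ, Set.Icc (-n : ℝ) a := by
    intro a
    ext x
    simp only [Set.mem_Iic, Set.mem_iUnion, Set.mem_Icc]
    refine ⟨fun h => ?_, fun ⟨n, h⟩ => h.2⟩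
    obtain ⟨n, hn⟩ := exists_nat_ge (-x)
    exact ⟨n, by linarith, h⟩
  have hIciN : ∀ b : ℝ, Set.Ici b = ⋃ n : ℕ, Set.Icc b (n : ℝ) := by
    intro a
    ext x
    simp only [Set.mem_Ici, Set.mem_iUnion, Set.mem_Icc]
    refine ⟨fun h => ?_, fun ⟨n, h⟩ => h.1⟩
    obtain ⟨n, hn⟩ := exists_nat_ge x
    exact ⟨n, h, hn⟩
  have hz : ∀ b, a < b → P.proj (Set.Iic a) (Q.proj (Set.Ici b) ψ) = 0 := by
    intro b hab
    have h1 : ∀ m : ℕ, P.proj (Set.Iic a) (Q.proj (Set.Icc b m) ψ) = 0 := by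
      intro m
      have h : P.measureAt (Q.proj (Set.Icc b m) ψ) (Set.Iic a) = 0 := by
        rw [hIicN, measure_iUnion_null_iff]
        intro n
        rw [P.measureAt_eq_norm_sq _ measurableSet_Icc, hP.proj_mul_proj_eq_zero hQ hc hab]
        simp
      rw [P.measureAt_eq_norm_sq _ measurableSet_Iic, ENNReal.ofReal_eq_zero] at h
      simpa using le_antisymm h (sq_nonneg _)
    have hcomm : ∀ B, MeasurableSet B → P.proj (Set.Iic a) (Q.proj B ψ) =
        Q.proj B (P.proj (Set.Iic a) ψ) := fun B hB =>
      congrArg (fun S : E →L[ℂ] E => S ψ) (hc _ _ measurableSet_Iic hB).eq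
    have h : Q.measureAt (P.proj (Set.Iic a) ψ) (Set.Ici b) = 0 := by
      rw [hIciN, measure_iUnion_null_iff]
      intro n
      rw [Q.measureAt_eq_norm_sq _ measurableSet_Icc, ← hcomm _ measurableSet_Icc, h1]
      simp
    rw [Q.measureAt_eq_norm_sq _ measurableSet_Ici, ENNReal.ofReal_eq_zero] at h
    rw [hcomm _ measurableSet_Ici]
    simpa using le_antisymm h (sq_nonneg _)
  have hb : ∀ b, a < b → P.measureAt ψ (Set.Iic a) ≤ Q.measureAt ψ (Set.Iic b) := by
    intro b hab
    have hsum : ψ = Q.proj (Set.Iio b) ψ + Q.proj (Set.Ici b) ψ := by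
      have := Q.proj_compl (measurableSet_Iio (a := b)) ψ
      rw [Set.compl_Iio] at this
      rw [this]
      abel
    have h1 : P.proj (Set.Iic a) ψ = P.proj (Set.Iic a) (Q.proj (Set.Iio b) ψ) := by
      conv_lhs => rw [hsum]
      rw [map_add, hz b hab, add_zero]
    calc P.measureAt ψ (Set.Iic a) = P.measureAt (Q.proj (Set.Iio b) ψ) (Set.Iic a) := by
          rw [P.measureAt_eq_norm_sq _ measurableSet_Iic, P.measureAt_eq_norm_sq _ measurableSet_Iic,
            h1]
      _ ≤ P.measureAt (Q.proj (Set.Iio b) ψ) Set.univ := measure_mono (Set.subset_univ _)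
      _ = Q.measureAt ψ (Set.Iio b) := by
          rw [P.measureAt_eq_norm_sq _ MeasurableSet.univ, P.univ,
            Q.measureAt_eq_norm_sq _ measurableSet_Iio]
          rfl
      _ ≤ Q.measureAt ψ (Set.Iic b) := measure_mono Set.Iio_subset_Iic_self
  have hlim : Tendsto (fun n : ℕ => Q.measureAt ψ (Set.Iic (a + 1 / ((n : ℝ) + 1)))) atTop
      (nhds (Q.measureAt ψ (⋂ n : ℕ, Set.Iic (a + 1 / ((n : ℝ) + 1))))) := by
    refine tendsto_measure_iInter_atTop (fun n => measurableSet_Iic.nullMeasurableSet)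
      (fun n m hnm => Set.Iic_subset_Iic.2 ?_) ⟨0, measure_ne_top _ _⟩
    have : (1 : ℝ) / ((m : ℝ) + 1) ≤ 1 / ((n : ℝ) + 1) :=
      one_div_le_one_div_of_le (by positivity) (by exact_mod_cast Nat.succ_le_succ hnm)
    linarith
  have hset : (⋂ n : ℕ, Set.Iic (a + 1 / ((n : ℝ) + 1))) = Set.Iic a := by
    ext x
    simp only [Set.mem_iInter, Set.mem_Iic]
    refine ⟨fun h => ?_, fun h n => h.trans (by
      have : (0 : ℝ) < 1 / ((n : ℝ) + 1) := by positivity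
      linarith)⟩
    have h0 : Tendsto (fun n : ℕ => a + 1 / ((n : ℝ) + 1)) atTop (nhds (a + 0)) :=
      tendsto_const_nhds.add tendsto_one_div_add_atTop_nhds_zero_nat
    rw [add_zero] at h0
    exact ge_of_tendsto' h0 h
  rw [hset] at hlim
  refine ge_of_tendsto' hlim fun n => hb _ ?_
  have : (0 : ℝ) < 1 / ((n : ℝ) + 1) := by positivity
  linarith

/-- Two commuting spectral resolutions of the same operator have the same spectral measures. -/
theorem IsSpectralResolution.measureAt_eq (hP : IsSpectralResolution T P)
    (hQ : IsSpectralResolution T Q)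
    (hc : ∀ A B, MeasurableSet A → MeasurableSet B → Commute (P.proj A) (Q.proj B))
    (ψ : E) : P.measureAt ψ = Q.measureAt ψ :=
  Measure.ext_of_Iic _ _ fun a => le_antisymm (hP.measureAt_Iic_le hQ hc ψ a)
    (hQ.measureAt_Iic_le hP (fun A B hA hB => (hc B A hB hA).symm) ψ a)

end Uniqueness

section Existence

variable {E : Type*} [NormedAddCommGroup E] [InnerProductSpace ℂ E] [CompleteSpace E]
variable (R : E →L[ℂ] E) [hR : IsStarNormal R]

open Classical in
/-- The spectral projection of the normal operator `R` on a Borel subset of `ℂ`. -/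
def spectralProj (B : Set ℂ) : E →L[ℂ] E :=
  if h : MeasurableSet B then (exists_isSpectralProjection (R := R) h).choose else 0

theorem isSpectralProjection_spectralProj {B : Set ℂ} (hB : MeasurableSet B) :
    IsSpectralProjection R B (spectralProj R B) := by
  rw [spectralProj, dif_pos hB]
  exact (exists_isSpectralProjection (R := R) hB).choose_spec

theorem spectralProj_union {A B : Set ℂ} (hA : MeasurableSet A) (hB : MeasurableSet B)
    (hd : Disjoint A B) : spectralProj R (A ∪ B) = spectralProj R A + spectralProj R B := by
  have hPA := isSpectralProjection_spectralProj R hA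
  have hPB := isSpectralProjection_spectralProj R hB
  have hPAB := isSpectralProjection_spectralProj R (hA.union hB)
  refine eq_of_forall_re_inner_eq hPAB.1.isSelfAdjoint
    (hPA.1.isSelfAdjoint.add hPB.1.isSelfAdjoint) fun x => ?_
  rw [add_apply, inner_add_right, inner_apply_eq_norm_sq hPAB.1, inner_apply_eq_norm_sq hPA.1,
    inner_apply_eq_norm_sq hPB.1, ← Complex.ofReal_add, hPAB.2.1, hPA.2.1, hPB.2.1,
    measureReal_union hd hB]

theorem spectralProj_inter {A B : Set ℂ} (hA : MeasurableSet A) (hB : MeasurableSet B) :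
    spectralProj R (A ∩ B) = spectralProj R A * spectralProj R B := by
  have hz : ∀ C D : Set ℂ, MeasurableSet C → MeasurableSet D → Disjoint C D →
      spectralProj R C * spectralProj R D = 0 := fun C D hC hD h =>
    (isSpectralProjection_spectralProj R hC).mul_eq_zero (isSpectralProjection_spectralProj R hD)
      hD h
  have hAB := hA.inter hB
  have eA : spectralProj R A = spectralProj R (A ∩ B) + spectralProj R (A \ B) := by
    rw [← spectralProj_union R hAB (hA.diff hB)
      (Set.disjoint_sdiff_inter.symm), Set.inter_union_sdiff]
  have eB : spectralProj R B = spectralProj R (A ∩ B) + spectralProj R (B \ A) := by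
    rw [Set.inter_comm, ← spectralProj_union R (hB.inter hA) (hB.diff hA)
      (Set.disjoint_sdiff_inter.symm), Set.inter_union_sdiff]
  rw [eA, eB, add_mul, mul_add, mul_add,
    (isSpectralProjection_spectralProj R hAB).1.isIdempotentElem.eq,
    hz _ _ hAB (hB.diff hA) (Set.disjoint_left.2 fun x h1 h2 => h2.2 h1.1),
    hz _ _ (hA.diff hB) hAB (Set.disjoint_left.2 fun x h1 h2 => h1.2 h2.2),
    hz _ _ (hA.diff hB) (hB.diff hA) (Set.disjoint_left.2 fun x h1 h2 => h1.2 h2.1)]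
  simp

theorem norm_spectralProj_sq {B : Set ℂ} (hB : MeasurableSet B) (ψ : E) :
    ‖spectralProj R B ψ‖ ^ 2 = (normalMeasure R ψ).real B :=
  (isSpectralProjection_spectralProj R hB).2.1 ψ

/-- The image of the projection-valued measure of a normal operator under a Borel function. -/
def normalPVM {c : ℂ → ℝ} (hc : Measurable c) : ProjectionValuedMeasure E where
  proj B := spectralProj R (c ⁻¹' B)
  isStarProjection B hB := (isSpectralProjection_spectralProj R (hc hB)).1
  empty := by
    ext ψ
    have h := norm_spectralProj_sq R MeasurableSet.empty ψ
    simpa using h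
  univ := by
    ext ψ
    have h := norm_sub_apply_sq (isSpectralProjection_spectralProj R MeasurableSet.univ).1 ψ
    rw [norm_spectralProj_sq R MeasurableSet.univ, normalMeasure_real_univ, sub_self] at h
    have h2 : ψ - spectralProj R Set.univ ψ = 0 := by simpa using h
    simpa using (sub_eq_zero.1 h2).symm
  inter A B hA hB := spectralProj_inter R (hc hA) (hc hB)
  -- σ-additivity in the strong sense: the squared distance of the partial sums
  -- to the projection of the union is the tail of the series of the measures.
  iUnion B hB hd ψ := by
    set U := ⋃ i, B i with hU
    have hm : ∀ i, MeasurableSet (c ⁻¹' (B i)) := fun i => hc (hB i)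
    have hmU : MeasurableSet (c ⁻¹' U) := hc (MeasurableSet.iUnion hB)
    have hd' : Pairwise (Function.onFun Disjoint fun i => c ⁻¹' (B i)) := fun i j hij =>
      (hd hij).preimage c
    have ho : ∀ i j, i ≠ j → spectralProj R (c ⁻¹' (B i)) * spectralProj R (c ⁻¹' (B j)) = 0 :=
      fun i j hij => (isSpectralProjection_spectralProj R (hm i)).mul_eq_zero
        (isSpectralProjection_spectralProj R (hm j)) (hm j) (hd' hij)
    have hT : ∀ i, IsStarProjection (spectralProj R (c ⁻¹' (B i))) := fun i =>
      (isSpectralProjection_spectralProj R (hm i)).1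
    have hsub : ∀ i, spectralProj R (c ⁻¹' (B i)) (spectralProj R (c ⁻¹' U) ψ) =
        spectralProj R (c ⁻¹' (B i)) ψ := by
      intro i
      rw [← mul_apply_eq_comp, ← spectralProj_inter R (hm i) hmU,
        Set.inter_eq_left.2 (Set.preimage_mono (Set.subset_iUnion B i))]
    have hs : HasSum (fun i => ‖spectralProj R (c ⁻¹' (B i)) ψ‖ ^ 2)
        (‖spectralProj R (c ⁻¹' U) ψ‖ ^ 2) := by
      simp_rw [norm_spectralProj_sq R (hm _), norm_spectralProj_sq R hmU]
      have e : c ⁻¹' U = ⋃ i, c ⁻¹' (B i) := by rw [hU, Set.preimage_iUnion]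
      rw [e]
      simp only [Measure.real, measure_iUnion hd' hm]
      rw [ENNReal.tsum_toReal_eq fun i => measure_ne_top _ _]
      exact ENNReal.hasSum_toReal (measure_iUnion (μ := normalMeasure R ψ) hd' hm ▸
        measure_ne_top _ _)
    have hdiff : ∀ s : Finset ℕ, ‖spectralProj R (c ⁻¹' U) ψ -
        ∑ i ∈ s, spectralProj R (c ⁻¹' (B i)) ψ‖ ^ 2 = ‖spectralProj R (c ⁻¹' U) ψ‖ ^ 2 -
          ∑ i ∈ s, ‖spectralProj R (c ⁻¹' (B i)) ψ‖ ^ 2 := by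
      intro s
      have h := norm_sub_apply_sq (isStarProjection_sum hT ho s) (spectralProj R (c ⁻¹' U) ψ)
      rw [norm_sum_apply_sq hT ho, sum_apply] at h
      simpa only [hsub] using h
    have h0 : Tendsto (fun s : Finset ℕ => ‖spectralProj R (c ⁻¹' U) ψ -
        ∑ i ∈ s, spectralProj R (c ⁻¹' (B i)) ψ‖ ^ 2) atTop (nhds 0) := by
      simp_rw [hdiff]
      have h := (tendsto_const_nhds (x := ‖spectralProj R (c ⁻¹' U) ψ‖ ^ 2)).sub hs
      rwa [sub_self] at h
    have h1 : Tendsto (fun s : Finset ℕ => ‖spectralProj R (c ⁻¹' U) ψ -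
        ∑ i ∈ s, spectralProj R (c ⁻¹' (B i)) ψ‖) atTop (nhds 0) := by
      have h := (Real.continuous_sqrt.tendsto 0).comp h0
      simpa [Function.comp_def, Real.sqrt_sq (norm_nonneg _)] using h
    rw [HasSum, SummationFilter.unconditional_filter]
    rw [tendsto_iff_norm_sub_tendsto_zero]
    simpa only [norm_sub_rev] using h1

theorem measureAt_normalPVM {c : ℂ → ℝ} (hc : Measurable c) (ψ : E) :
    (normalPVM R hc).measureAt ψ = (normalMeasure R ψ).map c := by
  ext B hB
  rw [ProjectionValuedMeasure.measureAt_eq_norm_sq _ ψ hB, Measure.map_apply hc hB]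
  change ENNReal.ofReal (‖spectralProj R (c ⁻¹' B) ψ‖ ^ 2) = _
  rw [norm_spectralProj_sq R (hc hB), ofReal_measureReal]

theorem normalMeasure_spectralProj {A : Set ℂ} (hA : MeasurableSet A) (ψ : E) :
    normalMeasure R (spectralProj R A ψ) = (normalMeasure R ψ).restrict A := by
  ext B hB
  rw [Measure.restrict_apply hB, ← ofReal_measureReal, ← ofReal_measureReal,
    ← norm_spectralProj_sq R hB, ← norm_spectralProj_sq R (hB.inter hA),
    spectralProj_inter R hB hA]
  rfl

end Existence

/-! ### The spectral theorem for operators with a resolvent -/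

section Resolution

variable {E : Type*} [NormedAddCommGroup E] [InnerProductSpace ℂ E] [CompleteSpace E]
variable {T : E →ₗ.[ℂ] E} {η : ℝ} {R : E →L[ℂ] E}

/-- The inverse of `x ↦ (x + iη)⁻¹` on its range. The junk value at `z = 0` is harmless, because the
spectral measures of a resolvent do not charge `0`. -/
def spectralParam (z : ℂ) : ℝ := (z⁻¹).re

theorem measurable_spectralParam : Measurable spectralParam :=
  Complex.measurable_re.comp measurable_inv

theorem abs_spectralParam_mul_norm_le (z : ℂ) : |spectralParam z| * ‖z‖ ≤ 1 := by
  by_cases hz : z = 0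
  · simp [hz]
  · calc |spectralParam z| * ‖z‖ ≤ ‖z⁻¹‖ * ‖z‖ :=
        mul_le_mul_of_nonneg_right (Complex.abs_re_le_norm _) (norm_nonneg _)
      _ = 1 := by rw [norm_inv, inv_mul_cancel₀ (norm_ne_zero_iff.2 hz)]

theorem norm_sq_mul_spectralParam (z : ℂ) : ‖z‖ ^ 2 * spectralParam z = z.re := by
  by_cases hz : z = 0
  · simp [hz]
  · rw [spectralParam, Complex.inv_re, Complex.normSq_eq_norm_sq]
    field_simp

theorem cfc_id_eq [IsStarNormal R] : cfc (fun z : ℂ => z) R = R := cfc_id' ℂ R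

theorem norm_apply_sq_eq [IsStarNormal R] (ψ : E) :
    ‖R ψ‖ ^ 2 = ∫ z, ‖z‖ ^ 2 ∂(normalMeasure R ψ) := by
  have h := norm_cfc_apply_sq R ψ (h := fun z => z) continuous_id
  rwa [cfc_id_eq] at h

/-- A resolvent is injective. -/
theorem IsResolvent.normalMeasure_zero [IsStarNormal R] (h : IsResolvent T η R) (ψ : E) :
    normalMeasure R ψ {0} = 0 := by
  have h1 : R (spectralProj R {0} ψ) = 0 := by
    have h2 := norm_apply_sq_eq (R := R) (spectralProj R {0} ψ)
    rw [normalMeasure_spectralProj R (measurableSet_singleton 0),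
      integral_singleton] at h2
    simpa using h2
  have h3 := norm_spectralProj_sq R (measurableSet_singleton 0) ψ
  rw [h.injective h1, norm_zero] at h3
  rw [← ofReal_measureReal, ← h3]
  simp

/-- The identity `R - R* = -2iη R* R` puts the spectrum of `R` on the circle
`im z = -η |z|²`, the image of the real line under `x ↦ (x + iη)⁻¹`. -/
theorem IsResolvent.ae_im_eq [IsStarNormal R] (h : IsResolvent T η R) (ψ : E) :
    ∀ᵐ z ∂(normalMeasure R ψ), z.im = -η * ‖z‖ ^ 2 := by
  let g : ℂ → ℂ := fun z => z - star z + (2 * Complex.I * η) * (star z * z)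
  have hg : Continuous g := by fun_prop
  have h0 : cfc g R = 0 := by
    simp only [g]
    rw [cfc_add (R := ℂ) (p := IsStarNormal) R (fun z => z - star z)
        (fun z => (2 * Complex.I * η) * (star z * z)) (by fun_prop) (by fun_prop),
      cfc_sub (R := ℂ) (p := IsStarNormal) (fun z => z) (fun z => star z) R
        (by fun_prop) (by fun_prop),
      cfc_const_mul (R := ℂ) (p := IsStarNormal) (2 * Complex.I * η) (fun z => star z * z) R
        (by fun_prop),
      cfc_mul (R := ℂ) (p := IsStarNormal) (fun z => star z) (fun z => z) R
        (by fun_prop) (by fun_prop), cfc_star (fun z => z), cfc_id_eq, h.sub_star, neg_smul]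
    simp
  have h1 := norm_cfc_apply_sq R ψ hg
  rw [h0] at h1
  simp only [zero_apply, norm_zero, ne_eq, OfNat.ofNat_ne_zero, not_false_eq_true, zero_pow] at h1
  have h2 := (integral_eq_zero_iff_of_nonneg (fun z => sq_nonneg ‖g z‖)
    (integrable_normalMeasure R ψ (by fun_prop))).1 h1.symm
  filter_upwards [h2] with z hz
  have hz' : g z = 0 := by simpa using hz
  have := congrArg Complex.im hz'
  simp only [g, Complex.add_im, Complex.sub_im, RCLike.star_def, Complex.conj_im,
    Complex.conj_mul', Complex.zero_im] at this
  rw [← Complex.ofReal_pow, mul_assoc, mul_assoc, ← Complex.ofReal_mul] at this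
  have e : ((‖z‖ : ℂ) ^ 2).re = ‖z‖ ^ 2 := by rw [← Complex.ofReal_pow, Complex.ofReal_re]
  simp [e] at this
  linarith

/-- Up to null sets, the points `z` of the spectrum of `R` are `(x + iη)⁻¹` with
`x = spectralParam z`. -/
theorem IsResolvent.ae_inv_eq [IsStarNormal R] (h : IsResolvent T η R) (ψ : E) :
    ∀ᵐ z ∂(normalMeasure R ψ), z ≠ 0 ∧ z⁻¹ = (spectralParam z : ℂ) + Complex.I * η := by
  have h0 : ∀ᵐ z ∂(normalMeasure R ψ), z ≠ 0 := by
    rw [ae_iff]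
    simpa using h.normalMeasure_zero ψ
  filter_upwards [h0, h.ae_im_eq ψ] with z hz him
  refine ⟨hz, Complex.ext (by simp [spectralParam]) ?_⟩
  have hn : ‖z‖ ^ 2 ≠ 0 := pow_ne_zero 2 (norm_ne_zero_iff.2 hz)
  rw [Complex.inv_im, him, Complex.normSq_eq_norm_sq]
  simp
  field_simp

/-- `‖E(B) R φ‖² = ‖R E(B) φ‖²`, as the spectral projections commute with `R`. -/
theorem normalMeasure_apply_self [IsStarNormal R] (φ : E) :
    normalMeasure R (R φ) = (normalMeasure R φ).withDensity fun z => ENNReal.ofReal (‖z‖ ^ 2) := by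
  ext B hB
  have hP := isSpectralProjection_spectralProj R hB
  have hc : spectralProj R B (R φ) = R (spectralProj R B φ) :=
    congrArg (fun S : E →L[ℂ] E => S φ)
      (hP.2.2 R (Commute.refl R) (IsStarNormal.star_comm_self (x := R)).symm).symm.eq
  rw [withDensity_apply _ hB, ← ofReal_measureReal, ← norm_spectralProj_sq R hB, hc,
    norm_apply_sq_eq, normalMeasure_spectralProj R hB,
    ofReal_integral_eq_lintegral_ofReal _ (Eventually.of_forall fun z => sq_nonneg _)]
  exact (integrable_normalMeasure R φ (h := fun z : ℂ => ‖z‖ ^ 2) (by fun_prop)).restrict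

/-- A vector with `∫ |z|⁻² d⟨ψ, E_R(z) ψ⟩ < ∞` is in the range of `R`: regularised inverses of `R`
converge on it. -/
theorem IsResolvent.exists_apply_eq [IsStarNormal R] (h : IsResolvent T η R) {ψ : E}
    (hψ : Integrable (fun z : ℂ => ‖z⁻¹‖ ^ 2) (normalMeasure R ψ)) : ∃ χ, R χ = ψ := by
  -- `g n z = z̄ / (|z|² + ε n)` is continuous on all of `ℂ` and tends to `z⁻¹` away from `0`.
  let ε : ℕ → ℝ := fun n => 1 / ((n : ℝ) + 1)
  have hε : ∀ n, 0 < ε n := fun n => by positivity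
  have hε0 : Tendsto ε atTop (nhds 0) := tendsto_one_div_add_atTop_nhds_zero_nat
  let g : ℕ → ℂ → ℂ := fun n z => star z * (((‖z‖ ^ 2 + ε n)⁻¹ : ℝ) : ℂ)
  have hpos : ∀ n (z : ℂ), 0 < ‖z‖ ^ 2 + ε n := fun n z => by have := hε n; positivity
  have hg : ∀ n, Continuous (g n) := fun n =>
    continuous_star.mul (Complex.continuous_ofReal.comp
      (Continuous.inv₀ (by fun_prop) fun z => (hpos n z).ne'))
  have hgz : ∀ n (z : ℂ), z * g n z = ((‖z‖ ^ 2 * (‖z‖ ^ 2 + ε n)⁻¹ : ℝ) : ℂ) := by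
    intro n z
    simp only [g, RCLike.star_def]
    rw [← mul_assoc, Complex.mul_conj']
    push_cast
    rfl
  have hone : ∀ n (z : ℂ), z ≠ 0 → 1 - ‖z‖ ^ 2 * (‖z‖ ^ 2 + ε n)⁻¹ = ε n * (‖z‖ ^ 2 + ε n)⁻¹ := by
    intro n z hz
    have := (hpos n z).ne'
    field_simp
    ring
  have hle : ∀ n (z : ℂ), z ≠ 0 → ‖z * g n z - 1‖ ≤ 1 := by
    intro n z hz
    rw [hgz, ← Complex.ofReal_one, ← Complex.ofReal_sub, Complex.norm_real, norm_sub_rev, hone n z hz,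
      Real.norm_of_nonneg (mul_nonneg (hε n).le (inv_nonneg.2 (hpos n z).le)), ← div_eq_mul_inv,
      div_le_one (hpos n z)]
    nlinarith [sq_nonneg ‖z‖]
  have hlim : ∀ z : ℂ, z ≠ 0 → Tendsto (fun n => z * g n z - 1) atTop (nhds 0) := by
    intro z hz
    have hn : ‖z‖ ^ 2 ≠ 0 := pow_ne_zero 2 (norm_ne_zero_iff.2 hz)
    have h1 : Tendsto (fun n => (‖z‖ ^ 2 * (‖z‖ ^ 2 + ε n)⁻¹ : ℝ)) atTop (nhds 1) := by
      have h2 := ((hε0.const_add (‖z‖ ^ 2)).inv₀ (by simpa using hz)).const_mul (‖z‖ ^ 2)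
      rwa [add_zero, mul_inv_cancel₀ hn] at h2
    have h3 := ((Complex.continuous_ofReal.tendsto 1).comp h1).sub_const 1
    simpa [hgz, Function.comp_def] using h3
  have hne : ∀ᵐ z ∂(normalMeasure R ψ), z ≠ 0 := (h.ae_inv_eq ψ).mono fun z hz => hz.1
  have hfac : ∀ n (z : ℂ), z ≠ 0 → g n z - z⁻¹ = z⁻¹ * (z * g n z - 1) := by
    intro n z hz
    field_simp
  have hsq : ∀ n (z : ℂ), z ≠ 0 → ‖g n z - z⁻¹‖ ^ 2 ≤ ‖z⁻¹‖ ^ 2 := by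
    intro n z hz
    rw [hfac n z hz, norm_mul]
    exact pow_le_pow_left₀ (by positivity) (mul_le_of_le_one_right (norm_nonneg _) (hle n z hz)) 2
  have hmeas : ∀ n, AEStronglyMeasurable (fun z => ‖g n z - z⁻¹‖ ^ 2) (normalMeasure R ψ) :=
    fun n => (((hg n).measurable.sub measurable_inv).norm.pow_const 2).aestronglyMeasurable
  have e0 : Tendsto (fun n => ∫ z, ‖g n z - z⁻¹‖ ^ 2 ∂(normalMeasure R ψ)) atTop (nhds 0) := by
    have h1 := tendsto_integral_of_dominated_convergence (μ := normalMeasure R ψ)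
      (F := fun n z => ‖g n z - z⁻¹‖ ^ 2) (f := fun _ => (0 : ℝ))
      (fun z : ℂ => ‖z⁻¹‖ ^ 2) hmeas hψ
      (fun n => hne.mono fun z hz => by
        rw [Real.norm_of_nonneg (sq_nonneg _)]
        exact hsq n z hz)
      (hne.mono fun z hz => by
        have h2 := ((hlim z hz).const_mul z⁻¹).norm.pow 2
        simpa [hfac _ z hz] using h2)
    simpa using h1
  have hint : ∀ n, Integrable (fun z => ‖g n z - z⁻¹‖ ^ 2) (normalMeasure R ψ) := fun n =>
    hψ.mono' (hmeas n) (hne.mono fun z hz => by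
      rw [Real.norm_of_nonneg (sq_nonneg _)]
      exact hsq n z hz)
  have hcauchy : CauchySeq fun n => cfc (g n) R ψ := by
    have e1 := e0.const_mul 2
    rw [mul_zero] at e1
    refine cauchySeq_of_norm_sub_sq_le e1 fun n m => ?_
    rw [← sub_apply, ← cfc_sub (R := ℂ) (p := IsStarNormal) _ _ R (hg n).continuousOn
        (hg m).continuousOn,
      norm_cfc_apply_sq R ψ (h := fun z => g n z - g m z) ((hg n).sub (hg m)), ← mul_add,
      ← integral_add (hint n) (hint m), ← integral_const_mul]
    refine integral_mono (integrable_normalMeasure R ψ (by have := hg n; have := hg m; fun_prop))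
      (((hint n).add (hint m)).const_mul 2) fun z => ?_
    have e : g n z - g m z = (g n z - z⁻¹) - (g m z - z⁻¹) := by ring
    have h2 : ‖g n z - g m z‖ ≤ ‖g n z - z⁻¹‖ + ‖g m z - z⁻¹‖ := by
      rw [e]
      exact norm_sub_le _ _
    have h3 := pow_le_pow_left₀ (norm_nonneg _) h2 2
    simp only
    nlinarith [sq_nonneg (‖g n z - z⁻¹‖ - ‖g m z - z⁻¹‖)]
  obtain ⟨χ, hχ⟩ := cauchySeq_tendsto_of_complete hcauchy
  refine ⟨χ, ?_⟩
  have h1 : Tendsto (fun n => R (cfc (g n) R ψ)) atTop (nhds (R χ)) :=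
    (R.continuous.tendsto χ).comp hχ
  refine tendsto_nhds_unique h1 ?_
  rw [tendsto_iff_norm_sub_tendsto_zero]
  have h2 : ∀ n, ‖R (cfc (g n) R ψ) - ψ‖ ^ 2 =
      ∫ z, ‖z * g n z - 1‖ ^ 2 ∂(normalMeasure R ψ) := by
    intro n
    rw [← norm_cfc_apply_sq R ψ (h := fun z => z * g n z - 1)
      ((continuous_id.mul (hg n)).sub continuous_const),
      cfc_sub (R := ℂ) (p := IsStarNormal) (fun z => z * g n z) (fun _ => 1) R
        (continuous_id.mul (hg n)).continuousOn continuousOn_const,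
      cfc_mul (R := ℂ) (p := IsStarNormal) (fun z => z) (g n) R continuousOn_id
        (hg n).continuousOn, cfc_id_eq, cfc_const_one ℂ R]
    rfl
  have h3 : Tendsto (fun n => ‖R (cfc (g n) R ψ) - ψ‖ ^ 2) atTop (nhds 0) := by
    simp_rw [h2]
    have h4 := tendsto_integral_of_dominated_convergence (μ := normalMeasure R ψ)
      (F := fun n z => ‖z * g n z - 1‖ ^ 2) (f := fun _ => (0 : ℝ)) (fun _ => (1 : ℝ))
      (fun n => (((continuous_id.mul (hg n)).sub continuous_const).norm.pow
        2).aestronglyMeasurable) (integrable_const 1)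
      (fun n => hne.mono fun z hz => by
        rw [Real.norm_of_nonneg (sq_nonneg _)]
        exact pow_le_one₀ (norm_nonneg _) (hle n z hz))
      (hne.mono fun z hz => by simpa using (hlim z hz).norm.pow 2)
    simpa using h4
  have h5 := (Real.continuous_sqrt.tendsto 0).comp h3
  simpa [Function.comp_def, Real.sqrt_sq (norm_nonneg _)] using h5

/-- The spectral theorem for an operator with a resolvent: the spectral resolution of `T` is the
image of that of `R` under the inverse of `x ↦ (x + iη)⁻¹`. -/
theorem IsResolvent.isSpectralResolution [IsStarNormal R] (h : IsResolvent T η R) :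
    IsSpectralResolution T (normalPVM R measurable_spectralParam) := by
  have hk := measurable_spectralParam
  have hdom : ∀ φ : T.domain, ∃ χ, R χ = φ := fun φ => ⟨_, h.left_inv φ⟩
  refine ⟨fun ψ => ?_, fun ψ => ?_⟩
  · rw [measureAt_normalPVM, lintegral_map (by fun_prop) hk]
    constructor
    · intro hψ
      obtain ⟨φ, hφ⟩ := hdom ⟨ψ, hψ⟩
      simp only at hφ
      rw [← hφ, normalMeasure_apply_self, lintegral_withDensity_eq_lintegral_mul _ (by fun_prop)
        (by fun_prop)]
      calc _ ≤ ∫⁻ z, 1 ∂(normalMeasure R φ) := by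
            refine lintegral_mono fun z => ?_
            simp only [Pi.mul_apply]
            rw [← ENNReal.ofReal_mul (sq_nonneg _), ← mul_pow, ← ENNReal.ofReal_one]
            refine ENNReal.ofReal_le_ofReal ?_
            rw [← sq_abs, abs_mul, abs_norm, mul_comm]
            exact pow_le_one₀ (by positivity) (abs_spectralParam_mul_norm_le z)
        _ < ∞ := by
            rw [lintegral_one]
            exact measure_lt_top _ _
    · intro hlt
      have h1 : Integrable (fun z => spectralParam z ^ 2) (normalMeasure R ψ) := by
        refine ⟨(hk.pow_const 2).aestronglyMeasurable, ?_⟩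
        rw [HasFiniteIntegral]
        exact lt_of_le_of_lt (le_of_eq (lintegral_congr fun z =>
          Real.enorm_eq_ofReal (sq_nonneg _))) hlt
      have h2 : Integrable (fun z : ℂ => ‖z⁻¹‖ ^ 2) (normalMeasure R ψ) := by
        refine (h1.add (integrable_const (η ^ 2))).congr ?_
        filter_upwards [h.ae_inv_eq ψ] with z hz
        rw [hz.2, ← Complex.normSq_eq_norm_sq, Complex.normSq_apply]
        simp [pow_two]
      obtain ⟨χ, hχ⟩ := h.exists_apply_eq h2
      exact hχ ▸ h.mem χ
  · obtain ⟨φ, hφ⟩ := hdom ψ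
    have hψ : ψ = ⟨R φ, h.mem φ⟩ := Subtype.ext hφ.symm
    subst hψ
    rw [measureAt_normalPVM, integral_map (f := fun x : ℝ => x) hk.aemeasurable
      measurable_id.aestronglyMeasurable,
      normalMeasure_apply_self, h.apply_eq]
    have h1 : ∫ z, spectralParam z ∂((normalMeasure R φ).withDensity
        fun z => ENNReal.ofReal (‖z‖ ^ 2)) = ∫ z, z.re ∂(normalMeasure R φ) := by
      rw [integral_withDensity_eq_integral_toReal_smul (by fun_prop)
        (Eventually.of_forall fun z => ENNReal.ofReal_lt_top)]
      refine integral_congr_ae (Eventually.of_forall fun z => ?_)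
      simp only
      rw [ENNReal.toReal_ofReal (sq_nonneg _), smul_eq_mul, norm_sq_mul_spectralParam]
    rw [h1, ← integral_complex_ofReal]
    have h2 : ⟪R φ, φ - (Complex.I * η) • R φ⟫_ℂ =
        ⟪φ, cfc (fun z : ℂ => star z - (Complex.I * η) * (star z * z)) R φ⟫_ℂ := by
      rw [cfc_sub (R := ℂ) (p := IsStarNormal) (fun z => star z)
          (fun z => (Complex.I * η) * (star z * z)) R (by fun_prop) (by fun_prop),
        cfc_const_mul (R := ℂ) (p := IsStarNormal) (Complex.I * η) (fun z => star z * z) R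
          (by fun_prop),
        cfc_mul (R := ℂ) (p := IsStarNormal) (fun z => star z) (fun z => z) R
          (by fun_prop) (by fun_prop), cfc_star (fun z => z), cfc_id_eq]
      change _ = ⟪φ, star R φ - (Complex.I * η) • star R (R φ)⟫_ℂ
      rw [ContinuousLinearMap.star_eq_adjoint, inner_sub_right, inner_sub_right, inner_smul_right,
        inner_smul_right, ContinuousLinearMap.adjoint_inner_right,
        ContinuousLinearMap.adjoint_inner_right]
    rw [h2, ← integral_normalMeasure R φ (by fun_prop)]
    refine integral_congr_ae ?_
    filter_upwards [h.ae_im_eq φ] with z hz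
    rw [RCLike.star_def, Complex.conj_mul']
    apply Complex.ext
    · simp [← Complex.ofReal_pow]
    · simp [← Complex.ofReal_pow, hz]

/-- The spectral measure of `T` at `ψ` is determined by the functions of the resolvent. The measure
`spectralMeasure T ψ` comes from an arbitrary choice of a spectral resolution, so that uniqueness
enters here. -/
theorem IsResolvent.integral_spectralMeasure [IsStarNormal R] (h : IsResolvent T η R) (ψ : E)
    {g : ℂ → ℂ} (hg : Continuous g) :
    ∫ x : ℝ, g ((x + Complex.I * η)⁻¹) ∂(spectralMeasure T ψ) = ⟪ψ, cfc g R ψ⟫_ℂ := by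
  have hex : ∃ P : ProjectionValuedMeasure E, IsSpectralResolution T P := ⟨_, h.isSpectralResolution⟩
  have heq : spectralMeasure T ψ = (normalMeasure R ψ).map spectralParam := by
    rw [spectralMeasure, dif_pos hex, ← measureAt_normalPVM R measurable_spectralParam]
    refine hex.choose_spec.measureAt_eq h.isSpectralResolution (fun A B hA hB => ?_) ψ
    have hc := hex.choose_spec.commute_resolvent h hA
    refine (isSpectralProjection_spectralProj R (measurable_spectralParam hB)).2.2 _ hc ?_
    have h1 := hc.star_star
    rwa [(hex.choose.isStarProjection A hA).isSelfAdjoint.star_eq] at h1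
  have hm : Measurable fun x : ℝ => g ((x + Complex.I * η)⁻¹) :=
    hg.measurable.comp ((Complex.measurable_ofReal.add_const _).inv)
  rw [heq, integral_map measurable_spectralParam.aemeasurable hm.aestronglyMeasurable,
    ← integral_normalMeasure R ψ hg]
  refine integral_congr_ae ?_
  filter_upwards [h.ae_inv_eq ψ] with z hz
  rw [← hz.2, inv_inv]

theorem IsResolvent.spectralMeasure_univ [IsStarNormal R] (h : IsResolvent T η R) (ψ : E) :
    spectralMeasure T ψ Set.univ = ENNReal.ofReal (‖ψ‖ ^ 2) := by
  have hex : ∃ P : ProjectionValuedMeasure E, IsSpectralResolution T P := ⟨_, h.isSpectralResolution⟩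
  rw [spectralMeasure, dif_pos hex, ← ProjectionValuedMeasure.measureAt_real_univ hex.choose,
    ofReal_measureReal]

end Resolution

/-! ### Self-adjointness of the Anderson Hamiltonian -/

section ResolventPair

variable {E : Type*} [NormedAddCommGroup E] [InnerProductSpace ℂ E] [CompleteSpace E]

/-- A symmetric operator `T` for which both `T + iη` and `T - iη` have bounded inverses `R`, `R'`
is self-adjoint in the sense of `IsResolvent`. -/
theorem isResolvent_of_pair {T : E →ₗ.[ℂ] E} {η : ℝ} (hη : η ≠ 0) {R R' : E →L[ℂ] E}
    (hsymm : ∀ φ χ : T.domain, ⟪T φ, (χ : E)⟫_ℂ = ⟪(φ : E), T χ⟫_ℂ)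
    (mem : ∀ ψ, R ψ ∈ T.domain) (apply_eq : ∀ ψ, T ⟨R ψ, mem ψ⟩ = ψ - (Complex.I * η) • R ψ)
    (left_inv : ∀ φ : T.domain, R (T φ + (Complex.I * η) • (φ : E)) = φ)
    (mem' : ∀ ψ, R' ψ ∈ T.domain) (apply_eq' : ∀ ψ, T ⟨R' ψ, mem' ψ⟩ = ψ + (Complex.I * η) • R' ψ)
    (left_inv' : ∀ φ : T.domain, R' (T φ - (Complex.I * η) • (φ : E)) = φ) :
    IsResolvent T η R ∧ star R = R' := by
  have hstar : star R = R' := by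
    refine ContinuousLinearMap.ext fun ψ => ext_inner_right ℂ fun φ => ?_
    rw [ContinuousLinearMap.star_eq_adjoint, ContinuousLinearMap.adjoint_inner_left]
    have h1 := hsymm ⟨R' ψ, mem' ψ⟩ ⟨R φ, mem φ⟩
    rw [apply_eq, apply_eq'] at h1
    simp only [inner_add_left, inner_sub_right, inner_smul_left, inner_smul_right, map_mul,
      Complex.conj_I, Complex.conj_ofReal] at h1
    linear_combination h1
  have e1 : R' - R = (2 * Complex.I * η) • (R * R') := by
    ext ψ
    have h := left_inv ⟨R' ψ, mem' ψ⟩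
    rw [apply_eq'] at h
    simp only [map_add, map_smul] at h
    change R' ψ - R ψ = (2 * Complex.I * η) • R (R' ψ)
    rw [← h]
    simp only [map_add, map_smul]
    conv_lhs => rw [← h]
    simp only [map_add, map_smul]
    module
  have e2 : R - R' = -(2 * Complex.I * η) • (R' * R) := by
    ext ψ
    have h := left_inv' ⟨R ψ, mem ψ⟩
    rw [apply_eq] at h
    simp only [map_sub, map_smul] at h
    change R ψ - R' ψ = -(2 * Complex.I * η) • R' (R ψ)
    have h2 : R ψ - R' ψ = -(Complex.I * η) • R' (R ψ) - (Complex.I * η) • R' (R ψ) := by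
      nth_rewrite 1 [← h]
      module
    rw [h2]
    module
  have hc : (2 * Complex.I * η : ℂ) ≠ 0 := by simp [hη]
  refine ⟨⟨mem, apply_eq, left_inv, ⟨?_⟩, by rw [hstar, e2]⟩, hstar⟩
  rw [hstar]
  have h3 : (2 * Complex.I * η : ℂ) • (R' * R) = (2 * Complex.I * η : ℂ) • (R * R') := by
    rw [← e1, ← neg_sub R R', e2, neg_smul, neg_neg]
  exact smul_right_injective _ hc h3

end ResolventPair

section Lattice

variable {d : ℕ}

theorem norm_sq_eq_tsum (ψ : Ell2 d) : ‖ψ‖ ^ 2 = ∑' n, ‖ψ n‖ ^ 2 := by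
  have h := lp.norm_rpow_eq_tsum (p := 2) (by norm_num) ψ
  simpa using h

/-- Translation by `e`. -/
def shift (e : Fin d → ℤ) (ψ : Ell2 d) : Ell2 d := ⟨fun n => ψ (n + e), memlp_shift e ψ⟩

theorem norm_shift (e : Fin d → ℤ) (ψ : Ell2 d) : ‖shift e ψ‖ = ‖ψ‖ := by
  refine (pow_left_inj₀ (norm_nonneg _) (norm_nonneg _) two_ne_zero).1 ?_
  rw [norm_sq_eq_tsum, norm_sq_eq_tsum]
  exact (Equiv.addRight e).tsum_eq fun n => ‖ψ n‖ ^ 2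

theorem laplacian_eq_sum_shift (ψ : Ell2 d) :
    laplacian d ψ = ∑ e ∈ unitVectors d, shift e ψ := by
  ext n
  rw [lp.coeFn_sum, Finset.sum_apply]
  rfl

theorem norm_laplacian_le (ψ : Ell2 d) :
    ‖laplacian d ψ‖ ≤ (unitVectors d).card * ‖ψ‖ := by
  rw [laplacian_eq_sum_shift]
  refine (norm_sum_le _ _).trans (le_of_eq ?_)
  simp [norm_shift]

/-- The discrete Laplacian as a bounded operator. -/
def laplacianCLM (d : ℕ) : Ell2 d →L[ℂ] Ell2 d :=
  (laplacian d).mkContinuous (unitVectors d).card norm_laplacian_le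

theorem norm_laplacianCLM_le : ‖laplacianCLM d‖ ≤ (unitVectors d).card :=
  LinearMap.mkContinuous_norm_le _ (by positivity) _

theorem neg_mem_unitVectors {e : Fin d → ℤ} : -e ∈ unitVectors d ↔ e ∈ unitVectors d := by
  simp [mem_unitVectors]

theorem inner_laplacian (φ χ : Ell2 d) : ⟪laplacian d φ, χ⟫_ℂ = ⟪φ, laplacian d χ⟫_ℂ := by
  have h1 : ∀ e : Fin d → ℤ, ⟪shift e φ, χ⟫_ℂ = ⟪φ, shift (-e) χ⟫_ℂ := by
    intro e
    rw [lp.inner_eq_tsum, lp.inner_eq_tsum,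
      ← (Equiv.addRight e).tsum_eq (fun n => ⟪φ n, shift (-e) χ n⟫_ℂ)]
    refine tsum_congr fun n => ?_
    simp [shift]
  rw [laplacian_eq_sum_shift, laplacian_eq_sum_shift, sum_inner, inner_sum]
  simp_rw [h1]
  refine Finset.sum_nbij' (fun e => -e) (fun e => -e) ?_ ?_ ?_ ?_ ?_
  · exact fun e he => neg_mem_unitVectors.2 he
  · exact fun e he => neg_mem_unitVectors.2 he
  · simp
  · simp
  · simp

theorem memlp_mul_of_bound {a : (Fin d → ℤ) → ℂ} {C : ℝ} (ha : ∀ n, ‖a n‖ ≤ C) (ψ : Ell2 d) :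
    Memℓp (fun n => a n * ψ n) 2 := by
  refine Memℓp.mono' (f := fun n => a n * ψ n) (g := fun n => (C : ℂ) * ψ n)
    ((lp.memℓp ψ).const_mul (C : ℂ)) fun n => ?_
  rw [norm_mul, norm_mul, Complex.norm_real]
  exact mul_le_mul_of_nonneg_right ((ha n).trans (le_abs_self C)) (norm_nonneg _)

/-- Multiplication by a bounded function. -/
def mulCLM {a : (Fin d → ℤ) → ℂ} {C : ℝ} (ha : ∀ n, ‖a n‖ ≤ C) : Ell2 d →L[ℂ] Ell2 d :=
  LinearMap.mkContinuous
    { toFun := fun ψ => ⟨fun n => a n * ψ n, memlp_mul_of_bound ha ψ⟩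
      map_add' := fun ψ φ => by
        ext n
        simp only [lp.coeFn_add, Pi.add_apply, mul_add]
      map_smul' := fun c ψ => by
        ext n
        simp [mul_left_comm] }
    C (fun ψ => by
      have hC : 0 ≤ C := (norm_nonneg _).trans (ha 0)
      have h : ‖(⟨fun n => a n * ψ n, memlp_mul_of_bound ha ψ⟩ : Ell2 d)‖ ≤ ‖(C : ℂ) • ψ‖ := by
        refine lp.norm_mono two_ne_zero fun n => ?_
        change ‖a n * ψ n‖ ≤ ‖(C : ℂ) * ψ n‖
        rw [norm_mul, norm_mul, Complex.norm_real]
        exact mul_le_mul_of_nonneg_right ((ha n).trans (le_abs_self C)) (norm_nonneg _)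
      rw [norm_smul, Complex.norm_real, Real.norm_of_nonneg hC] at h
      exact h)

theorem mulCLM_apply {a : (Fin d → ℤ) → ℂ} {C : ℝ} (ha : ∀ n, ‖a n‖ ≤ C) (ψ : Ell2 d)
    (n : Fin d → ℤ) : mulCLM ha ψ n = a n * ψ n := rfl

theorem norm_mulCLM_le {a : (Fin d → ℤ) → ℂ} {C : ℝ} (ha : ∀ n, ‖a n‖ ≤ C) : ‖mulCLM ha‖ ≤ C :=
  LinearMap.mkContinuous_norm_le _ ((norm_nonneg _).trans (ha 0)) _

theorem hamiltonian_apply_apply (ω : (Fin d → ℤ) → ℝ) (ψ : (hamiltonian ω).domain)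
    (n : Fin d → ℤ) :
    (hamiltonian ω ψ) n = laplacian d (ψ : Ell2 d) n + (ω n : ℂ) * (ψ : Ell2 d) n := rfl

theorem mem_hamiltonian_domain (ω : (Fin d → ℤ) → ℝ) (ψ : Ell2 d) :
    ψ ∈ (hamiltonian ω).domain ↔ Memℓp (fun n => (ω n : ℂ) * ψ n) 2 := Iff.rfl

theorem hamiltonian_symm (ω : (Fin d → ℤ) → ℝ) (φ χ : (hamiltonian ω).domain) :
    ⟪hamiltonian ω φ, (χ : Ell2 d)⟫_ℂ = ⟪(φ : Ell2 d), hamiltonian ω χ⟫_ℂ := by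
  have h : ∀ ψ : (hamiltonian ω).domain, hamiltonian ω ψ =
      laplacian d (ψ : Ell2 d) + (potential ω).toFun ψ := fun ψ => rfl
  rw [h, h, inner_add_left, inner_add_right, inner_laplacian]
  congr 1
  rw [lp.inner_eq_tsum, lp.inner_eq_tsum]
  refine tsum_congr fun n => ?_
  change ⟪(ω n : ℂ) * (φ : Ell2 d) n, (χ : Ell2 d) n⟫_ℂ =
    ⟪(φ : Ell2 d) n, (ω n : ℂ) * (χ : Ell2 d) n⟫_ℂ
  simp
  ring

theorem norm_inv_add_I_mul_le {η : ℝ} (hη : η ≠ 0) (x : ℝ) :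
    ‖((x : ℂ) + Complex.I * η)⁻¹‖ ≤ |η|⁻¹ := by
  rw [norm_inv]
  refine inv_anti₀ (abs_pos.2 hη) ?_
  have h := Complex.abs_im_le_norm ((x : ℂ) + Complex.I * η)
  simpa using h

theorem add_I_mul_ne_zero {η : ℝ} (hη : η ≠ 0) (x : ℝ) : (x : ℂ) + Complex.I * η ≠ 0 := by
  intro h
  have := congrArg Complex.im h
  simp at this
  exact hη this

/-- A Neumann series gives the resolvent of `Δ + V` at `-iη` as soon as `|η| > ‖Δ‖`. -/
theorem exists_inverse_hamiltonian (ω : (Fin d → ℤ) → ℝ) {η : ℝ}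
    (hη : ((unitVectors d).card : ℝ) < |η|) :
    ∃ R : Ell2 d →L[ℂ] Ell2 d, ∃ mem : ∀ ψ, R ψ ∈ (hamiltonian ω).domain,
      (∀ ψ, hamiltonian ω ⟨R ψ, mem ψ⟩ = ψ - (Complex.I * η) • R ψ) ∧
      ∀ φ : (hamiltonian ω).domain, R (hamiltonian ω φ + (Complex.I * η) • (φ : Ell2 d)) = φ := by
  have hη0 : η ≠ 0 := by
    rintro rfl
    rw [abs_zero] at hη
    exact absurd hη (not_lt.2 (by positivity))
  -- `S = (V + iη)⁻¹`, and `(H + iη) S = 1 + Δ S` is invertible.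
  let S : Ell2 d →L[ℂ] Ell2 d :=
    mulCLM (a := fun n => ((ω n : ℂ) + Complex.I * η)⁻¹) fun n => norm_inv_add_I_mul_le hη0 (ω n)
  have hS : ‖S‖ ≤ |η|⁻¹ := norm_mulCLM_le _
  have hnorm : ‖-(laplacianCLM d * S)‖ < 1 := by
    rw [norm_neg]
    calc ‖laplacianCLM d * S‖ ≤ ‖laplacianCLM d‖ * ‖S‖ := norm_mul_le _ _
      _ ≤ (unitVectors d).card * |η|⁻¹ :=
          mul_le_mul norm_laplacianCLM_le hS (norm_nonneg _) (by positivity)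
      _ < 1 := by
          rw [← div_eq_mul_inv, div_lt_one (abs_pos.2 hη0)]
          exact hη
  let U := Units.oneSub (-(laplacianCLM d * S)) hnorm
  have hU : (U : Ell2 d →L[ℂ] Ell2 d) = 1 + laplacianCLM d * S := by
    simp [U]
  have hSapp : ∀ ψ n, (ω n : ℂ) * S ψ n = ψ n - (Complex.I * η) * S ψ n := by
    intro ψ n
    have h := add_I_mul_ne_zero hη0 (ω n)
    simp only [S, mulCLM_apply]
    field_simp
    ring
  have hmem : ∀ ψ, S ψ ∈ (hamiltonian ω).domain := by
    intro ψ
    rw [mem_hamiltonian_domain]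
    simp_rw [hSapp]
    exact lp.memℓp (ψ - (Complex.I * η) • S ψ)
  have hHS : ∀ ψ, hamiltonian ω ⟨S ψ, hmem ψ⟩ + (Complex.I * η) • S ψ =
      (U : Ell2 d →L[ℂ] Ell2 d) ψ := by
    intro ψ
    rw [hU]
    ext n
    change laplacian d (S ψ) n + (ω n : ℂ) * S ψ n + (Complex.I * η) * S ψ n =
      ψ n + laplacian d (S ψ) n
    rw [hSapp]
    ring
  let V : Ell2 d →L[ℂ] Ell2 d := ↑U⁻¹
  refine ⟨S * V, fun ψ => hmem _, fun ψ => ?_, fun φ => ?_⟩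
  · have h := hHS (V ψ)
    have h2 : (U : Ell2 d →L[ℂ] Ell2 d) (V ψ) = ψ :=
      congrArg (fun A : Ell2 d →L[ℂ] Ell2 d => A ψ) U.mul_inv
    rw [h2] at h
    exact eq_sub_of_add_eq h
  · have hmem2 : Memℓp (fun n => (ω n : ℂ) * (φ : Ell2 d) n) 2 := φ.2
    let χ : Ell2 d := (⟨_, hmem2⟩ : Ell2 d) + (Complex.I * η) • (φ : Ell2 d)
    have hχ : S χ = φ := by
      ext n
      have h := add_I_mul_ne_zero hη0 (ω n)
      rw [mulCLM_apply]
      change ((ω n : ℂ) + Complex.I * η)⁻¹ * ((ω n : ℂ) * (φ : Ell2 d) n +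
        (Complex.I * η) * (φ : Ell2 d) n) = (φ : Ell2 d) n
      field_simp
    have h1 := hHS χ
    have h2 : (⟨S χ, hmem χ⟩ : (hamiltonian ω).domain) = φ := Subtype.ext hχ
    rw [h2, hχ] at h1
    rw [h1]
    change S (V ((U : Ell2 d →L[ℂ] Ell2 d) χ)) = φ
    have h3 : V ((U : Ell2 d →L[ℂ] Ell2 d) χ) = χ :=
      congrArg (fun A : Ell2 d →L[ℂ] Ell2 d => A χ) U.inv_mul
    rw [h3, hχ]

/-- A spectral parameter beyond the norm of the Laplacian. -/
def eta (d : ℕ) : ℝ := (unitVectors d).card + 1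

theorem one_le_eta (d : ℕ) : 1 ≤ eta d := by
  unfold eta
  have : (0 : ℝ) ≤ (unitVectors d).card := by positivity
  linarith

/-- The Hamiltonian of every configuration is self-adjoint. -/
theorem exists_isResolvent_hamiltonian (ω : (Fin d → ℤ) → ℝ) :
    ∃ R : Ell2 d →L[ℂ] Ell2 d, IsResolvent (hamiltonian ω) (eta d) R ∧
      IsResolvent (hamiltonian ω) (-eta d) (star R) := by
  have h0 := one_le_eta d
  have hlt : ((unitVectors d).card : ℝ) < |eta d| := by
    rw [abs_of_pos (by linarith), eta]
    linarith
  obtain ⟨R, mem, h1, h2⟩ := exists_inverse_hamiltonian ω hlt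
  obtain ⟨R', mem', h1', h2'⟩ := exists_inverse_hamiltonian ω (η := -eta d) (by rwa [abs_neg])
  have a := isResolvent_of_pair (η := eta d) (by linarith) (hamiltonian_symm ω) mem h1 h2 mem'
    (fun ψ => by rw [h1']; push_cast; rw [mul_neg, neg_smul, sub_neg_eq_add])
    (fun φ => by
      have h := h2' φ
      push_cast at h
      rwa [mul_neg, neg_smul, ← sub_eq_add_neg] at h)
  have b := isResolvent_of_pair (η := -eta d) (by linarith) (hamiltonian_symm ω) mem' h1' h2' mem
    (fun ψ => by rw [h1]; push_cast; rw [mul_neg, neg_smul, ← sub_eq_add_neg])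
    (fun φ => by
      have h := h2 φ
      push_cast
      rwa [mul_neg, neg_smul, sub_neg_eq_add])
  exact ⟨R, a.1, a.2 ▸ b.1⟩

end Lattice

/-! ### Finite-volume Hamiltonians -/

/-- For a symmetric operator `T`, applied with `w = T u`, this is the bound
`|η| ‖u‖ ≤ ‖(T + iη) u‖`. -/
theorem abs_mul_norm_le {E : Type*} [NormedAddCommGroup E] [InnerProductSpace ℂ E] {u w : E}
    (h : (⟪u, w⟫_ℂ).im = 0) (η : ℝ) : |η| * ‖u‖ ≤ ‖w + (Complex.I * η) • u‖ := by
  by_cases hu : ‖u‖ = 0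
  · rw [hu, mul_zero]
    exact norm_nonneg _
  have h1 : (⟪u, w + (Complex.I * η) • u⟫_ℂ).im = η * ‖u‖ ^ 2 := by
    rw [inner_add_right, inner_smul_right, inner_self_eq_norm_sq_to_K, Complex.add_im, h, zero_add]
    simp [Complex.mul_im, ← Complex.ofReal_pow]
  have h2 : |η| * ‖u‖ ^ 2 ≤ ‖u‖ * ‖w + (Complex.I * η) • u‖ := by
    rw [← abs_of_nonneg (sq_nonneg ‖u‖), ← abs_mul, ← h1]
    exact (Complex.abs_im_le_norm _).trans (norm_inner_le_norm _ _)
  have h3 : 0 < ‖u‖ := lt_of_le_of_ne (norm_nonneg _) (Ne.symm hu)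
  refine le_of_mul_le_mul_left ?_ h3
  calc ‖u‖ * (|η| * ‖u‖) = |η| * ‖u‖ ^ 2 := by ring
    _ ≤ _ := h2

section FiniteVolume

variable {d : ℕ}

theorem delta_apply (n m : Fin d → ℤ) : (delta n : Ell2 d) m = if m = n then 1 else 0 := by
  by_cases h : m = n
  · subst h
    simp [delta]
  · simp [delta, lp.single_apply, h]

theorem inner_delta_left (n : Fin d → ℤ) (ψ : Ell2 d) : ⟪delta n, ψ⟫_ℂ = ψ n := by
  rw [delta, lp.inner_single_left]
  simp

theorem norm_delta (n : Fin d → ℤ) : ‖(delta n : Ell2 d)‖ = 1 := by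
  rw [delta, lp.norm_single (by norm_num)]
  simp

instance : Nontrivial (Ell2 d) :=
  ⟨delta 0, 0, fun h => by simpa [h] using norm_delta (d := d) 0⟩

/-- The compression of `H^ω` to `ℓ²(Λ)`, for an arbitrary finite `Λ ⊆ ℤᵈ`; for a box this is
`boxHamiltonian` by definition. Translates of boxes are needed as well. -/
def finiteHamiltonian (Λ : Finset (Fin d → ℤ)) (ω : (Fin d → ℤ) → ℝ) : Matrix Λ Λ ℂ :=
  Matrix.of fun m n =>
    ⟪(delta (m : Fin d → ℤ) : Ell2 d), hamiltonian ω ⟨delta n, delta_mem_domain ω n⟩⟫_ℂ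

theorem finiteHamiltonian_apply (Λ : Finset (Fin d → ℤ)) (ω : (Fin d → ℤ) → ℝ) (m n : Λ) :
    finiteHamiltonian Λ ω m n =
      (if (n : Fin d → ℤ) - m ∈ unitVectors d then 1 else 0) + if m = n then (ω n : ℂ) else 0 := by
  change ⟪(delta (m : Fin d → ℤ) : Ell2 d), _⟫_ℂ = _
  rw [inner_delta_left, hamiltonian_apply_apply]
  congr 1
  · change ∑ e ∈ unitVectors d, (delta (n : Fin d → ℤ) : Ell2 d) (m + e) = _
    simp only [delta_apply]
    have h : ∀ e, ((m : Fin d → ℤ) + e = n) = (e = (n : Fin d → ℤ) - m) := fun e => by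
      rw [eq_sub_iff_add_eq']
    simp_rw [h, Finset.sum_ite_eq']
  · simp only [delta_apply, Subtype.ext_iff]
    split_ifs with h
    · rw [h, mul_one]
    · simp

theorem isHermitian_finiteHamiltonian (Λ : Finset (Fin d → ℤ)) (ω : (Fin d → ℤ) → ℝ) :
    (finiteHamiltonian Λ ω).IsHermitian := by
  ext m n
  rw [Matrix.conjTranspose_apply, finiteHamiltonian_apply, finiteHamiltonian_apply, star_add]
  have h : (m : Fin d → ℤ) - n ∈ unitVectors d ↔ (n : Fin d → ℤ) - m ∈ unitVectors d := by
    rw [← neg_mem_unitVectors, neg_sub]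
  simp only [h]
  congr 1
  · split_ifs <;> simp
  · by_cases hmn : m = n
    · subst hmn
      simp
    · simp [hmn, Ne.symm hmn]

theorem continuous_finiteHamiltonian (Λ : Finset (Fin d → ℤ)) :
    Continuous (finiteHamiltonian Λ) := by
  refine continuous_matrix fun m n => ?_
  simp_rw [finiteHamiltonian_apply]
  refine continuous_const.add ?_
  by_cases h : m = n
  · simp only [h, if_true]
    exact Complex.continuous_ofReal.comp (continuous_apply _)
  · simp only [h, if_false]
    exact continuous_const

theorem finiteHamiltonian_congr (Λ : Finset (Fin d → ℤ)) {ω ω' : (Fin d → ℤ) → ℝ}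
    (h : ∀ n ∈ Λ, ω n = ω' n) : finiteHamiltonian Λ ω = finiteHamiltonian Λ ω' := by
  ext m n
  rw [finiteHamiltonian_apply, finiteHamiltonian_apply, h n n.2]

/-- Changing the potential at one site of `Λ` is a perturbation of rank one. -/
theorem finiteHamiltonian_update (Λ : Finset (Fin d → ℤ)) (ω : (Fin d → ℤ) → ℝ) (n : Λ) (x : ℝ) :
    finiteHamiltonian Λ (Function.update ω n (ω n + x)) =
      finiteHamiltonian Λ ω + Matrix.single n n (x : ℂ) := by
  ext k l
  rw [Matrix.add_apply, finiteHamiltonian_apply, finiteHamiltonian_apply, add_assoc]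
  congr 1
  by_cases hkl : k = l
  · subst hkl
    simp only [if_true]
    by_cases hk : k = n
    · subst hk
      simp
    · have hk' : (k : Fin d → ℤ) ≠ n := fun h => hk (Subtype.ext h)
      rw [Function.update_of_ne hk', Matrix.single_apply, if_neg (fun h => hk h.1.symm), add_zero]
  · rw [if_neg hkl, if_neg hkl, Matrix.single_apply,
      if_neg (fun h => hkl (h.1.symm.trans h.2)), add_zero]

/-! #### The compressions as operators on `ℓ²(ℤᵈ)` -/

/-- The projection `χ_Λ` of `ℓ²(ℤᵈ)` onto `ℓ²(Λ)`. -/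
def cutoff (Λ : Finset (Fin d → ℤ)) : Ell2 d →L[ℂ] Ell2 d :=
  mulCLM (a := fun n => if n ∈ Λ then 1 else 0) (C := 1) fun n => by split_ifs <;> simp

theorem cutoff_apply (Λ : Finset (Fin d → ℤ)) (ψ : Ell2 d) (n : Fin d → ℤ) :
    cutoff Λ ψ n = if n ∈ Λ then ψ n else 0 := by
  rw [cutoff, mulCLM_apply]
  split_ifs <;> simp

theorem norm_cutoff_le (Λ : Finset (Fin d → ℤ)) : ‖cutoff Λ‖ ≤ 1 := norm_mulCLM_le _

theorem tendsto_cutoff (ψ : Ell2 d) : Tendsto (fun Λ => cutoff Λ ψ) atTop (nhds ψ) := by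
  have h := lp.hasSum_single (p := 2) (by norm_num) ψ
  rw [HasSum, SummationFilter.unconditional_filter] at h
  refine h.congr fun Λ => ?_
  ext n
  rw [cutoff_apply, lp.coeFn_sum, Finset.sum_apply]
  simp only [lp.single_apply]
  rw [Finset.sum_pi_single]

theorem inner_mulCLM {a : (Fin d → ℤ) → ℂ} {C : ℝ} (ha : ∀ n, ‖a n‖ ≤ C)
    (hreal : ∀ n, star (a n) = a n) (φ χ : Ell2 d) :
    ⟪mulCLM ha φ, χ⟫_ℂ = ⟪φ, mulCLM ha χ⟫_ℂ := by
  rw [lp.inner_eq_tsum, lp.inner_eq_tsum]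
  refine tsum_congr fun n => ?_
  have h := hreal n
  simp only [mulCLM_apply, RCLike.inner_apply, map_mul]
  rw [RCLike.star_def] at h
  rw [h]
  ring

/-- The potential restricted to `Λ`. -/
def finitePotential (Λ : Finset (Fin d → ℤ)) (ω : (Fin d → ℤ) → ℝ) : Ell2 d →L[ℂ] Ell2 d :=
  mulCLM (a := fun n => if n ∈ Λ then (ω n : ℂ) else 0) (C := ∑ n ∈ Λ, |ω n|) fun n => by
    split_ifs with h
    · rw [Complex.norm_real]
      exact Finset.single_le_sum (f := fun n => |ω n|) (fun _ _ => abs_nonneg _) h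
    · rw [norm_zero]
      exact Finset.sum_nonneg fun _ _ => abs_nonneg _

/-- The operator `χ_Λ H^ω χ_Λ` on `ℓ²(ℤᵈ)`. -/
def compression (Λ : Finset (Fin d → ℤ)) (ω : (Fin d → ℤ) → ℝ) : Ell2 d →L[ℂ] Ell2 d :=
  cutoff Λ * laplacianCLM d * cutoff Λ + finitePotential Λ ω

theorem compression_apply (Λ : Finset (Fin d → ℤ)) (ω : (Fin d → ℤ) → ℝ) (ψ : Ell2 d)
    (n : Fin d → ℤ) : compression Λ ω ψ n =
      if n ∈ Λ then laplacian d (cutoff Λ ψ) n + ω n * ψ n else 0 := by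
  change cutoff Λ (laplacian d (cutoff Λ ψ)) n + finitePotential Λ ω ψ n = _
  rw [cutoff_apply, finitePotential, mulCLM_apply]
  split_ifs <;> simp

theorem inner_compression (Λ : Finset (Fin d → ℤ)) (ω : (Fin d → ℤ) → ℝ) (φ χ : Ell2 d) :
    ⟪compression Λ ω φ, χ⟫_ℂ = ⟪φ, compression Λ ω χ⟫_ℂ := by
  have hc : ∀ φ χ : Ell2 d, ⟪cutoff Λ φ, χ⟫_ℂ = ⟪φ, cutoff Λ χ⟫_ℂ := fun φ χ =>
    inner_mulCLM _ (fun n => by split_ifs <;> simp) φ χ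
  change ⟪cutoff Λ (laplacian d (cutoff Λ φ)) + finitePotential Λ ω φ, χ⟫_ℂ =
    ⟪φ, cutoff Λ (laplacian d (cutoff Λ χ)) + finitePotential Λ ω χ⟫_ℂ
  rw [inner_add_left, inner_add_right, hc, inner_laplacian, hc]
  congr 1
  exact inner_mulCLM _ (fun n => by split_ifs <;> simp) φ χ

/-- The compressions converge strongly on the whole domain of `H^ω`. -/
theorem tendsto_compression (ω : (Fin d → ℤ) → ℝ) (φ : (hamiltonian ω).domain) :
    Tendsto (fun Λ => compression Λ ω (φ : Ell2 d)) atTop (nhds (hamiltonian ω φ)) := by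
  have hφ : Memℓp (fun n => (ω n : ℂ) * (φ : Ell2 d) n) 2 := φ.2
  let V : Ell2 d := ⟨_, hφ⟩
  have e : ∀ Λ, compression Λ ω (φ : Ell2 d) =
      cutoff Λ (laplacianCLM d (cutoff Λ (φ : Ell2 d) - φ)) + cutoff Λ (laplacianCLM d φ) +
        cutoff Λ V := by
    intro Λ
    rw [map_sub, map_sub, sub_add_cancel]
    ext n
    rw [compression_apply, lp.coeFn_add, Pi.add_apply, cutoff_apply, cutoff_apply]
    split_ifs
    · rfl
    · simp
  have h0 : Tendsto (fun Λ => cutoff Λ (laplacianCLM d (cutoff Λ (φ : Ell2 d) - φ))) atTop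
      (nhds 0) := by
    have h1 : Tendsto (fun Λ => laplacianCLM d (cutoff Λ (φ : Ell2 d) - φ)) atTop (nhds 0) := by
      have h2 := (tendsto_cutoff (φ : Ell2 d)).sub_const (φ : Ell2 d)
      rw [sub_self] at h2
      have h3 := ((laplacianCLM d).continuous.tendsto 0).comp h2
      rwa [map_zero] at h3
    refine squeeze_zero_norm (fun Λ => ?_) (tendsto_zero_iff_norm_tendsto_zero.1 h1)
    refine ((cutoff Λ).le_opNorm _).trans ?_
    exact mul_le_of_le_one_left (norm_nonneg _) (norm_cutoff_le Λ)
  simp_rw [e]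
  have h4 := (h0.add (tendsto_cutoff (laplacianCLM d φ))).add (tendsto_cutoff V)
  rw [zero_add] at h4
  exact h4

/-- The inclusion `ℓ²(Λ) ⊆ ℓ²(ℤᵈ)`. -/
def embed (Λ : Finset (Fin d → ℤ)) (v : Λ → ℂ) : Ell2 d := ∑ n, v n • delta (n : Fin d → ℤ)

theorem embed_apply (Λ : Finset (Fin d → ℤ)) (v : Λ → ℂ) (m : Fin d → ℤ) :
    embed Λ v m = if h : m ∈ Λ then v ⟨m, h⟩ else 0 := by
  rw [embed, lp.coeFn_sum, Finset.sum_apply]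
  simp only [lp.coeFn_smul, Pi.smul_apply, delta_apply, smul_eq_mul, mul_ite, mul_one, mul_zero]
  split_ifs with h
  · rw [Finset.sum_eq_single (⟨m, h⟩ : Λ)]
    · simp
    · intro b _ hb
      rw [if_neg]
      rintro rfl
      exact hb rfl
    · simp
  · refine Finset.sum_eq_zero fun n _ => ?_
    rw [if_neg]
    rintro rfl
    exact h n.2

theorem norm_embed (Λ : Finset (Fin d → ℤ)) (v : Λ → ℂ) :
    ‖embed Λ v‖ = ‖WithLp.toLp 2 v‖ := by
  refine (pow_left_inj₀ (norm_nonneg _) (norm_nonneg _) two_ne_zero).1 ?_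
  rw [norm_sq_eq_tsum, EuclideanSpace.norm_sq_eq, tsum_eq_sum (s := Λ), ← Finset.sum_coe_sort]
  · refine Finset.sum_congr rfl fun n _ => ?_
    rw [embed_apply, dif_pos n.2]
  · intro n hn
    rw [embed_apply, dif_neg hn]
    simp

theorem embed_add (Λ : Finset (Fin d → ℤ)) (v w : Λ → ℂ) :
    embed Λ (v + w) = embed Λ v + embed Λ w := by
  simp [embed, add_smul, Finset.sum_add_distrib]

theorem embed_smul (Λ : Finset (Fin d → ℤ)) (c : ℂ) (v : Λ → ℂ) :
    embed Λ (c • v) = c • embed Λ v := by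
  simp [embed, mul_smul, Finset.smul_sum]

/-- On `ℓ²(Λ)` the operator `χ_Λ H^ω χ_Λ` is the matrix `H_Λ`. -/
theorem compression_embed (Λ : Finset (Fin d → ℤ)) (ω : (Fin d → ℤ) → ℝ) (v : Λ → ℂ) :
    compression Λ ω (embed Λ v) = embed Λ ((finiteHamiltonian Λ ω).mulVec v) := by
  ext m
  rw [embed_apply]
  split_ifs with h
  · rw [compression_apply, if_pos h]
    have h1 : cutoff Λ (embed Λ v) = embed Λ v := by
      ext k
      rw [cutoff_apply, embed_apply]
      split_ifs <;> rfl
    rw [h1]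
    have h2 : ∀ (B : Ell2 d →ₗ[ℂ] Ell2 d),
        B (embed Λ v) m = ∑ n : Λ, v n * B (delta (n : Fin d → ℤ)) m := by
      intro B
      rw [embed, map_sum, lp.coeFn_sum, Finset.sum_apply]
      refine Finset.sum_congr rfl fun n _ => ?_
      rw [map_smul, lp.coeFn_smul, Pi.smul_apply, smul_eq_mul]
    have h3 := h2 LinearMap.id
    simp only [LinearMap.id_apply] at h3
    rw [h2, h3, Finset.mul_sum, ← Finset.sum_add_distrib, Matrix.mulVec, dotProduct]
    refine Finset.sum_congr rfl fun n _ => ?_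
    change _ = ⟪(delta m : Ell2 d), hamiltonian ω ⟨delta n, delta_mem_domain ω n⟩⟫_ℂ * v n
    rw [inner_delta_left, hamiltonian_apply_apply]
    ring
  · rw [compression_apply, if_neg h]

/-! #### Strong convergence of the functional calculus -/

theorem norm_hermitianFun_mulVec_le {ι : Type*} [Fintype ι] [DecidableEq ι] {A : Matrix ι ι ℂ}
    (hA : A.IsHermitian) {g : ℝ → ℂ} {c : ℝ} (hc : 0 ≤ c) (hg : ∀ x, ‖g x‖ ≤ c) (v : ι → ℂ) :
    ‖WithLp.toLp 2 ((hermitianFun hA g).mulVec v)‖ ≤ c * ‖WithLp.toLp 2 v‖ := by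
  open scoped Matrix.Norms.L2Operator in
  have h := Matrix.l2_opNorm_mulVec (hermitianFun hA g) (WithLp.toLp 2 v)
  have h2 : ‖hermitianFun hA g‖ ≤ c := by
    unfold hermitianFun
    rw [CStarRing.norm_mul_mem_unitary _ (Unitary.star_mem hA.eigenvectorUnitary.2),
      CStarRing.norm_mem_unitary_mul _ hA.eigenvectorUnitary.2, Matrix.l2_opNorm_diagonal]
    exact (pi_norm_le_iff_of_nonneg hc).2 fun i => hg _
  exact h.trans (mul_le_mul_of_nonneg_right h2 (norm_nonneg _))

end FiniteVolume

/-! ### Strong resolvent convergence -/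

section Convergence

variable {d : ℕ}

theorem IsResolvent.norm_le {E : Type*} [NormedAddCommGroup E] [InnerProductSpace ℂ E]
    [CompleteSpace E] {T : E →ₗ.[ℂ] E} {η : ℝ} {R : E →L[ℂ] E} (h : IsResolvent T η R)
    (hT : ∀ φ : T.domain, (⟪(φ : E), T φ⟫_ℂ).im = 0) (hη : 1 ≤ |η|) : ‖R‖ ≤ 1 := by
  refine ContinuousLinearMap.opNorm_le_bound _ zero_le_one fun ψ => ?_
  have h1 := abs_mul_norm_le (hT ⟨R ψ, h.mem ψ⟩) η
  rw [h.apply_eq, sub_add_cancel] at h1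
  rw [one_mul]
  exact (le_mul_of_one_le_left (norm_nonneg _) hη).trans h1

theorem im_inner_hamiltonian (ω : (Fin d → ℤ) → ℝ) (φ : (hamiltonian ω).domain) :
    (⟪(φ : Ell2 d), hamiltonian ω φ⟫_ℂ).im = 0 := by
  rw [← Complex.conj_eq_iff_im]
  rw [inner_conj_symm, hamiltonian_symm]

theorem im_inner_compression (Λ : Finset (Fin d → ℤ)) (ω : (Fin d → ℤ) → ℝ) (φ : Ell2 d) :
    (⟪φ, compression Λ ω φ⟫_ℂ).im = 0 := by
  rw [← Complex.conj_eq_iff_im]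
  rw [inner_conj_symm, inner_compression]

/-- Strong resolvent convergence of the finite-volume Hamiltonians. The bound `‖(T + iη)⁻¹‖ ≤ 1`
reduces it to the convergence of `χ_Λ H χ_Λ` on the vector `R ψ` of the domain of `H`. The argument
`v` varies with `Λ` so that the statement can be iterated. -/
theorem IsResolvent.tendsto_embed {ω : (Fin d → ℤ) → ℝ} {η : ℝ} {R : Ell2 d →L[ℂ] Ell2 d}
    (h : IsResolvent (hamiltonian ω) η R) (hη : 1 ≤ |η|)
    {v : ∀ Λ : Finset (Fin d → ℤ), Λ → ℂ} {ψ : Ell2 d}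
    (hv : Tendsto (fun Λ => embed Λ (v Λ)) atTop (nhds ψ)) :
    Tendsto (fun Λ => embed Λ ((hermitianFun (isHermitian_finiteHamiltonian Λ ω)
      fun x => ((x : ℂ) + Complex.I * η)⁻¹).mulVec (v Λ))) atTop (nhds (R ψ)) := by
  have hη0 : η ≠ 0 := by
    rintro rfl
    simp at hη
    linarith
  set w : ∀ Λ : Finset (Fin d → ℤ), Λ → ℂ := fun Λ =>
    (hermitianFun (isHermitian_finiteHamiltonian Λ ω)
      fun x => ((x : ℂ) + Complex.I * η)⁻¹).mulVec (v Λ) with hw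
  have h1 : ∀ Λ, compression Λ ω (embed Λ (w Λ)) + (Complex.I * η) • embed Λ (w Λ) =
      embed Λ (v Λ) := by
    intro Λ
    have hA := isHermitian_finiteHamiltonian Λ ω
    have e : finiteHamiltonian Λ ω + (Complex.I * η) • (1 : Matrix Λ Λ ℂ) =
        hermitianFun hA fun x => (x : ℂ) + Complex.I * η := by
      rw [← hermitianFun_const hA, ← hermitianFun_add, hermitianFun_id]
    rw [compression_embed, ← embed_smul, ← embed_add]
    congr 1
    calc (finiteHamiltonian Λ ω).mulVec (w Λ) + (Complex.I * η) • w Λ =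
        (finiteHamiltonian Λ ω + (Complex.I * η) • (1 : Matrix Λ Λ ℂ)).mulVec (w Λ) := by
          rw [Matrix.add_mulVec, Matrix.smul_mulVec, Matrix.one_mulVec]
      _ = v Λ := by
          rw [e, hw, Matrix.mulVec_mulVec, hermitianFun_mul]
          have h2 : (fun x : ℝ => ((x : ℂ) + Complex.I * η) * ((x : ℂ) + Complex.I * η)⁻¹) =
              fun _ => 1 := funext fun x => mul_inv_cancel₀ (add_I_mul_ne_zero hη0 x)
          rw [h2, hermitianFun_const, one_smul, Matrix.one_mulVec]
  rw [tendsto_iff_norm_sub_tendsto_zero]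
  have h3 : Tendsto (fun Λ => ‖embed Λ (v Λ) -
      (compression Λ ω (R ψ) + (Complex.I * η) • R ψ)‖) atTop (nhds 0) := by
    have h4 := hv.sub ((tendsto_compression ω ⟨R ψ, h.mem ψ⟩).add_const ((Complex.I * η) • R ψ))
    rw [h.apply_eq, sub_add_cancel, sub_self] at h4
    exact tendsto_zero_iff_norm_tendsto_zero.1 h4
  refine squeeze_zero (fun _ => norm_nonneg _) (fun Λ => ?_) h3
  have h5 := abs_mul_norm_le (im_inner_compression Λ ω (embed Λ (w Λ) - R ψ)) η
  refine (le_mul_of_one_le_left (norm_nonneg _) hη).trans (h5.trans (le_of_eq ?_))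
  congr 1
  rw [map_sub, smul_sub, ← h1]
  abel

/-- The resolvent function `x ↦ (x + iη)⁻¹` with values in the unit disc. -/
def resolventFun (d : ℕ) (x : ℝ) : Metric.closedBall (0 : ℂ) 1 :=
  ⟨((x : ℂ) + Complex.I * eta d)⁻¹, by
    rw [mem_closedBall_zero_iff]
    refine (norm_inv_add_I_mul_le (by linarith [one_le_eta d]) x).trans ?_
    rw [abs_of_pos (by linarith [one_le_eta d])]
    exact inv_le_one_of_one_le₀ (one_le_eta d)⟩

/-- Continuous functions of the finite-volume resolvents converge strongly. By the Stone–Weierstrass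
theorem it is enough to treat the resolvents and their adjoints. The functions live on the unit
disc, which contains the spectra of all the resolvents. -/
theorem tendsto_embed_of_starAlgHom {ω : (Fin d → ℤ) → ℝ} {R : Ell2 d →L[ℂ] Ell2 d}
    (h : IsResolvent (hamiltonian ω) (eta d) R)
    (h' : IsResolvent (hamiltonian ω) (-eta d) (star R))
    (Φ : C(Metric.closedBall (0 : ℂ) 1, ℂ) →⋆ₐ[ℂ] (Ell2 d →L[ℂ] Ell2 d))
    (hΦ : Φ (.restrict _ (.id ℂ)) = R) (f : C(Metric.closedBall (0 : ℂ) 1, ℂ)) :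
    ∀ (v : ∀ Λ : Finset (Fin d → ℤ), Λ → ℂ) (ψ : Ell2 d),
      Tendsto (fun Λ => embed Λ (v Λ)) atTop (nhds ψ) →
      Tendsto (fun Λ => embed Λ ((hermitianFun (isHermitian_finiteHamiltonian Λ ω)
        fun x => f (resolventFun d x)).mulVec (v Λ))) atTop (nhds (Φ f ψ)) := by
  have h1 := one_le_eta d
  have heta : 1 ≤ |eta d| := by rwa [abs_of_pos (by linarith)]
  induction f using ContinuousMap.induction_on_of_compact with
  | const r =>
    intro v ψ hv
    have e : Φ (.const _ r) = r • 1 := by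
      rw [← Algebra.algebraMap_eq_smul_one, ← AlgHomClass.commutes Φ r]
      rfl
    rw [e]
    simp only [ContinuousMap.const_apply, hermitianFun_const, Matrix.smul_mulVec,
      Matrix.one_mulVec, embed_smul]
    exact hv.const_smul r
  | id =>
    intro v ψ hv
    rw [hΦ]
    exact h.tendsto_embed heta hv
  | star_id =>
    intro v ψ hv
    rw [map_star, hΦ]
    have h2 := h'.tendsto_embed (by rwa [abs_neg]) hv
    refine h2.congr fun Λ => ?_
    congr 3
    funext x
    simp [resolventFun]
  | add f g hf hg =>
    intro v ψ hv
    rw [map_add]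
    refine ((hf v ψ hv).add (hg v ψ hv)).congr fun Λ => ?_
    rw [← embed_add, ← Matrix.add_mulVec, hermitianFun_add]
    rfl
  | mul f g hf hg =>
    intro v ψ hv
    rw [map_mul]
    refine (hf _ _ (hg v ψ hv)).congr fun Λ => ?_
    rw [Matrix.mulVec_mulVec, hermitianFun_mul]
    rfl
  | frequently f hf =>
    intro v ψ hv
    rw [tendsto_iff_norm_sub_tendsto_zero, Metric.tendsto_nhds]
    intro ε hε
    have hδ : 0 < ε / (3 * (‖ψ‖ + 1)) := by positivity
    obtain ⟨g, hg, hgf⟩ := (hf.and_eventually (Metric.ball_mem_nhds f hδ)).exists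
    rw [dist_eq_norm] at hgf
    have h2 := hg v ψ hv
    rw [tendsto_iff_norm_sub_tendsto_zero] at h2
    have h3 : ∀ᶠ Λ in atTop, ‖embed Λ (v Λ)‖ < ‖ψ‖ + 1 :=
      hv.norm.eventually (gt_mem_nhds (by linarith))
    filter_upwards [h3, h2.eventually (gt_mem_nhds (show (0 : ℝ) < ε / 3 by positivity))]
      with Λ h3 h4
    rw [dist_zero_right, norm_norm]
    have hA := isHermitian_finiteHamiltonian Λ ω
    have e1 : embed Λ ((hermitianFun hA fun x => f (resolventFun d x)).mulVec (v Λ)) =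
        embed Λ ((hermitianFun hA fun x => g (resolventFun d x)).mulVec (v Λ)) -
        embed Λ ((hermitianFun hA fun x => (g - f) (resolventFun d x)).mulVec (v Λ)) := by
      rw [eq_sub_iff_add_eq, ← embed_add, ← Matrix.add_mulVec, hermitianFun_add]
      congr 3
      funext x
      simp
    have e2 : ‖embed Λ ((hermitianFun hA fun x => (g - f) (resolventFun d x)).mulVec (v Λ))‖ ≤
        ‖g - f‖ * (‖ψ‖ + 1) := by
      rw [norm_embed]
      refine (norm_hermitianFun_mulVec_le hA (norm_nonneg _)
        (fun x => ContinuousMap.norm_coe_le_norm (g - f) _) _).trans ?_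
      rw [← norm_embed]
      gcongr
    have e3 : ‖Φ g ψ - Φ f ψ‖ ≤ ‖g - f‖ * (‖ψ‖ + 1) := by
      have : Φ g ψ - Φ f ψ = Φ (g - f) ψ := by rw [map_sub]; rfl
      rw [this]
      refine ((Φ (g - f)).le_opNorm ψ).trans ?_
      have h5 : ‖Φ (g - f)‖ ≤ ‖g - f‖ := NonUnitalStarAlgHom.norm_apply_le Φ (g - f)
      exact mul_le_mul h5 (by linarith) (norm_nonneg _) (norm_nonneg _)
    have e4 : ‖g - f‖ * (‖ψ‖ + 1) < ε / 3 := by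
      calc ‖g - f‖ * (‖ψ‖ + 1) < ε / (3 * (‖ψ‖ + 1)) * (‖ψ‖ + 1) := by gcongr
        _ = ε / 3 := by field_simp
    rw [e1]
    have e5 : ∀ a b c p : Ell2 d, a - b - p = (a - c) - b + (c - p) := fun a b c p => by abel
    rw [e5 _ _ (Φ g ψ)]
    calc _ ≤ _ + _ := norm_add_le _ _
      _ ≤ (_ + _) + _ := by gcongr; exact norm_sub_le _ _
      _ < ε := by linarith

/-- The spectral measure at `δ_0` of the Hamiltonian compressed to `ℓ²(Λ)`; the value for `Λ ∌ 0`
is an arbitrary probability measure. -/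
def finiteMeasure (Λ : Finset (Fin d → ℤ)) (ω : (Fin d → ℤ) → ℝ) : Measure ℝ :=
  if h : 0 ∈ Λ then matrixMeasure (isHermitian_finiteHamiltonian Λ ω) ⟨0, h⟩ else Measure.dirac 0

instance (Λ : Finset (Fin d → ℤ)) (ω : (Fin d → ℤ) → ℝ) :
    IsProbabilityMeasure (finiteMeasure Λ ω) := by
  unfold finiteMeasure
  split_ifs <;> infer_instance

theorem isProbabilityMeasure_spectralMeasure (ω : (Fin d → ℤ) → ℝ) :
    IsProbabilityMeasure (spectralMeasure (hamiltonian ω) (delta 0)) := by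
  obtain ⟨R, h, -⟩ := exists_isResolvent_hamiltonian ω
  have := h.normal
  exact ⟨by rw [h.spectralMeasure_univ, norm_delta]; simp⟩

/-- Convergence of the spectral measures at `δ_0` when tested against functions of the resolvent. -/
theorem tendsto_integral_resolventFun (ω : (Fin d → ℤ) → ℝ) {g : ℂ → ℂ} (hg : Continuous g) :
    Tendsto (fun Λ => ∫ x, g (resolventFun d x) ∂(finiteMeasure Λ ω)) atTop
      (nhds (∫ x, g (resolventFun d x) ∂(spectralMeasure (hamiltonian ω) (delta 0)))) := by
  obtain ⟨R, h, h'⟩ := exists_isResolvent_hamiltonian ω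
  have hnormal := h.normal
  have h1 := one_le_eta d
  have hR : ‖R‖ ≤ 1 := h.norm_le (im_inner_hamiltonian ω) (by rwa [abs_of_pos (by linarith)])
  have hspec : spectrum ℂ R ⊆ Metric.closedBall 0 1 :=
    (spectrum.subset_closedBall_norm R).trans (Metric.closedBall_subset_closedBall hR)
  let Φ : C(Metric.closedBall (0 : ℂ) 1, ℂ) →⋆ₐ[ℂ] (Ell2 d →L[ℂ] Ell2 d) :=
    (cfcHom (R := ℂ) (p := IsStarNormal) hnormal).comp
      (ContinuousMap.compStarAlgHom' ℂ ℂ ⟨Set.inclusion hspec, continuous_inclusion hspec⟩)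
  have hΦ : Φ (.restrict _ (.id ℂ)) = R := cfcHom_id (R := ℂ) hnormal
  have hΦg : Φ (.restrict _ ⟨g, hg⟩) = cfc g R := by
    rw [cfc_apply g R hnormal hg.continuousOn]
    rfl
  have h2 := tendsto_embed_of_starAlgHom h h' Φ hΦ (.restrict _ ⟨g, hg⟩)
    (fun Λ n => if (n : Fin d → ℤ) = 0 then 1 else 0) (delta 0) (by
      refine tendsto_const_nhds.congr' ?_
      filter_upwards [eventually_ge_atTop ({0} : Finset (Fin d → ℤ))] with Λ hΛ
      have h0 : 0 ∈ Λ := hΛ (Finset.mem_singleton_self 0)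
      ext m
      rw [embed_apply, delta_apply]
      by_cases hm : m = 0
      · subst hm
        simp [h0]
      · simp [hm])
  rw [hΦg] at h2
  have h3 := (innerSL ℂ (delta 0 : Ell2 d)).continuous.tendsto _ |>.comp h2
  have h4 := h.integral_spectralMeasure (delta 0 : Ell2 d) hg
  change Tendsto _ atTop (nhds (∫ x : ℝ, g ((x + Complex.I * eta d)⁻¹)
    ∂(spectralMeasure (hamiltonian ω) (delta 0))))
  rw [h4]
  refine h3.congr' ?_
  filter_upwards [eventually_ge_atTop ({0} : Finset (Fin d → ℤ))] with Λ hΛ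
  have h0 : 0 ∈ Λ := hΛ (Finset.mem_singleton_self 0)
  rw [finiteMeasure, dif_pos h0, ← hermitianFun_apply_self]
  simp only [Function.comp_apply, innerSL_apply_apply]
  rw [inner_delta_left, embed_apply, dif_pos h0, Matrix.mulVec, dotProduct,
    Finset.sum_eq_single (⟨0, h0⟩ : Λ)]
  · simp
  · intro b _ hb
    rw [if_neg, mul_zero]
    exact fun h => hb (Subtype.ext h)
  · simp

end Convergence

/-! ### Moments of the finite-volume spectral measures -/

section Moments

variable {d : ℕ}

/-- A continuous cutoff of large energies which is a function of the resolvent `(x + iη)⁻¹`. -/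
def energyCutoff (d N : ℕ) (x : ℝ) : ℝ := min 1 (max 0 (N / (x ^ 2 + eta d ^ 2) - 1))

theorem energyCutoff_nonneg (d N : ℕ) (x : ℝ) : 0 ≤ energyCutoff d N x :=
  le_min zero_le_one (le_max_left _ _)

theorem energyCutoff_le_one (d N : ℕ) (x : ℝ) : energyCutoff d N x ≤ 1 := min_le_left _ _

theorem sq_add_eta_sq_pos (d : ℕ) (x : ℝ) : 0 < x ^ 2 + eta d ^ 2 := by
  have := one_le_eta d
  positivity

theorem continuous_energyCutoff (d N : ℕ) : Continuous (energyCutoff d N) := by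
  unfold energyCutoff
  have h : ∀ x : ℝ, x ^ 2 + eta d ^ 2 ≠ 0 := fun x => (sq_add_eta_sq_pos d x).ne'
  fun_prop (disch := exact h _)

theorem one_sub_energyCutoff_le (d : ℕ) {N : ℕ} (hN : 0 < N) (x : ℝ) :
    1 - energyCutoff d N x ≤ 2 * (x ^ 2 + eta d ^ 2) / N := by
  have hs := sq_add_eta_sq_pos d x
  have hN' : (0 : ℝ) < N := by exact_mod_cast hN
  by_cases h : 2 * (x ^ 2 + eta d ^ 2) ≤ N
  · have h1 : 1 ≤ N / (x ^ 2 + eta d ^ 2) - 1 := by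
      rw [le_sub_iff_add_le, le_div_iff₀ hs]
      linarith
    have h2 : energyCutoff d N x = 1 := min_eq_left (h1.trans (le_max_right _ _))
    rw [h2, sub_self]
    positivity
  · have h1 : 1 ≤ 2 * (x ^ 2 + eta d ^ 2) / N := by
      rw [le_div_iff₀ hN']
      linarith
    linarith [energyCutoff_nonneg d N x]

theorem norm_sq_resolventFun (x : ℝ) :
    ‖(resolventFun d x : ℂ)‖ ^ 2 = (x ^ 2 + eta d ^ 2)⁻¹ := by
  rw [resolventFun, norm_inv, inv_pow, ← Complex.normSq_eq_norm_sq, Complex.normSq_apply]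
  simp [sq]

theorem inv_resolventFun_re (x : ℝ) : ((resolventFun d x : ℂ)⁻¹).re = x := by
  rw [resolventFun, inv_inv]
  simp

/-- The cutoff makes `g` times it a continuous function of the resolvent: it vanishes when the
resolvent is close to `0`, where `x = re z⁻¹` is unbounded. -/
theorem exists_eq_comp_resolventFun {g : ℝ → ℝ} (hg : Continuous g) (N : ℕ) :
    ∃ G : ℂ → ℂ, Continuous G ∧
      ∀ x, G (resolventFun d x) = ((g x * energyCutoff d N x : ℝ) : ℂ) := by
  let κ : ℂ → ℝ := fun w => min 1 (max 0 (N * ‖w‖ ^ 2 - 1))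
  have hκ : Continuous κ := by fun_prop
  refine ⟨fun w => ((g (w⁻¹.re) * κ w : ℝ) : ℂ), ?_, fun x => ?_⟩
  · rw [continuous_iff_continuousAt]
    intro w
    by_cases hw : w = 0
    · have h0 : ∀ᶠ z in nhds w, κ z = 0 := by
        have h1 : ∀ᶠ z : ℂ in nhds w, N * ‖z‖ ^ 2 - 1 < 0 := by
          have h2 : Continuous fun z : ℂ => (N : ℝ) * ‖z‖ ^ 2 - 1 := by fun_prop
          refine h2.continuousAt.eventually (gt_mem_nhds ?_)
          simp [hw]
        filter_upwards [h1] with z hz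
        simp [κ, max_eq_left hz.le]
      have h3 : (fun z => ((g (z⁻¹.re) * κ z : ℝ) : ℂ)) =ᶠ[nhds w] fun _ => 0 := by
        filter_upwards [h0] with z hz
        simp [hz]
      exact continuousAt_const.congr h3.symm
    · have h1 : ContinuousAt (fun z : ℂ => g (z⁻¹.re)) w :=
        hg.continuousAt.comp (Complex.continuous_re.continuousAt.comp (continuousAt_inv₀ hw))
      exact Complex.continuous_ofReal.continuousAt.comp (h1.mul hκ.continuousAt)
  · simp only [inv_resolventFun_re, κ, norm_sq_resolventFun, energyCutoff, div_eq_mul_inv]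

theorem tendsto_integral_mul_energyCutoff (ω : (Fin d → ℤ) → ℝ) {g : ℝ → ℝ} (hg : Continuous g)
    (N : ℕ) :
    Tendsto (fun Λ => ∫ x, g x * energyCutoff d N x ∂(finiteMeasure Λ ω)) atTop
      (nhds (∫ x, g x * energyCutoff d N x ∂(spectralMeasure (hamiltonian ω) (delta 0)))) := by
  obtain ⟨G, hG, hGx⟩ := exists_eq_comp_resolventFun (d := d) hg N
  have h := tendsto_integral_resolventFun ω hG
  simp_rw [hGx, integral_complex_ofReal] at h
  exact (Complex.continuous_re.tendsto _).comp h

theorem integrable_finiteMeasure (Λ : Finset (Fin d → ℤ)) (ω : (Fin d → ℤ) → ℝ) (g : ℝ → ℝ) :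
    Integrable g (finiteMeasure Λ ω) := by
  unfold finiteMeasure
  split_ifs
  · exact integrable_matrixMeasure _ _ _
  · exact integrable_dirac (by simp)

/-- A random variable that dominates the moments of order at most `J` of all finite-volume
spectral measures. -/
def momentBound (J : ℕ) (ω : (Fin d → ℤ) → ℝ) : ℝ :=
  1 + (unitVectors d).card + ∑ n ∈ box d J, |ω n|

theorem one_le_momentBound (J : ℕ) (ω : (Fin d → ℤ) → ℝ) : 1 ≤ momentBound J ω := by
  have h : 0 ≤ ∑ n ∈ box d J, |ω n| := Finset.sum_nonneg fun _ _ => abs_nonneg _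
  unfold momentBound
  have : (0 : ℝ) ≤ (unitVectors d).card := by positivity
  linarith

theorem abs_le_momentBound (J : ℕ) (ω : (Fin d → ℤ) → ℝ) {n : Fin d → ℤ} (hn : n ∈ box d J) :
    |ω n| ≤ momentBound J ω := by
  have h := Finset.single_le_sum (f := fun n => |ω n|) (fun _ _ => abs_nonneg _) hn
  unfold momentBound
  have : (0 : ℝ) ≤ (unitVectors d).card := by positivity
  linarith

theorem zero_mem_box (J : ℕ) : (0 : Fin d → ℤ) ∈ box d J := by
  simp [box, Pi.le_def]

theorem mem_box {J : ℕ} {n : Fin d → ℤ} : n ∈ box d J ↔ ∀ i, |n i| ≤ J := by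
  simp [box, Pi.le_def, abs_le, forall_and]

theorem box_subset_box {J J' : ℕ} (h : J ≤ J') : box d J ⊆ box d J' := fun n hn =>
  mem_box.2 fun i => (mem_box.1 hn i).trans (by exact_mod_cast h)

theorem norm_compression_apply_le (Λ : Finset (Fin d → ℤ)) (ω : (Fin d → ℤ) → ℝ) (J : ℕ)
    {ψ : Ell2 d} (hψ : ∀ n, n ∉ box d J → ψ n = 0) :
    ‖compression Λ ω ψ‖ ≤ momentBound J ω * ‖ψ‖ := by
  have hS : 0 ≤ ∑ n ∈ box d J, |ω n| := Finset.sum_nonneg fun _ _ => abs_nonneg _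
  have h1 : ‖finitePotential Λ ω ψ‖ ≤ (∑ n ∈ box d J, |ω n|) * ‖ψ‖ := by
    have h : ‖finitePotential Λ ω ψ‖ ≤ ‖((∑ n ∈ box d J, |ω n| : ℝ) : ℂ) • ψ‖ := by
      refine lp.norm_mono two_ne_zero fun n => ?_
      rw [finitePotential, mulCLM_apply, lp.coeFn_smul, Pi.smul_apply, smul_eq_mul, norm_mul,
        norm_mul, Complex.norm_real, Real.norm_of_nonneg hS]
      by_cases hn : n ∈ box d J
      · refine mul_le_mul_of_nonneg_right ?_ (norm_nonneg _)
        split_ifs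
        · rw [Complex.norm_real]
          exact Finset.single_le_sum (f := fun n => |ω n|) (fun _ _ => abs_nonneg _) hn
        · rwa [norm_zero]
      · rw [hψ n hn, norm_zero, mul_zero, mul_zero]
    rwa [norm_smul, Complex.norm_real, Real.norm_of_nonneg hS] at h
  have hc : ∀ φ : Ell2 d, ‖cutoff Λ φ‖ ≤ ‖φ‖ := fun φ =>
    ((cutoff Λ).le_opNorm φ).trans (mul_le_of_le_one_left (norm_nonneg _) (norm_cutoff_le Λ))
  have h2 : ‖cutoff Λ (laplacian d (cutoff Λ ψ))‖ ≤ (unitVectors d).card * ‖ψ‖ :=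
    (hc _).trans ((norm_laplacian_le _).trans
      (mul_le_mul_of_nonneg_left (hc ψ) (by positivity)))
  change ‖cutoff Λ (laplacian d (cutoff Λ ψ)) + finitePotential Λ ω ψ‖ ≤ _
  refine (norm_add_le _ _).trans ?_
  unfold momentBound
  nlinarith [norm_nonneg ψ]

theorem abs_le_one_of_mem_unitVectors {e : Fin d → ℤ} (he : e ∈ unitVectors d) (i : Fin d) :
    |e i| ≤ 1 := by
  rw [mem_unitVectors] at he
  exact he ▸ Finset.single_le_sum (f := fun i => |e i|) (fun j _ => abs_nonneg (e j))
    (Finset.mem_univ i)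

/-- The hopping range is one: `(χ_Λ H χ_Λ)^j δ_0` lives on the box of radius `j`. -/
theorem compression_pow_delta (Λ : Finset (Fin d → ℤ)) (ω : (Fin d → ℤ) → ℝ) (J j : ℕ)
    (hj : j ≤ J) :
    (∀ n, n ∉ box d j → ((compression Λ ω ^ j) (delta 0)) n = 0) ∧
      ‖(compression Λ ω ^ j) (delta 0)‖ ≤ momentBound J ω ^ j := by
  induction j with
  | zero =>
    refine ⟨fun n hn => ?_, ?_⟩
    · change (delta 0 : Ell2 d) n = 0
      rw [delta_apply, if_neg]
      rintro rfl
      exact hn (zero_mem_box 0)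
    · rw [pow_zero, pow_zero]
      exact (norm_delta 0).le
  | succ j ih =>
    obtain ⟨ih1, ih2⟩ := ih (by omega)
    have e : (compression Λ ω ^ (j + 1)) (delta 0) =
        compression Λ ω ((compression Λ ω ^ j) (delta 0)) := by
      rw [pow_succ']
      rfl
    rw [e]
    refine ⟨fun n hn => ?_, ?_⟩
    · have hn0 : n ∉ box d j := fun h => hn (box_subset_box (Nat.le_succ j) h)
      rw [compression_apply, ih1 n hn0, mul_zero, add_zero]
      split_ifs
      · refine Finset.sum_eq_zero fun k hk => ?_
        rw [cutoff_apply, ih1, ite_self]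
        intro h
        refine hn (mem_box.2 fun i => ?_)
        have h1 := mem_box.1 h i
        have h2 := abs_le_one_of_mem_unitVectors hk i
        simp only [Pi.add_apply] at h1
        rw [abs_le] at h1 h2 ⊢
        push_cast
        omega
      · rfl
    · refine (norm_compression_apply_le Λ ω J fun n hn => ih1 n fun h =>
        hn (box_subset_box (by omega) h)).trans ?_
      rw [pow_succ']
      exact mul_le_mul_of_nonneg_left ih2 (zero_le_one.trans (one_le_momentBound J ω))

theorem embed_single (Λ : Finset (Fin d → ℤ)) (n : Λ) :
    embed Λ (Pi.single n 1) = delta (n : Fin d → ℤ) := by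
  rw [embed, Finset.sum_eq_single n]
  · simp
  · intro b _ hb
    rw [Pi.single_eq_of_ne hb, zero_smul]
  · simp

theorem compression_pow_embed (Λ : Finset (Fin d → ℤ)) (ω : (Fin d → ℤ) → ℝ) (v : Λ → ℂ) (j : ℕ) :
    (compression Λ ω ^ j) (embed Λ v) = embed Λ ((finiteHamiltonian Λ ω ^ j).mulVec v) := by
  induction j with
  | zero => simp
  | succ j ih =>
    rw [pow_succ', pow_succ', ← Matrix.mulVec_mulVec, ← compression_embed, ← ih]
    rfl

/-- The moments are `⟨δ_0, (χ_Λ H χ_Λ)^j δ_0⟩`, and bounded uniformly in `Λ`. -/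
theorem integral_pow_finiteMeasure_le (Λ : Finset (Fin d → ℤ)) (ω : (Fin d → ℤ) → ℝ) {J j : ℕ}
    (hj : j ≤ J) : ∫ x, x ^ j ∂(finiteMeasure Λ ω) ≤ momentBound J ω ^ j := by
  have hW := one_le_momentBound J ω
  unfold finiteMeasure
  split_ifs with h
  · rw [← pow_apply_self]
    have h1 : (finiteHamiltonian Λ ω ^ j) ⟨0, h⟩ ⟨0, h⟩ =
        ⟪(delta 0 : Ell2 d), (compression Λ ω ^ j) (delta 0)⟫_ℂ := by
      have h2 := embed_single Λ ⟨0, h⟩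
      simp only at h2
      rw [inner_delta_left, ← h2, compression_pow_embed, embed_apply, dif_pos h]
      simp
    rw [h1]
    refine (Complex.re_le_norm _).trans ((norm_inner_le_norm _ _).trans ?_)
    rw [norm_delta, one_mul]
    exact (compression_pow_delta Λ ω J j hj).2
  · rw [integral_dirac]
    have h1 : (0 : ℝ) ^ j ≤ 1 := pow_le_one₀ le_rfl zero_le_one
    exact h1.trans (one_le_pow₀ hW)

theorem integral_one_add_sq_pow_le (Λ : Finset (Fin d → ℤ)) (ω : (Fin d → ℤ) → ℝ) (p : ℕ) :
    ∫ x, (1 + x ^ 2) ^ p ∂(finiteMeasure Λ ω) ≤ 2 ^ (p + 1) * momentBound (2 * p) ω ^ (2 * p) := by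
  have hW := one_le_momentBound (2 * p) ω
  calc ∫ x, (1 + x ^ 2) ^ p ∂(finiteMeasure Λ ω)
      ≤ ∫ x, 2 ^ p * (1 + x ^ (2 * p)) ∂(finiteMeasure Λ ω) := by
        refine integral_mono (integrable_finiteMeasure _ _ _) (integrable_finiteMeasure _ _ _)
          fun x => ?_
        have h := add_pow_le zero_le_one (sq_nonneg x) p
        rw [one_pow, ← pow_mul] at h
        refine h.trans (mul_le_mul_of_nonneg_right
          (pow_le_pow_right₀ one_le_two (Nat.sub_le p 1)) ?_)
        rw [pow_mul]
        positivity
    _ = 2 ^ p * (1 + ∫ x, x ^ (2 * p) ∂(finiteMeasure Λ ω)) := by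
        rw [integral_const_mul, integral_add (integrable_const _) (integrable_finiteMeasure _ _ _)]
        simp
    _ ≤ 2 ^ p * (momentBound (2 * p) ω ^ (2 * p) + momentBound (2 * p) ω ^ (2 * p)) := by
        gcongr
        · exact one_le_pow₀ hW
        · exact integral_pow_finiteMeasure_le Λ ω le_rfl
    _ = _ := by ring

end Moments

/-! ### Convergence for test functions of polynomial growth -/

section MomentConvergence

variable {d : ℕ}

/-- The bound for the moments `∫ (1 + x²)^p` of the finite-volume spectral measures. -/
def evenMomentBound (p : ℕ) (ω : (Fin d → ℤ) → ℝ) : ℝ :=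
  2 ^ (p + 1) * momentBound (2 * p) ω ^ (2 * p)

theorem evenMomentBound_nonneg (p : ℕ) (ω : (Fin d → ℤ) → ℝ) : 0 ≤ evenMomentBound p ω := by
  have := one_le_momentBound (2 * p) ω
  unfold evenMomentBound
  positivity

theorem hasCompactSupport_energyCutoff (d N : ℕ) : HasCompactSupport (energyCutoff d N) := by
  refine HasCompactSupport.intro (isCompact_Icc (a := -(N : ℝ)) (b := N)) fun x hx => ?_
  have hs := sq_add_eta_sq_pos d x
  have h1 : (N : ℝ) ≤ x ^ 2 + eta d ^ 2 := by
    have h0 := one_le_eta d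
    have hN : (0 : ℝ) ≤ N := by positivity
    have h2 : (N : ℝ) ≤ |x| := by
      by_contra! h
      exact hx (abs_le.1 h.le)
    nlinarith [sq_abs x, sq_nonneg (|x| - 1)]
  have h2 : (N : ℝ) / (x ^ 2 + eta d ^ 2) - 1 ≤ 0 := by
    rw [sub_nonpos, div_le_one hs]
    exact h1
  rw [energyCutoff, max_eq_left h2]
  simp

theorem continuous_one_add_sq_pow (p : ℕ) : Continuous fun x : ℝ => (1 + x ^ 2) ^ p := by fun_prop

theorem integrable_mul_energyCutoff (m : Measure ℝ) [IsFiniteMeasure m] {g : ℝ → ℝ}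
    (hg : Continuous g) (N : ℕ) : Integrable (fun x => g x * energyCutoff d N x) m :=
  (hg.mul (continuous_energyCutoff d N)).integrable_of_hasCompactSupport
    (hasCompactSupport_energyCutoff d N).mul_left

theorem tendsto_energyCutoff (d : ℕ) (x : ℝ) :
    Tendsto (fun N => energyCutoff d N x) atTop (nhds 1) := by
  have h : Tendsto (fun N : ℕ => 2 * (x ^ 2 + eta d ^ 2) / (N : ℝ)) atTop (nhds 0) :=
    tendsto_const_div_atTop_nhds_zero_nat _
  have h1 : Tendsto (fun N => 1 - energyCutoff d N x) atTop (nhds 0) :=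
    tendsto_of_tendsto_of_tendsto_of_le_of_le' tendsto_const_nhds h
      (Eventually.of_forall fun N => sub_nonneg.2 (energyCutoff_le_one d N x))
      ((eventually_gt_atTop 0).mono fun N hN => one_sub_energyCutoff_le d hN x)
  have h2 := h1.const_sub 1
  simpa using h2

/-- The uniform moment bounds pass to the limit by Fatou's lemma. -/
theorem lintegral_one_add_sq_pow_spectralMeasure_le (ω : (Fin d → ℤ) → ℝ) (p : ℕ) :
    ∫⁻ x, ENNReal.ofReal ((1 + x ^ 2) ^ p) ∂(spectralMeasure (hamiltonian ω) (delta 0)) ≤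
      ENNReal.ofReal (evenMomentBound p ω) := by
  have := isProbabilityMeasure_spectralMeasure ω
  set m := spectralMeasure (hamiltonian ω) (delta 0)
  have h1 : ∀ N, ∫⁻ x, ENNReal.ofReal ((1 + x ^ 2) ^ p * energyCutoff d N x) ∂m ≤
      ENNReal.ofReal (evenMomentBound p ω) := by
    intro N
    have h0 : ∀ x : ℝ, 0 ≤ (1 + x ^ 2) ^ p * energyCutoff d N x := fun x =>
      mul_nonneg (by positivity) (energyCutoff_nonneg d N x)
    rw [← ofReal_integral_eq_lintegral_ofReal
      (integrable_mul_energyCutoff m (continuous_one_add_sq_pow p) N) (Eventually.of_forall h0)]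
    refine ENNReal.ofReal_le_ofReal ?_
    refine le_of_tendsto (tendsto_integral_mul_energyCutoff ω (continuous_one_add_sq_pow p) N)
      (Eventually.of_forall fun Λ => ?_)
    refine le_trans ?_ (integral_one_add_sq_pow_le Λ ω p)
    refine integral_mono (integrable_finiteMeasure _ _ _) (integrable_finiteMeasure _ _ _)
      fun x => ?_
    exact mul_le_of_le_one_right (by positivity) (energyCutoff_le_one d N x)
  have h2 : ∀ x : ℝ, ENNReal.ofReal ((1 + x ^ 2) ^ p) =
      liminf (fun N => ENNReal.ofReal ((1 + x ^ 2) ^ p * energyCutoff d N x)) atTop := by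
    intro x
    have h3 := (tendsto_energyCutoff d x).const_mul ((1 + x ^ 2) ^ p)
    rw [mul_one] at h3
    exact (ENNReal.tendsto_ofReal h3).liminf_eq.symm
  simp_rw [h2]
  refine (lintegral_liminf_le fun N => ?_).trans ?_
  · exact ((continuous_one_add_sq_pow p).mul (continuous_energyCutoff d N)).measurable.ennreal_ofReal
  · calc _ ≤ liminf (fun _ : ℕ => ENNReal.ofReal (evenMomentBound p ω)) atTop :=
          liminf_le_liminf (Eventually.of_forall h1)
      _ = _ := liminf_const _

theorem integrable_one_add_sq_pow_spectralMeasure (ω : (Fin d → ℤ) → ℝ) (p : ℕ) :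
    Integrable (fun x => (1 + x ^ 2) ^ p) (spectralMeasure (hamiltonian ω) (delta 0)) := by
  refine ⟨(continuous_one_add_sq_pow p).aestronglyMeasurable, ?_⟩
  rw [hasFiniteIntegral_iff_ofReal (Eventually.of_forall fun x => by positivity)]
  exact (lintegral_one_add_sq_pow_spectralMeasure_le ω p).trans_lt ENNReal.ofReal_lt_top

theorem integral_one_add_sq_pow_spectralMeasure_le (ω : (Fin d → ℤ) → ℝ) (p : ℕ) :
    ∫ x, (1 + x ^ 2) ^ p ∂(spectralMeasure (hamiltonian ω) (delta 0)) ≤ evenMomentBound p ω := by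
  have h := lintegral_one_add_sq_pow_spectralMeasure_le ω p
  rw [← ofReal_integral_eq_lintegral_ofReal (integrable_one_add_sq_pow_spectralMeasure ω p)
    (Eventually.of_forall fun x => by positivity)] at h
  exact (ENNReal.ofReal_le_ofReal_iff (evenMomentBound_nonneg p ω)).1 h

/-- The error made by cutting off large energies is controlled by a higher moment. -/
theorem abs_integral_sub_energyCutoff_le {m : Measure ℝ} {g : ℝ → ℝ} {C : ℝ} {p : ℕ}
    {N : ℕ} (hN : 0 < N) (hg : ∀ x, |g x| ≤ C * (1 + x ^ 2) ^ p) (hC : 0 ≤ C)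
    (h1 : Integrable g m) (h2 : Integrable (fun x => g x * energyCutoff d N x) m)
    (h3 : Integrable (fun x => (1 + x ^ 2) ^ (p + 1)) m) :
    |∫ x, g x ∂m - ∫ x, g x * energyCutoff d N x ∂m| ≤
      2 * C * eta d ^ 2 * (∫ x, (1 + x ^ 2) ^ (p + 1) ∂m) / N := by
  rw [← integral_sub h1 h2]
  have e : 2 * C * eta d ^ 2 * (∫ x, (1 + x ^ 2) ^ (p + 1) ∂m) / N =
      ∫ x, 2 * C * eta d ^ 2 / N * (1 + x ^ 2) ^ (p + 1) ∂m := by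
    rw [integral_const_mul]
    ring
  rw [e, ← Real.norm_eq_abs]
  refine norm_integral_le_of_norm_le (h3.const_mul _) (Eventually.of_forall fun x => ?_)
  have h4 := one_sub_energyCutoff_le d hN x
  have h5 := energyCutoff_le_one d N x
  have h6 : x ^ 2 + eta d ^ 2 ≤ eta d ^ 2 * (1 + x ^ 2) := by
    have := one_le_eta d
    have h7 : 1 ≤ eta d ^ 2 := one_le_pow₀ this
    nlinarith [sq_nonneg x]
  have hN' : (0 : ℝ) < N := by exact_mod_cast hN
  calc ‖g x - g x * energyCutoff d N x‖ = |g x| * (1 - energyCutoff d N x) := by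
        rw [← mul_one_sub, norm_mul, Real.norm_eq_abs, Real.norm_of_nonneg (sub_nonneg.2 h5)]
    _ ≤ C * (1 + x ^ 2) ^ p * (2 * (eta d ^ 2 * (1 + x ^ 2)) / N) := by
        refine mul_le_mul (hg x) (h4.trans ?_) (sub_nonneg.2 h5) (by positivity)
        gcongr
    _ = _ := by ring

/-- The finite-volume spectral measures converge to the spectral measure of the Hamiltonian when
tested against continuous functions of polynomial growth. -/
theorem tendsto_integral_finiteMeasure (ω : (Fin d → ℤ) → ℝ) {g : ℝ → ℝ} (hg : Continuous g)
    {C : ℝ} {p : ℕ} (hC : 0 ≤ C) (hgC : ∀ x, |g x| ≤ C * (1 + x ^ 2) ^ p) :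
    Integrable g (spectralMeasure (hamiltonian ω) (delta 0)) ∧
    Tendsto (fun Λ => ∫ x, g x ∂(finiteMeasure Λ ω)) atTop
      (nhds (∫ x, g x ∂(spectralMeasure (hamiltonian ω) (delta 0)))) := by
  have := isProbabilityMeasure_spectralMeasure ω
  set m := spectralMeasure (hamiltonian ω) (delta 0) with hm
  have hint : Integrable g m :=
    ((integrable_one_add_sq_pow_spectralMeasure ω p).const_mul C).mono'
      hg.aestronglyMeasurable (Eventually.of_forall hgC)
  refine ⟨hint, ?_⟩
  set D : ℝ := 2 * C * eta d ^ 2 * evenMomentBound (p + 1) ω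
  have hcoef : 0 ≤ 2 * C * eta d ^ 2 := by positivity
  rw [Metric.tendsto_nhds]
  intro ε hε
  have hDN : Tendsto (fun N : ℕ => D / (N : ℝ)) atTop (nhds 0) :=
    tendsto_const_div_atTop_nhds_zero_nat _
  obtain ⟨N, hN1, hN⟩ := ((hDN.eventually (gt_mem_nhds (show 0 < ε / 3 by positivity))).and
    (eventually_gt_atTop 0)).exists
  filter_upwards [(Metric.tendsto_nhds.1 (tendsto_integral_mul_energyCutoff ω hg N)) (ε / 3)
    (by positivity)] with Λ hΛ
  have a1 := abs_integral_sub_energyCutoff_le (d := d) (m := finiteMeasure Λ ω) hN hgC hC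
    (integrable_finiteMeasure _ _ _) (integrable_finiteMeasure _ _ _)
    (integrable_finiteMeasure _ _ _)
  have a2 := abs_integral_sub_energyCutoff_le (d := d) (m := m) hN hgC hC hint
    (integrable_mul_energyCutoff m hg N) (integrable_one_add_sq_pow_spectralMeasure ω (p + 1))
  have b1 : 2 * C * eta d ^ 2 * (∫ x, (1 + x ^ 2) ^ (p + 1) ∂(finiteMeasure Λ ω)) / N ≤ D / N := by
    have h := integral_one_add_sq_pow_le Λ ω (p + 1)
    exact div_le_div_of_nonneg_right (mul_le_mul_of_nonneg_left h hcoef) (Nat.cast_nonneg N)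
  have b2 : 2 * C * eta d ^ 2 * (∫ x, (1 + x ^ 2) ^ (p + 1) ∂m) / N ≤ D / N := by
    have h := integral_one_add_sq_pow_spectralMeasure_le ω (p + 1)
    exact div_le_div_of_nonneg_right (mul_le_mul_of_nonneg_left h hcoef) (Nat.cast_nonneg N)
  rw [Real.dist_eq] at hΛ ⊢
  rw [abs_sub_comm] at a2
  have c1 := abs_sub_le (∫ x, g x ∂(finiteMeasure Λ ω))
    (∫ x, g x * energyCutoff d N x ∂(finiteMeasure Λ ω)) (∫ x, g x ∂m)
  have c2 := abs_sub_le (∫ x, g x * energyCutoff d N x ∂(finiteMeasure Λ ω))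
    (∫ x, g x * energyCutoff d N x ∂m) (∫ x, g x ∂m)
  linarith

end MomentConvergence

/-! ### The modified density of states measure -/

section Measurability

variable {d : ℕ}

theorem continuous_integral_finiteMeasure (Λ : Finset (Fin d → ℤ)) {g : ℝ → ℝ}
    (hg : Continuous g) : Continuous fun ω => ∫ x, g x ∂(finiteMeasure Λ ω) := by
  unfold finiteMeasure
  split_ifs with h
  · simp_rw [← re_cfc_apply_self]
    exact Complex.continuous_re.comp ((continuous_cfc_matrix (continuous_finiteHamiltonian Λ)
      (isHermitian_finiteHamiltonian Λ) hg).matrix_elem _ _)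
  · exact continuous_const

/-- The spectral measure is a limit of spectral measures of matrices, which depend continuously on
`ω`. This makes the composition of kernels in the definition of `ν̄` meaningful. -/
theorem measurable_spectralMeasure :
    Measurable fun ω : (Fin d → ℤ) → ℝ => spectralMeasure (hamiltonian ω) (delta 0) := by
  have := isProbabilityMeasure_spectralMeasure (d := d)
  refine Measurable.measure_of_isPiSystem_of_isProbabilityMeasure
    (BorelSpace.measurable_eq.trans borel_eq_generateFrom_isClosed) isPiSystem_isClosed ?_
  intro F hF
  have h1 : ∀ n, Measurable fun ω : (Fin d → ℤ) → ℝ =>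
      ∫⁻ x, hF.apprSeq n x ∂(spectralMeasure (hamiltonian ω) (delta 0)) := by
    intro n
    have hc : Continuous fun x => (hF.apprSeq n x : ℝ) :=
      NNReal.continuous_coe.comp (hF.apprSeq n).continuous
    have hb : ∀ x, |(hF.apprSeq n x : ℝ)| ≤ 1 * (1 + x ^ 2) ^ 0 := by
      intro x
      rw [NNReal.abs_eq, pow_zero, mul_one]
      exact_mod_cast HasOuterApproxClosed.apprSeq_apply_le_one hF n x
    have e : ∀ ω : (Fin d → ℤ) → ℝ,
        ∫⁻ x, hF.apprSeq n x ∂(spectralMeasure (hamiltonian ω) (delta 0)) =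
          ENNReal.ofReal (∫ x, (hF.apprSeq n x : ℝ)
            ∂(spectralMeasure (hamiltonian ω) (delta 0))) := by
      intro ω
      rw [ofReal_integral_eq_lintegral_ofReal
        (tendsto_integral_finiteMeasure ω hc zero_le_one hb).1
        (Eventually.of_forall fun x => NNReal.coe_nonneg _)]
      simp
    simp_rw [e]
    refine Measurable.ennreal_ofReal ?_
    refine measurable_of_tendsto_metrizable' (atTop : Filter (Finset (Fin d → ℤ)))
      (fun Λ => (continuous_integral_finiteMeasure Λ hc).measurable) ?_
    rw [tendsto_pi_nhds]
    exact fun ω => (tendsto_integral_finiteMeasure ω hc zero_le_one hb).2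
  refine measurable_of_tendsto_metrizable h1 ?_
  rw [tendsto_pi_nhds]
  exact fun ω => HasOuterApproxClosed.tendsto_lintegral_apprSeq hF _

theorem continuous_rescaleZero :
    Continuous fun p : ℝ × ((Fin d → ℤ) → ℝ) => rescaleZero p.1 p.2 := by
  unfold rescaleZero
  fun_prop

/-- The product of the Lebesgue measure on `[0, 1]` and the law of the potential. -/
def scaledLaw (d : ℕ) (μ : Measure ℝ) [IsProbabilityMeasure μ] :
    Measure (ℝ × ((Fin d → ℤ) → ℝ)) :=
  (volume.restrict (Set.Icc (0 : ℝ) 1)).prod (law d μ)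

variable (μ : Measure ℝ) [IsProbabilityMeasure μ]

instance : IsProbabilityMeasure (law d μ) := by
  unfold law
  infer_instance

instance : IsProbabilityMeasure (scaledLaw d μ) := by
  have : IsProbabilityMeasure (volume.restrict (Set.Icc (0 : ℝ) 1)) := ⟨by simp⟩
  unfold scaledLaw
  infer_instance

theorem measurable_spectralMeasure_rescaleZero :
    Measurable fun p : ℝ × ((Fin d → ℤ) → ℝ) =>
      spectralMeasure (hamiltonian (rescaleZero p.1 p.2)) (delta 0) :=
  measurable_spectralMeasure.comp continuous_rescaleZero.measurable

theorem lintegral_bind_withDensity_bind {Ω : Type*} [MeasurableSpace Ω] (ρ : Measure ℝ)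
    (P : Measure Ω) [SFinite P] {κ : ℝ × Ω → Measure ℝ} (hκ : Measurable κ)
    {w : Ω → ℝ≥0∞} (hw : Measurable w) {G : ℝ → ℝ≥0∞} (hG : Measurable G) :
    ∫⁻ x, G x ∂(ρ.bind fun u => (P.withDensity w).bind fun ω => κ (u, ω)) =
      ∫⁻ p, w p.2 * ∫⁻ x, G x ∂(κ p) ∂(ρ.prod P) := by
  have hκu : ∀ u, Measurable fun ω => κ (u, ω) := fun u => hκ.comp measurable_prodMk_left
  have hin : Measurable fun p => ∫⁻ x, G x ∂(κ p) := (Measure.measurable_lintegral hG).comp hκ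
  have hbind : Measurable fun u : ℝ => (P.withDensity w).bind fun ω => κ (u, ω) := by
    refine Measure.measurable_of_measurable_coe _ fun B hB => ?_
    simp_rw [Measure.bind_apply hB (hκu _).aemeasurable]
    exact Measurable.lintegral_prod_right' ((Measure.measurable_coe hB).comp hκ)
  have hprod := lintegral_prod (μ := ρ) (ν := P) (fun p => w p.2 * ∫⁻ x, G x ∂(κ p))
    ((hw.comp measurable_snd).mul hin).aemeasurable
  rw [Measure.lintegral_bind hbind.aemeasurable hG.aemeasurable, hprod]
  refine lintegral_congr fun u => ?_
  rw [Measure.lintegral_bind (hκu u).aemeasurable hG.aemeasurable]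
  exact lintegral_withDensity_eq_lintegral_mul _ hw (hin.comp (measurable_prodMk_left (x := u)))

/-- The defining formula of `ν̄`, for functions instead of sets. -/
theorem lintegral_modifiedDOS {G : ℝ → ℝ≥0∞} (hG : Measurable G) :
    ∫⁻ x, G x ∂(modifiedDOS d μ) = ∫⁻ p, ENNReal.ofReal (p.2 0 ^ 2) *
      ∫⁻ x, G x ∂(spectralMeasure (hamiltonian (rescaleZero p.1 p.2)) (delta 0))
        ∂(scaledLaw d μ) :=
  lintegral_bind_withDensity_bind _ _ measurable_spectralMeasure_rescaleZero
    (by fun_prop : Measurable fun ω : (Fin d → ℤ) → ℝ => ENNReal.ofReal (ω 0 ^ 2)) hG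

end Measurability

/-! ### Averages over the disorder -/

section Averages

variable {d : ℕ} {μ : Measure ℝ} [IsProbabilityMeasure μ]

theorem memLp_momentBound (hμ : ∀ k : ℕ, Integrable (fun x => |x| ^ k) μ) (J q : ℕ) :
    MemLp (momentBound (d := d) J) q (law d μ) := by
  have h1 : MemLp (fun x : ℝ => |x|) q μ := by
    by_cases hq : q = 0
    · subst hq
      rw [Nat.cast_zero, memLp_zero_iff_aestronglyMeasurable]
      exact continuous_abs.aestronglyMeasurable
    · refine (integrable_norm_rpow_iff continuous_abs.aestronglyMeasurable
        (by exact_mod_cast hq) (by simp)).1 ?_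
      simpa using hμ q
  have h2 : ∀ n : Fin d → ℤ, MemLp (fun ω : (Fin d → ℤ) → ℝ => |ω n|) q (law d μ) := fun n =>
    h1.comp_measurePreserving (measurePreserving_eval_infinitePi (fun _ => μ) n)
  have h3 : MemLp (fun ω : (Fin d → ℤ) → ℝ => ∑ n ∈ box d J, |ω n|) q (law d μ) :=
    memLp_finsetSum _ fun n _ => h2 n
  have h4 : MemLp (fun _ : (Fin d → ℤ) → ℝ => 1 + ((unitVectors d).card : ℝ)) q (law d μ) :=
    memLp_const _
  exact h4.add h3

theorem integrable_momentBound_pow (hμ : ∀ k : ℕ, Integrable (fun x => |x| ^ k) μ) (J q : ℕ) :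
    Integrable (fun ω => momentBound (d := d) J ω ^ q) (law d μ) := by
  by_cases hq : q = 0
  · subst hq
    simp
  refine ((memLp_momentBound hμ J q).integrable_norm_pow hq).congr (Eventually.of_forall fun ω => ?_)
  have h := one_le_momentBound J ω
  simp only
  rw [Real.norm_of_nonneg (by linarith)]

theorem momentBound_rescaleZero_le (J : ℕ) {u : ℝ} (hu : |u| ≤ 1) (ω : (Fin d → ℤ) → ℝ) :
    momentBound J (rescaleZero u ω) ≤ momentBound J ω := by
  unfold momentBound
  refine add_le_add le_rfl (Finset.sum_le_sum fun n _ => ?_)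
  unfold rescaleZero
  by_cases hn : n = 0
  · subst hn
    rw [Function.update_self, abs_mul]
    exact mul_le_of_le_one_left (abs_nonneg _) hu
  · rw [Function.update_of_ne hn]

theorem integral_finiteMeasure_le (Λ : Finset (Fin d → ℤ)) (ω : (Fin d → ℤ) → ℝ) {g : ℝ → ℝ}
    {C : ℝ} {p : ℕ} (hC : 0 ≤ C) (hg : ∀ x, |g x| ≤ C * (1 + x ^ 2) ^ p) :
    |∫ x, g x ∂(finiteMeasure Λ ω)| ≤ C * evenMomentBound p ω := by
  have h1 : |∫ x, g x ∂(finiteMeasure Λ ω)| ≤ ∫ x, C * (1 + x ^ 2) ^ p ∂(finiteMeasure Λ ω) := by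
    rw [← Real.norm_eq_abs]
    exact norm_integral_le_of_norm_le (integrable_finiteMeasure _ _ _) (Eventually.of_forall hg)
  rw [integral_const_mul] at h1
  exact h1.trans (mul_le_mul_of_nonneg_left (integral_one_add_sq_pow_le Λ ω p) hC)

/-- The finite-volume analogue of `∫ g dν̄`. -/
def averagedMoment (μ : Measure ℝ) [IsProbabilityMeasure μ] (g : ℝ → ℝ)
    (Λ : Finset (Fin d → ℤ)) : ℝ≥0∞ :=
  ∫⁻ p, ENNReal.ofReal (p.2 0 ^ 2) *
    ENNReal.ofReal (∫ x, g x ∂(finiteMeasure Λ (rescaleZero p.1 p.2))) ∂(scaledLaw d μ)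

theorem measurable_averagedMoment_integrand {g : ℝ → ℝ} (hg : Continuous g)
    (Λ : Finset (Fin d → ℤ)) : Measurable fun p : ℝ × ((Fin d → ℤ) → ℝ) =>
      ENNReal.ofReal (p.2 0 ^ 2) *
        ENNReal.ofReal (∫ x, g x ∂(finiteMeasure Λ (rescaleZero p.1 p.2))) := by
  have h1 : Measurable fun p : ℝ × ((Fin d → ℤ) → ℝ) => ENNReal.ofReal (p.2 0 ^ 2) :=
    Measurable.ennreal_ofReal (by fun_prop)
  exact h1.mul ((continuous_integral_finiteMeasure Λ hg).comp
    continuous_rescaleZero).measurable.ennreal_ofReal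

/-- The finite-volume averages converge to the integral against `ν̄`, and are bounded uniformly
in the volume. -/
theorem tendsto_averagedMoment (hμ : ∀ k : ℕ, Integrable (fun x => |x| ^ k) μ) {g : ℝ → ℝ}
    (hg : Continuous g) (hg0 : ∀ x, 0 ≤ g x) {C : ℝ} {p : ℕ} (hC : 0 ≤ C)
    (hgC : ∀ x, |g x| ≤ C * (1 + x ^ 2) ^ p) :
    (∃ B : ℝ≥0∞, B ≠ ∞ ∧ ∀ Λ : Finset (Fin d → ℤ), averagedMoment μ g Λ ≤ B) ∧
    Tendsto (averagedMoment (d := d) μ g) atTop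
      (nhds (∫⁻ x, ENNReal.ofReal (g x) ∂(modifiedDOS d μ))) := by
  let bound : ℝ × ((Fin d → ℤ) → ℝ) → ℝ≥0∞ := fun q =>
    ENNReal.ofReal (C * 2 ^ (p + 1) * momentBound (2 * p) q.2 ^ (2 * p + 2))
  have hfin : ∫⁻ q, bound q ∂(scaledLaw d μ) ≠ ∞ := by
    have h1 : Integrable (fun q : ℝ × ((Fin d → ℤ) → ℝ) =>
        C * 2 ^ (p + 1) * momentBound (2 * p) q.2 ^ (2 * p + 2)) (scaledLaw d μ) := by
      have h2 := (integrable_momentBound_pow (d := d) hμ (2 * p) (2 * p + 2)).comp_snd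
        (volume.restrict (Set.Icc (0 : ℝ) 1))
      exact h2.const_mul _
    exact h1.lintegral_lt_top.ne
  have hae : ∀ᵐ q ∂(scaledLaw d μ), q.1 ∈ Set.Icc (0 : ℝ) 1 := by
    have h : ∀ᵐ u ∂(volume.restrict (Set.Icc (0 : ℝ) 1)), u ∈ Set.Icc (0 : ℝ) 1 :=
      ae_restrict_mem measurableSet_Icc
    exact Measure.quasiMeasurePreserving_fst.ae h
  have hbound : ∀ Λ : Finset (Fin d → ℤ), ∀ᵐ q ∂(scaledLaw d μ), ENNReal.ofReal (q.2 0 ^ 2) *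
      ENNReal.ofReal (∫ x, g x ∂(finiteMeasure Λ (rescaleZero q.1 q.2))) ≤ bound q := by
    intro Λ
    filter_upwards [hae] with q hq
    have hu : |q.1| ≤ 1 := by rw [abs_of_nonneg hq.1]; exact hq.2
    have h1 := (le_abs_self _).trans (integral_finiteMeasure_le Λ (rescaleZero q.1 q.2) hC hgC)
    have h2 := momentBound_rescaleZero_le (2 * p) hu q.2
    have h3 := abs_le_momentBound (2 * p) q.2 (zero_mem_box (2 * p))
    have h4 := one_le_momentBound (2 * p) (rescaleZero q.1 q.2)
    rw [← ENNReal.ofReal_mul (sq_nonneg _)]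
    refine ENNReal.ofReal_le_ofReal ?_
    calc q.2 0 ^ 2 * ∫ x, g x ∂(finiteMeasure Λ (rescaleZero q.1 q.2))
        ≤ momentBound (2 * p) q.2 ^ 2 *
          (C * (2 ^ (p + 1) * momentBound (2 * p) q.2 ^ (2 * p))) := by
          refine mul_le_mul ?_ (h1.trans ?_) (integral_nonneg hg0) (sq_nonneg _)
          · rw [← sq_abs]
            exact pow_le_pow_left₀ (abs_nonneg _) h3 2
          · unfold evenMomentBound
            gcongr
      _ = _ := by ring
  refine ⟨⟨_, hfin, fun Λ => lintegral_mono_ae (hbound Λ)⟩, ?_⟩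
  rw [lintegral_modifiedDOS μ hg.measurable.ennreal_ofReal]
  refine tendsto_lintegral_filter_of_dominated_convergence bound
    (Eventually.of_forall fun Λ => measurable_averagedMoment_integrand hg Λ)
    (Eventually.of_forall hbound) hfin (Eventually.of_forall fun q => ?_)
  have h1 := tendsto_integral_finiteMeasure (rescaleZero q.1 q.2) hg hC hgC
  rw [← ofReal_integral_eq_lintegral_ofReal h1.1 (Eventually.of_forall hg0)]
  exact ENNReal.Tendsto.const_mul (ENNReal.tendsto_ofReal h1.2) (Or.inr ENNReal.ofReal_ne_top)

/-! #### Translations -/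

/-- The translated configuration `k ↦ ω (k + n)`. -/
def translate (n : Fin d → ℤ) (ω : (Fin d → ℤ) → ℝ) : (Fin d → ℤ) → ℝ := fun k => ω (k + n)

theorem measurePreserving_translate (n : Fin d → ℤ) :
    MeasurePreserving (translate n) (law d μ) (law d μ) := by
  refine ⟨measurable_pi_lambda _ fun k => measurable_pi_apply _, ?_⟩
  have h := Measure.infinitePi_map_piCongrLeft (X := fun _ : Fin d → ℤ => ℝ) (fun _ => μ)
    (Equiv.subRight n)
  unfold law
  convert h using 2
  funext ω k
  obtain ⟨j, rfl⟩ := (Equiv.subRight n).surjective k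
  rw [MeasurableEquiv.coe_piCongrLeft, Equiv.piCongrLeft_apply_apply]
  simp [translate]

/-- The translated volume `Λ - n`. -/
def translateFinset (Λ : Finset (Fin d → ℤ)) (n : Fin d → ℤ) : Finset (Fin d → ℤ) :=
  Λ.map (Equiv.subRight n).toEmbedding

theorem mem_translateFinset {Λ : Finset (Fin d → ℤ)} {n k : Fin d → ℤ} :
    k ∈ translateFinset Λ n ↔ k + n ∈ Λ := by
  unfold translateFinset
  rw [Finset.mem_map_equiv]
  rfl

/-- Translation covariance: the entry at `n` for the volume `Λ` is the entry at `0` for `Λ - n`. -/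
theorem cfc_finiteHamiltonian_apply_self (Λ : Finset (Fin d → ℤ)) (ω : (Fin d → ℤ) → ℝ)
    (g : ℝ → ℝ) (n : Λ) : (cfc g (finiteHamiltonian Λ ω) n n).re =
      ∫ x, g x ∂(finiteMeasure (translateFinset Λ n) (translate n ω)) := by
  have h0 : 0 ∈ translateFinset Λ (n : Fin d → ℤ) := by
    rw [mem_translateFinset, zero_add]
    exact n.2
  let e : translateFinset Λ (n : Fin d → ℤ) ≃ Λ :=
    (Equiv.addRight (n : Fin d → ℤ)).subtypeEquiv fun k => mem_translateFinset
  have he : ∀ k, ((e k : Λ) : Fin d → ℤ) = k + n := fun k => rfl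
  have h1 : finiteHamiltonian (translateFinset Λ n) (translate n ω) =
      (finiteHamiltonian Λ ω).submatrix e e := by
    ext k l
    rw [Matrix.submatrix_apply, finiteHamiltonian_apply, finiteHamiltonian_apply]
    simp only [he, e.injective.eq_iff, add_sub_add_right_eq_sub]
    rfl
  have h2 : e ⟨0, h0⟩ = n := Subtype.ext (by rw [he, zero_add])
  rw [finiteMeasure, dif_pos h0, ← re_cfc_apply_self, h1,
    map_cfc_reindex e (isHermitian_finiteHamiltonian Λ ω), Matrix.submatrix_apply, h2]

end Averages

/-! ### The variance of traces -/

section Variance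

theorem exists_polynomial_bound (P : Polynomial ℝ) :
    ∃ C : ℝ, ∃ p : ℕ, 0 ≤ C ∧ ∀ x, P.eval x ≤ C * (1 + x ^ 2) ^ p := by
  refine ⟨∑ i ∈ Finset.range (P.natDegree + 1), |P.coeff i|, P.natDegree,
    Finset.sum_nonneg fun _ _ => abs_nonneg _, fun x => ?_⟩
  rw [Polynomial.eval_eq_sum_range, Finset.sum_mul]
  refine Finset.sum_le_sum fun i hi => (le_abs_self _).trans ?_
  rw [abs_mul, abs_pow]
  refine mul_le_mul_of_nonneg_left ?_ (abs_nonneg _)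
  have h1 : |x| ≤ 1 + x ^ 2 := by nlinarith [sq_abs x, sq_nonneg (|x| - 1)]
  calc |x| ^ i ≤ (1 + x ^ 2) ^ i := pow_le_pow_left₀ (abs_nonneg _) h1 i
    _ ≤ (1 + x ^ 2) ^ P.natDegree :=
      pow_le_pow_right₀ (by nlinarith [sq_nonneg x]) (Nat.lt_succ_iff.1 (Finset.mem_range.1 hi))

/-- Polynomial growth of the derivative implies that of the function. -/
theorem abs_le_of_abs_deriv_le {f : ℝ → ℝ} (hf : Differentiable ℝ f) {C : ℝ} {p : ℕ} (hC : 0 ≤ C)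
    (h : ∀ x, |deriv f x| ≤ C * (1 + x ^ 2) ^ p) (x : ℝ) :
    |f x| ≤ (|f 0| + C) * (1 + x ^ 2) ^ (p + 1) := by
  have h1 : ‖f x - f 0‖ ≤ C * (1 + x ^ 2) ^ p * ‖x - 0‖ := by
    refine Convex.norm_image_sub_le_of_norm_deriv_le (s := Set.Icc (-|x|) |x|)
      (fun y _ => hf y) (fun y hy => ?_) (convex_Icc _ _) ?_ ?_
    · refine (h y).trans ?_
      have h2 : y ^ 2 ≤ x ^ 2 := sq_le_sq.2 (abs_le.2 hy)
      gcongr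
    · simp
    · exact abs_le.1 le_rfl
  rw [sub_zero, Real.norm_eq_abs, Real.norm_eq_abs] at h1
  have h3 : |f x| ≤ |f 0| + |f x - f 0| := by
    have := abs_add_le (f 0) (f x - f 0)
    rwa [add_sub_cancel] at this
  have h4 : |x| ≤ 1 + x ^ 2 := by nlinarith [sq_abs x, sq_nonneg (|x| - 1)]
  have h5 : 1 ≤ (1 + x ^ 2) ^ (p + 1) := one_le_pow₀ (by nlinarith [sq_nonneg x])
  calc |f x| ≤ |f 0| + C * (1 + x ^ 2) ^ p * |x| := h3.trans (by linarith)
    _ ≤ |f 0| * (1 + x ^ 2) ^ (p + 1) + C * (1 + x ^ 2) ^ p * (1 + x ^ 2) := by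
        gcongr
        exact le_mul_of_one_le_right (abs_nonneg _) h5
    _ = _ := by ring

variable {d : ℕ} {μ : Measure ℝ} [IsProbabilityMeasure μ]

theorem memLp_evenMomentBound (hμ : ∀ k : ℕ, Integrable (fun x => |x| ^ k) μ) (p : ℕ) :
    MemLp (evenMomentBound (d := d) p) 2 (law d μ) := by
  have hm : Measurable (evenMomentBound (d := d) p) := by
    unfold evenMomentBound momentBound
    fun_prop
  rw [memLp_two_iff_integrable_sq hm.aestronglyMeasurable]
  refine ((integrable_momentBound_pow (d := d) hμ (2 * p) (2 * p * 2)).const_mul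
    ((2 ^ (p + 1)) ^ 2)).congr (Eventually.of_forall fun ω => ?_)
  simp only [evenMomentBound]
  rw [mul_pow, ← pow_mul (momentBound (2 * p) ω)]

/-- The random variable `⟨δ_n, f(H_Λ) δ_n⟩`. -/
def diagonalEntry (f : ℝ → ℝ) (Λ : Finset (Fin d → ℤ)) (n : Λ) (ω : (Fin d → ℤ) → ℝ) : ℝ :=
  (cfc f (finiteHamiltonian Λ ω) n n).re

theorem continuous_diagonalEntry {f : ℝ → ℝ} (hf : Continuous f) (Λ : Finset (Fin d → ℤ))
    (n : Λ) : Continuous (diagonalEntry f Λ n) :=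
  Complex.continuous_re.comp ((continuous_cfc_matrix (continuous_finiteHamiltonian Λ)
    (isHermitian_finiteHamiltonian Λ) hf).matrix_elem _ _)

theorem memLp_diagonalEntry (hμ : ∀ k : ℕ, Integrable (fun x => |x| ^ k) μ) {f : ℝ → ℝ}
    (hf : Continuous f) {C : ℝ} {p : ℕ} (hC : 0 ≤ C) (hfC : ∀ x, |f x| ≤ C * (1 + x ^ 2) ^ p)
    (Λ : Finset (Fin d → ℤ)) (n : Λ) : MemLp (diagonalEntry f Λ n) 2 (law d μ) := by
  have h1 : MemLp (fun ω => C * evenMomentBound p (translate (n : Fin d → ℤ) ω)) 2 (law d μ) :=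
    ((memLp_evenMomentBound hμ p).comp_measurePreserving
      (measurePreserving_translate (n : Fin d → ℤ))).const_mul C
  refine h1.mono' (continuous_diagonalEntry hf Λ n).aestronglyMeasurable
    (Eventually.of_forall fun ω => ?_)
  unfold diagonalEntry
  rw [cfc_finiteHamiltonian_apply_self, Real.norm_eq_abs]
  exact integral_finiteMeasure_le _ _ hC hfC

/-- The linear statistic `Tr f(H_Λ)`. -/
def traceStatistic (f : ℝ → ℝ) (Λ : Finset (Fin d → ℤ)) (ω : (Fin d → ℤ) → ℝ) : ℝ :=
  ∑ n : Λ, diagonalEntry f Λ n ω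

theorem traceStatistic_eq (f : ℝ → ℝ) (Λ : Finset (Fin d → ℤ)) (ω : (Fin d → ℤ) → ℝ) :
    traceStatistic f Λ ω = (cfc f (finiteHamiltonian Λ ω)).trace.re := by
  rw [Matrix.trace, Complex.re_sum]
  rfl

theorem translate_update_mul (n : Fin d → ℤ) (t : ℝ) (ω : (Fin d → ℤ) → ℝ) :
    translate n (Function.update ω n (t * ω n)) = rescaleZero t (translate n ω) := by
  funext k
  unfold translate rescaleZero
  by_cases hk : k = 0
  · subst hk
    simp
  · rw [Function.update_of_ne hk, Function.update_of_ne]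
    simpa using hk

/-- Switching off the potential at the site `n` changes `Tr f(H_Λ)` by an integral of
`⟨δ_n, f'(·) δ_n⟩` along the rescaled Hamiltonians. -/
theorem traceStatistic_sub_update {f : ℝ → ℝ} (hf : Differentiable ℝ f)
    (hf' : Continuous (deriv f)) (Λ : Finset (Fin d → ℤ)) (n : Λ) (ω : (Fin d → ℤ) → ℝ) :
    traceStatistic f Λ ω - traceStatistic f Λ (Function.update ω n 0) =
      ∫ t in (0 : ℝ)..1, ω n * ∫ x, deriv f x
        ∂(finiteMeasure (translateFinset Λ n) (rescaleZero t (translate n ω))) := by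
  have key : ∀ t : ℝ, finiteHamiltonian Λ (Function.update ω n (t * ω n)) =
      finiteHamiltonian Λ (Function.update ω n 0) +
        t • Matrix.single n n ((ω n : ℝ) : ℂ) := by
    intro t
    have h := finiteHamiltonian_update Λ (Function.update ω n 0) n (t * ω n)
    rw [Function.update_self, zero_add, Function.update_idem] at h
    rw [h, Matrix.smul_single]
    congr 2
    simp
  have h1 : finiteHamiltonian Λ ω = finiteHamiltonian Λ (Function.update ω n 0) +
      Matrix.single n n ((ω n : ℝ) : ℂ) := by
    have h := key 1
    rwa [one_mul, Function.update_eq_self, one_smul] at h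
  rw [traceStatistic_eq, traceStatistic_eq, h1,
    trace_cfc_sub (isHermitian_finiteHamiltonian Λ _) n (ω n) hf hf']
  refine intervalIntegral.integral_congr fun t _ => ?_
  rw [← key, cfc_finiteHamiltonian_apply_self, translate_update_mul]

/-- The Cauchy–Schwarz inequality, for the integral over `t` and for that over the spectral measure.
-/
theorem enorm_traceStatistic_sub_update_sq_le {f : ℝ → ℝ} (hf : Differentiable ℝ f)
    (hf' : Continuous (deriv f)) (Λ : Finset (Fin d → ℤ)) (n : Λ) (ω : (Fin d → ℤ) → ℝ) :
    ‖traceStatistic f Λ ω - traceStatistic f Λ (Function.update ω n 0)‖ₑ ^ 2 ≤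
      ∫⁻ t in Set.Icc (0 : ℝ) 1, ENNReal.ofReal (translate n ω 0 ^ 2) *
        ENNReal.ofReal (∫ x, deriv f x ^ 2
          ∂(finiteMeasure (translateFinset Λ n) (rescaleZero t (translate n ω)))) := by
  set m : ℝ → Measure ℝ := fun t =>
    finiteMeasure (translateFinset Λ n) (rescaleZero t (translate n ω)) with hm
  have hprob : IsProbabilityMeasure (volume.restrict (Set.Icc (0 : ℝ) 1)) := ⟨by simp⟩
  have hcont : Continuous fun t => ω n * ∫ x, deriv f x ∂(m t) :=
    continuous_const.mul ((continuous_integral_finiteMeasure _ hf').comp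
      (continuous_rescaleZero.comp (Continuous.prodMk_left _)))
  have hmem : MemLp (fun t => ω n * ∫ x, deriv f x ∂(m t)) 2
      (volume.restrict (Set.Icc (0 : ℝ) 1)) := by
    rw [memLp_two_iff_integrable_sq hcont.aestronglyMeasurable]
    exact (hcont.pow 2).continuousOn.integrableOn_compact isCompact_Icc
  rw [traceStatistic_sub_update hf hf', intervalIntegral.integral_of_le zero_le_one,
    ← integral_Icc_eq_integral_Ioc, enorm_sq_eq_ofReal]
  refine (ENNReal.ofReal_le_ofReal (sq_integral_le_integral_sq hmem)).trans ?_
  rw [ofReal_integral_sq hmem]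
  refine lintegral_mono fun t => ?_
  rw [← ENNReal.ofReal_mul (sq_nonneg _)]
  refine ENNReal.ofReal_le_ofReal ?_
  have h0 : translate (n : Fin d → ℤ) ω 0 = ω n := by simp [translate]
  rw [h0, mul_pow]
  refine mul_le_mul_of_nonneg_left ?_ (sq_nonneg _)
  refine sq_integral_le_integral_sq ?_
  rw [memLp_two_iff_integrable_sq hf'.aestronglyMeasurable]
  exact integrable_finiteMeasure _ _ _

theorem memLp_traceStatistic (hμ : ∀ k : ℕ, Integrable (fun x => |x| ^ k) μ) {f : ℝ → ℝ}
    (hf : Continuous f) {C : ℝ} {p : ℕ} (hC : 0 ≤ C) (hfC : ∀ x, |f x| ≤ C * (1 + x ^ 2) ^ p)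
    (Λ : Finset (Fin d → ℤ)) : MemLp (traceStatistic f Λ) 2 (law d μ) :=
  memLp_finsetSum _ fun n _ => memLp_diagonalEntry hμ hf hC hfC Λ n

/-- The variance of `Tr f(H_Λ)` is at most a sum of local contributions, by the Efron–Stein
inequality with the reference value `0` for the potential: scaling `ω_n` down to `0` produces the
average over `u` in the definition of `ν̄`. -/
theorem lintegral_traceStatistic_le (hμ : ∀ k : ℕ, Integrable (fun x => |x| ^ k) μ) {f : ℝ → ℝ}
    (hf : Differentiable ℝ f) (hf' : Continuous (deriv f)) {C : ℝ} {p : ℕ} (hC : 0 ≤ C)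
    (hfC : ∀ x, |f x| ≤ C * (1 + x ^ 2) ^ p) (Λ : Finset (Fin d → ℤ)) :
    ∫⁻ ω, ‖traceStatistic f Λ ω - ∫ ω', traceStatistic f Λ ω' ∂(law d μ)‖ₑ ^ 2 ∂(law d μ) ≤
      ∑ n ∈ Λ, averagedMoment μ (fun x => deriv f x ^ 2) (translateFinset Λ n) := by
  have hcont : Continuous (traceStatistic f Λ) :=
    continuous_finsetSum _ fun n _ => continuous_diagonalEntry hf.continuous Λ n
  have hdep : DependsOn (traceStatistic f Λ) (Λ : Set (Fin d → ℤ)) := by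
    intro ω ω' h
    rw [traceStatistic_eq, traceStatistic_eq, finiteHamiltonian_congr Λ h]
  refine (lintegral_sub_mean_sq_le_sum Λ hcont.stronglyMeasurable
    (memLp_traceStatistic hμ hf.continuous hC hfC Λ) hdep 0).trans
    (Finset.sum_le_sum fun n hn => ?_)
  have h1 : averagedMoment μ (fun x => deriv f x ^ 2) (translateFinset Λ n) =
      ∫⁻ ω, (∫⁻ t in Set.Icc (0 : ℝ) 1, ENNReal.ofReal (ω 0 ^ 2) *
        ENNReal.ofReal (∫ x, deriv f x ^ 2
          ∂(finiteMeasure (translateFinset Λ n) (rescaleZero t ω)))) ∂(law d μ) :=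
    lintegral_prod_symm _ (measurable_averagedMoment_integrand (hf'.pow 2) _).aemeasurable
  have h2 : Measurable fun ω : (Fin d → ℤ) → ℝ =>
      ∫⁻ t in Set.Icc (0 : ℝ) 1, ENNReal.ofReal (ω 0 ^ 2) *
        ENNReal.ofReal (∫ x, deriv f x ^ 2
          ∂(finiteMeasure (translateFinset Λ n) (rescaleZero t ω))) :=
    (measurable_averagedMoment_integrand (hf'.pow 2) _).lintegral_prod_left'
  rw [h1, ← (measurePreserving_translate (μ := μ) n).lintegral_comp h2]
  exact lintegral_mono fun ω => enorm_traceStatistic_sub_update_sq_le hf hf' Λ ⟨n, hn⟩ ω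

end Variance

/-! ### The thermodynamic limit -/

section ThermodynamicLimit

variable {d : ℕ}

theorem card_box (d L : ℕ) : (box d L).card = (2 * L + 1) ^ d := by
  unfold box
  rw [Pi.card_Icc]
  simp only [Int.card_Icc, Finset.prod_const, Finset.card_univ, Fintype.card_fin]
  congr 1
  omega

theorem box_subset_translateFinset {L K : ℕ} {n : Fin d → ℤ} (hn : n ∈ box d L) :
    box d K ⊆ translateFinset (box d (L + K)) n := by
  intro k hk
  rw [mem_translateFinset, mem_box]
  intro i
  have h1 := mem_box.1 hn i
  have h2 := mem_box.1 hk i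
  rw [Pi.add_apply]
  push_cast
  have := abs_add_le (k i) (n i)
  omega

theorem exists_subset_box (Λ : Finset (Fin d → ℤ)) : ∃ K, Λ ⊆ box d K := by
  refine ⟨Λ.sup fun n => ∑ i, (n i).natAbs, fun n hn => mem_box.2 fun i => ?_⟩
  have h1 : (n i).natAbs ≤ ∑ i, (n i).natAbs :=
    Finset.single_le_sum (f := fun i => (n i).natAbs) (fun _ _ => Nat.zero_le _)
      (Finset.mem_univ i)
  have h2 := Finset.le_sup (f := fun n : Fin d → ℤ => ∑ i, (n i).natAbs) hn
  rw [Int.abs_eq_natAbs]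
  exact_mod_cast h1.trans h2

theorem tendsto_card_box_div (d K : ℕ) :
    Tendsto (fun L : ℕ => ((box d L).card : ℝ) / (box d (L + K)).card) atTop (nhds 1) := by
  have h1 : Tendsto (fun L : ℕ => (2 * (L : ℝ) + 1) / (2 * ((L + K : ℕ) : ℝ) + 1)) atTop
      (nhds 1) := by
    have e : ∀ L : ℕ, (2 * (L : ℝ) + 1) / (2 * ((L + K : ℕ) : ℝ) + 1) =
        1 - (2 * K : ℝ) / (2 * ((L + K : ℕ) : ℝ) + 1) := by
      intro L
      have : (2 * ((L + K : ℕ) : ℝ) + 1) ≠ 0 := by positivity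
      field_simp
      push_cast
      ring
    simp_rw [e]
    have h2 : Tendsto (fun L : ℕ => 2 * ((L + K : ℕ) : ℝ) + 1) atTop atTop := by
      refine tendsto_atTop_add_const_right _ _ (Tendsto.const_mul_atTop two_pos ?_)
      exact tendsto_natCast_atTop_atTop.comp (tendsto_add_atTop_nat K)
    have h3 := (h2.const_div_atTop (2 * K : ℝ)).const_sub 1
    rwa [sub_zero] at h3
  have h4 := h1.pow d
  rw [one_pow] at h4
  refine h4.congr fun L => ?_
  rw [card_box, card_box, div_pow]
  push_cast
  rfl

/-- Cesàro averages over the boxes `Λ_L` of a bounded function of `Λ_L - n` that converges along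
the finite subsets of the lattice. Only the sites near the boundary do not see the limit. -/
theorem limsup_average_le {a : Finset (Fin d → ℤ) → ℝ≥0∞} {ℓ B : ℝ≥0∞} (hB : B ≠ ∞)
    (ha : ∀ Λ, a Λ ≤ B) (hlim : Tendsto a atTop (nhds ℓ)) :
    limsup (fun L : ℕ => ((box d L).card : ℝ≥0∞)⁻¹ *
      ∑ n ∈ box d L, a (translateFinset (box d L) n)) atTop ≤ ℓ := by
  have hℓ : ℓ ≠ ∞ := ne_top_of_le_ne_top hB (le_of_tendsto hlim (Eventually.of_forall ha))
  refine le_of_forall_gt_imp_ge_of_dense fun b hb => ?_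
  obtain ⟨Λ₀, hΛ₀⟩ := eventually_atTop.1 (hlim.eventually (gt_mem_nhds hb))
  obtain ⟨K, hK⟩ := exists_subset_box Λ₀
  rw [← limsup_nat_add _ K]
  have hcard : ∀ L, ((box d L).card : ℝ≥0∞) ≠ 0 := fun L => by
    rw [card_box]
    positivity
  have key : ∀ L : ℕ, ((box d (L + K)).card : ℝ≥0∞)⁻¹ *
      ∑ n ∈ box d (L + K), a (translateFinset (box d (L + K)) n) ≤
      b + B * ENNReal.ofReal (1 - ((box d L).card : ℝ) / (box d (L + K)).card) := by
    intro L
    have hsub : box d L ⊆ box d (L + K) := box_subset_box (Nat.le_add_right L K)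
    have hpos : (0 : ℝ) < (box d (L + K)).card := by
      rw [card_box]
      positivity
    have h1 : ∑ n ∈ box d (L + K), a (translateFinset (box d (L + K)) n) ≤
        (box d (L + K)).card * b + ((box d (L + K) \ box d L).card : ℝ≥0∞) * B := by
      rw [← Finset.sum_sdiff hsub, add_comm]
      refine add_le_add ?_ ?_
      · calc _ ≤ ∑ n ∈ box d L, b := Finset.sum_le_sum fun n hn =>
              (hΛ₀ _ (hK.trans (box_subset_translateFinset hn))).le
          _ = (box d L).card * b := by rw [Finset.sum_const, nsmul_eq_mul]
          _ ≤ _ := by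
              have := Finset.card_le_card hsub
              gcongr
      · calc _ ≤ ∑ n ∈ box d (L + K) \ box d L, B := Finset.sum_le_sum fun n hn => ha _
          _ = _ := by rw [Finset.sum_const, nsmul_eq_mul]
    have h2 : ENNReal.ofReal (1 - ((box d L).card : ℝ) / (box d (L + K)).card) =
        ((box d (L + K)).card : ℝ≥0∞)⁻¹ * ((box d (L + K) \ box d L).card : ℝ≥0∞) := by
      have e : 1 - ((box d L).card : ℝ) / (box d (L + K)).card =
          ((box d (L + K)).card : ℝ)⁻¹ * ((box d (L + K) \ box d L).card : ℝ) := by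
        rw [Finset.card_sdiff_of_subset hsub, Nat.cast_sub (Finset.card_le_card hsub)]
        field_simp
      rw [e, ENNReal.ofReal_mul (by positivity), ENNReal.ofReal_inv_of_pos hpos,
        ENNReal.ofReal_natCast, ENNReal.ofReal_natCast]
    calc _ ≤ ((box d (L + K)).card : ℝ≥0∞)⁻¹ *
          ((box d (L + K)).card * b + ((box d (L + K) \ box d L).card : ℝ≥0∞) * B) := by gcongr
      _ = b + B * ENNReal.ofReal (1 - ((box d L).card : ℝ) / (box d (L + K)).card) := by
          rw [h2, mul_add, ← mul_assoc, ENNReal.inv_mul_cancel (hcard _) (by simp), one_mul]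
          ring
  have hlim2 : Tendsto (fun L : ℕ =>
      b + B * ENNReal.ofReal (1 - ((box d L).card : ℝ) / (box d (L + K)).card)) atTop (nhds b) := by
    have h1 := (tendsto_card_box_div d K).const_sub 1
    rw [sub_self] at h1
    have h2 := ENNReal.tendsto_ofReal h1
    rw [ENNReal.ofReal_zero] at h2
    have h3 := (ENNReal.Tendsto.const_mul h2 (Or.inr hB)).const_add b
    rwa [mul_zero, add_zero] at h3
  calc _ ≤ limsup (fun L : ℕ =>
        b + B * ENNReal.ofReal (1 - ((box d L).card : ℝ) / (box d (L + K)).card)) atTop :=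
        limsup_le_limsup (Eventually.of_forall key)
    _ = b := hlim2.limsup_eq

variable {μ : Measure ℝ} [IsProbabilityMeasure μ]

theorem fluctuation_eq (f : ℝ → ℝ) (L : ℕ)
    (hint : ∀ n : box d L, Integrable (diagEntry f L n) (law d μ)) (ω : (Fin d → ℤ) → ℝ) :
    fluctuation d μ f L ω = (1 / Real.sqrt ((box d L).card : ℝ)) *
      (traceStatistic f (box d L) ω - ∫ ω', traceStatistic f (box d L) ω' ∂(law d μ)) := by
  unfold fluctuation traceStatistic
  rw [Finset.sum_sub_distrib, ← integral_finsetSum _ fun n _ => hint n]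
  rfl

theorem lintegral_fluctuation_sq (f : ℝ → ℝ) (L : ℕ)
    (hint : ∀ n : box d L, Integrable (diagEntry f L n) (law d μ)) :
    ∫⁻ ω, ‖fluctuation d μ f L ω‖ₑ ^ 2 ∂(law d μ) = ((box d L).card : ℝ≥0∞)⁻¹ *
      ∫⁻ ω, ‖traceStatistic f (box d L) ω - ∫ ω', traceStatistic f (box d L) ω' ∂(law d μ)‖ₑ ^ 2
        ∂(law d μ) := by
  have hpos : (0 : ℝ) < (box d L).card := by
    rw [card_box]
    positivity
  have h : ‖(1 / Real.sqrt ((box d L).card : ℝ))‖ₑ ^ 2 = ((box d L).card : ℝ≥0∞)⁻¹ := by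
    rw [enorm_sq_eq_ofReal, div_pow, one_pow, Real.sq_sqrt hpos.le, one_div,
      ENNReal.ofReal_inv_of_pos hpos, ENNReal.ofReal_natCast]
  rw [← lintegral_const_mul' _ _ (ENNReal.inv_ne_top.2 (by rw [card_box]; positivity))]
  refine lintegral_congr fun ω => ?_
  rw [fluctuation_eq f L hint, enorm_mul, mul_pow, h]

/-- The variance bound for the normalized trace. -/
theorem limsupVariance_le (hμ : ∀ k : ℕ, Integrable (fun x => |x| ^ k) μ) {f : ℝ → ℝ}
    (hf : Differentiable ℝ f) (hf' : Continuous (deriv f)) {C : ℝ} {p : ℕ} (hC : 0 ≤ C)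
    (hfC : ∀ x, |f x| ≤ C * (1 + x ^ 2) ^ p) {ℓ B : ℝ≥0∞} (hB : B ≠ ∞)
    (hbound : ∀ Λ : Finset (Fin d → ℤ), averagedMoment μ (fun x => deriv f x ^ 2) Λ ≤ B)
    (hlim : Tendsto (averagedMoment (d := d) μ fun x => deriv f x ^ 2) atTop (nhds ℓ)) :
    limsupVariance d μ f ≤ ℓ := by
  have hint : ∀ L : ℕ, ∀ n : box d L, Integrable (diagEntry f L n) (law d μ) := fun L n =>
    (memLp_diagonalEntry hμ hf.continuous hC hfC (box d L) n).integrable (by norm_num)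
  have h1 : ∀ L : ℕ, ∫⁻ ω, ‖fluctuation d μ f L ω‖ₑ ^ 2 ∂(law d μ) ≤
      ((box d L).card : ℝ≥0∞)⁻¹ * ∑ n ∈ box d L,
        averagedMoment μ (fun x => deriv f x ^ 2) (translateFinset (box d L) n) := by
    intro L
    rw [lintegral_fluctuation_sq f L (hint L)]
    exact mul_le_mul_right (lintegral_traceStatistic_le hμ hf hf' hC hfC (box d L)) _
  exact (limsup_le_limsup (Eventually.of_forall h1)).trans (limsup_average_le hB hbound hlim)

end ThermodynamicLimit

end Anderson

open Anderson in
theorem proposition2p2 (d : ℕ) (hd : 1 ≤ d) (μ : MeasureTheory.Measure ℝ)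
    [MeasureTheory.IsProbabilityMeasure μ] (hμ : Anderson.MomentHypothesis μ)
    (f : ℝ → ℝ) (hf : Anderson.IsC1P f) :
    (∀ L : ℕ, ∀ n : Anderson.box d L,
      MeasureTheory.Integrable (Anderson.diagEntry f L n) (Anderson.law d μ)) ∧
    (∀ L : ℕ, MeasureTheory.MemLp (Anderson.fluctuation d μ f L) 2 (Anderson.law d μ)) ∧
    0 ≤ Anderson.limsupVariance d μ f ∧
    Anderson.limsupVariance d μ f
      ≤ 8 * MeasureTheory.eLpNorm (deriv f) 2 (Anderson.modifiedDOS d μ) ^ 2 ∧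
    8 * MeasureTheory.eLpNorm (deriv f) 2 (Anderson.modifiedDOS d μ) ^ 2 < ⊤ := by
  obtain ⟨hf1, hf2, P, hP⟩ := hf
  have hmom := hμ.1
  obtain ⟨C, p, hC, hCp⟩ := exists_polynomial_bound P
  have hder : ∀ x, |deriv f x| ≤ C * (1 + x ^ 2) ^ p := fun x => (hP x).trans (hCp x)
  have hfC := abs_le_of_abs_deriv_le hf1 hC hder
  have hC' : 0 ≤ |f 0| + C := by positivity
  have hsq : ∀ x, |deriv f x ^ 2| ≤ C ^ 2 * (1 + x ^ 2) ^ (2 * p) := by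
    intro x
    rw [abs_pow, mul_comm 2 p, pow_mul, ← mul_pow]
    exact pow_le_pow_left₀ (abs_nonneg _) (hder x) 2
  have hint : ∀ L : ℕ, ∀ n : box d L, Integrable (diagEntry f L n) (law d μ) := fun L n =>
    (memLp_diagonalEntry hmom hf1.continuous hC' hfC (box d L) n).integrable (by norm_num)
  have hnorm : eLpNorm (deriv f) 2 (modifiedDOS d μ) ^ 2 =
      ∫⁻ x, ENNReal.ofReal (deriv f x ^ 2) ∂(modifiedDOS d μ) := by
    have h := eLpNorm_nnreal_pow_eq_lintegral (f := deriv f) (μ := modifiedDOS d μ)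
      (p := 2) two_ne_zero
    simp only [NNReal.coe_ofNat, ENNReal.rpow_ofNat, ENNReal.coe_ofNat] at h
    rw [h]
    exact lintegral_congr fun x => enorm_sq_eq_ofReal _
  obtain ⟨⟨B, hB, hbound⟩, hlim⟩ := tendsto_averagedMoment (d := d) (μ := μ)
    (g := fun x => deriv f x ^ 2) hmom (hf2.pow 2)
    (fun x => sq_nonneg (deriv f x)) (sq_nonneg C) hsq
  refine ⟨hint, fun L => ?_, zero_le, ?_, ?_⟩
  · have h := ((memLp_traceStatistic hmom hf1.continuous hC' hfC (box d L)).sub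
      (memLp_const (∫ ω', traceStatistic f (box d L) ω' ∂(law d μ)))).const_mul
      (1 / Real.sqrt ((box d L).card : ℝ))
    exact (memLp_congr_ae (Eventually.of_forall (fluctuation_eq f L (hint L)))).2 h
  · rw [hnorm]
    exact (limsupVariance_le hmom hf1 hf2 hC' hfC hB hbound hlim).trans 
      (le_mul_of_one_le_left zero_le (by norm_num))
  · rw [hnorm]
    exact ENNReal.mul_lt_top (by simp)
      ((le_of_tendsto hlim (Eventually.of_forall hbound)).trans_lt hB.lt_top)

end
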